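/- Let $n\ge 2$, $\gamma<2$, $r_0>0$, and let $g:(0,\infty)\to(0,\infty)$ be continuous with $$\liminf_{s\searrow 0}\, s^{-(n+1-\gamma)/(n-1)}\,g(s)>0\qquad\text{and}\qquad \liminf_{s\to\infty}\, s^{1-\gamma}\,g(s)>0$$ (each lower limit may be $+\infty$). Let $\Omega=\{x\in\mathbb{R}^n: x_n>0,\ |x|>r_0\}$. Then the equation $$-\Delta u=|x|^{-\gamma}g(u)\quad\text{in }\Omega$$ has no positive supersolution, whether classical, weak or viscosity. That is, there is no function $u:\Omega\to\mathbb{R}$ of any of the following three kinds: 1. (classical) $u\in C^2(\Omega)$, $u>0$ in $\Omega$, and $-\Delta u(x)\ge |x|^{-\gamma}g(u(x))$ for all $x\in\Omega$; 2. (weak) $u\in W^{1,2}_{\mathrm{loc}}(\Omega)$, $u>0$ almost everywhere in $\Omega$, and $$\int_\Omega Du\cdot D\varphi\,dx\ \ge\ \int_\Omega |x|^{-\gamma}g(u)\,\varphi\,dx$$ for every nonnegative $\varphi\in C_0^\infty(\Omega)$ (in particular the right-hand integral is finite); 3. (viscosity) $u$ is real-valued and lower semicontinuous, $u>0$ in $\Omega$,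 and whenever $x_0\in\Omega$, $\varphi\in C^2(\Omega)$ and $u-\varphi$ has a local minimum at $x_0$, one has $-\Delta\varphi(x_0)\ge |x_0|^{-\gamma}g(u(x_0))$. -/

import Mathlib

open Set Filter Topology MeasureTheory
open scoped ContDiff

/-- The open half space `{x ∈ ℝⁿ : xₙ > 0}`, where `xₙ` is the last coordinate. -/
def upperHalfSpace (n : ℕ) : Set (EuclideanSpace ℝ (Fin n)) :=
  {x | ∃ i : Fin n, (i : ℕ) + 1 = n ∧ 0 < x i}

/-- Real-valued `C^∞` functions with compact support contained in `Ω`. -/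
structure IsTestFunctionOn {n : ℕ} (Ω : Set (EuclideanSpace ℝ (Fin n)))
    (φ : EuclideanSpace ℝ (Fin n) → ℝ) : Prop where
  contDiff : ContDiff ℝ ∞ φ
  hasCompactSupport : HasCompactSupport φ
  tsupport_subset : tsupport φ ⊆ Ω

/-- `V` is the weak gradient of `u` in `Ω`: `∫_Ω u ∂ᵢφ = -∫_Ω Vᵢ φ` for all test functions `φ`
and all `i`. It is used below only for locally integrable `u` and `V`. -/
def IsWeakGradientOn {n : ℕ} (Ω : Set (EuclideanSpace ℝ (Fin n)))
    (u : EuclideanSpace ℝ (Fin n) → ℝ)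
    (V : EuclideanSpace ℝ (Fin n) → EuclideanSpace ℝ (Fin n)) : Prop :=
  ∀ φ : EuclideanSpace ℝ (Fin n) → ℝ, IsTestFunctionOn Ω φ → ∀ i : Fin n,
    ∫ x in Ω, u x * fderiv ℝ φ x (EuclideanSpace.single i 1) = -∫ x in Ω, V x i * φ x

/-- `u ∈ W^{1,2}_loc(Ω)` with weak gradient `V`. -/
structure IsW12LocWithGradient {n : ℕ} (Ω : Set (EuclideanSpace ℝ (Fin n)))
    (u : EuclideanSpace ℝ (Fin n) → ℝ)
    (V : EuclideanSpace ℝ (Fin n) → EuclideanSpace ℝ (Fin n)) : Prop where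
  memLp : ∀ K : Set (EuclideanSpace ℝ (Fin n)), IsCompact K → K ⊆ Ω →
    MemLp u 2 (volume.restrict K)
  memLp_gradient : ∀ K : Set (EuclideanSpace ℝ (Fin n)), IsCompact K → K ⊆ Ω →
    MemLp V 2 (volume.restrict K)
  isWeakGradient : IsWeakGradientOn Ω u V

/-- Classical supersolution of `-Δu = f(u, x)` in the open set `Ω`. -/
structure IsClassicalSupersolution {n : ℕ} (Ω : Set (EuclideanSpace ℝ (Fin n)))
    (f : ℝ → EuclideanSpace ℝ (Fin n) → ℝ) (u : EuclideanSpace ℝ (Fin n) → ℝ) : Prop where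
  contDiffOn : ContDiffOn ℝ 2 u Ω
  le_neg_laplacian : ∀ x ∈ Ω, f (u x) x ≤ -(Laplacian.laplacian u x)

/-- Weak (Sobolev) supersolution of `-Δu = f(u, x)` in the open set `Ω`: `u ∈ W^{1,2}_loc(Ω)` and
`∫_Ω Du · Dφ ≥ ∫_Ω f(u, x) φ` for every nonnegative test function `φ`. For `f ≥ 0` the right-hand
side is an integral in `[0, ∞]`, and the inequality forces it to be finite; this is the
integrability clause. -/
def IsWeakSupersolution {n : ℕ} (Ω : Set (EuclideanSpace ℝ (Fin n)))
    (f : ℝ → EuclideanSpace ℝ (Fin n) → ℝ) (u : EuclideanSpace ℝ (Fin n) → ℝ) : Prop :=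
  ∃ V : EuclideanSpace ℝ (Fin n) → EuclideanSpace ℝ (Fin n),
    IsW12LocWithGradient Ω u V ∧
    ∀ φ : EuclideanSpace ℝ (Fin n) → ℝ, IsTestFunctionOn Ω φ → (∀ x, 0 ≤ φ x) →
      IntegrableOn (fun x => f (u x) x * φ x) Ω ∧
      ∫ x in Ω, f (u x) x * φ x ≤ ∫ x in Ω, inner ℝ (V x) (gradient φ x)

/-- Viscosity supersolution of `-Δu = f(u, x)` in the open set `Ω`: a lower semicontinuous `u` such
that `-Δφ(x₀) ≥ f(u(x₀), x₀)` whenever `φ ∈ C²(Ω)` and `u - φ` has a local minimum at `x₀ ∈ Ω`. -/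
structure IsViscositySupersolution {n : ℕ} (Ω : Set (EuclideanSpace ℝ (Fin n)))
    (f : ℝ → EuclideanSpace ℝ (Fin n) → ℝ) (u : EuclideanSpace ℝ (Fin n) → ℝ) : Prop where
  lowerSemicontinuousOn : LowerSemicontinuousOn u Ω
  le_neg_laplacian : ∀ x₀ ∈ Ω, ∀ φ : EuclideanSpace ℝ (Fin n) → ℝ, ContDiffOn ℝ 2 φ Ω →
    IsLocalMin (fun x => u x - φ x) x₀ → f (u x₀) x₀ ≤ -(Laplacian.laplacian φ x₀)

/-!
All three notions of supersolution obey one comparison principle: if `u` dominates `ψ` near the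
boundary of a bounded set and the source lies above `-Δψ` where `u < ψ`, then `u ≥ ψ` inside,
everywhere for viscosity and almost everywhere for weak supersolutions.

Comparison with the half-space solution `xₙ|x|⁻ⁿ` bounds `u` from below at infinity. Up to values
of `u` of order one the source is critical for this solution, so a barrier with an additional
logarithm improves the bound by `log |x|`. On cones this gain, fed back through the bump functions
of large balls, doubles the bound again and again until `u ≥ η|x|`. Linear growth makes the source
critical at infinity as well: comparison with `xₙ` and its logarithmic corrections then pushes `u`
above every constant, which is impossible.
-/

open scoped Laplacian Gradient RealInnerProductSpace

/-- The Euclidean space `ℝⁿ`. -/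
abbrev Eucl (n : ℕ) := EuclideanSpace ℝ (Fin n)

/-! ### Calculus of the Laplacian -/

section Laplacian

variable {E : Type*} [NormedAddCommGroup E] [InnerProductSpace ℝ E]
  {f g : E → ℝ} {x : E}

theorem differentiableAt_fderiv_of_contDiffAt_two (h : ContDiffAt ℝ 2 f x) :
    DifferentiableAt ℝ (fderiv ℝ f) x :=
  (h.fderiv_right (m := 1) (by norm_num)).differentiableAt (by norm_num)

theorem eventually_differentiableAt_of_contDiffAt_two (h : ContDiffAt ℝ 2 f x) :
    ∀ᶠ y in 𝓝 x, DifferentiableAt ℝ f y :=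
  (h.eventually (by simp)).mono fun _ hy => hy.differentiableAt (by norm_num)

theorem deriv_deriv_nonneg_of_isLocalMin {φ : ℝ → ℝ} {t : ℝ} (hmin : IsLocalMin φ t)
    (hφ : ContinuousAt φ t) : 0 ≤ deriv (deriv φ) t := by
  by_contra! hneg
  have hmax := isLocalMax_of_deriv_deriv_neg hneg hmin.deriv_eq_zero hφ
  have hconst : φ =ᶠ[𝓝 t] fun _ => φ t := by
    filter_upwards [hmin, hmax] with s h₁ h₂ using le_antisymm h₂ h₁
  have hzero : deriv (deriv φ) t = 0 := by
    rw [hconst.deriv.deriv_eq]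
    simp
  exact hneg.ne hzero

theorem deriv_deriv_comp_line (h : ContDiffAt ℝ 2 f x) (v : E) :
    deriv (deriv fun t : ℝ => f (x + t • v)) 0 = fderiv ℝ (fun y => fderiv ℝ f y v) x v := by
  have hline : ∀ t : ℝ, HasDerivAt (fun s : ℝ => x + s • v) v t := fun t => by
    simpa using ((hasDerivAt_id t).smul_const v).const_add x
  have hzero : x + (0 : ℝ) • v = x := by simp
  have hderiv : (deriv fun t : ℝ => f (x + t • v)) =ᶠ[𝓝 0] fun t => fderiv ℝ f (x + t • v) v := by
    have htend : Tendsto (fun s : ℝ => x + s • v) (𝓝 0) (𝓝 x) := by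
      simpa using (hline 0).continuousAt.tendsto
    filter_upwards [htend.eventually (eventually_differentiableAt_of_contDiffAt_two h)] with t ht
    exact (ht.hasFDerivAt.comp_hasDerivAt t (hline t)).deriv
  have hd : HasFDerivAt (fun y => fderiv ℝ f y v) (fderiv ℝ (fun y => fderiv ℝ f y v) x)
      (x + (0 : ℝ) • v) := by
    rw [hzero]
    exact ((differentiableAt_fderiv_of_contDiffAt_two h).clm_apply
      (differentiableAt_const _)).hasFDerivAt
  exact ((hd.comp_hasDerivAt (0 : ℝ) (hline 0)).congr_of_eventuallyEq hderiv).deriv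

variable [FiniteDimensional ℝ E] {ι : Type*} [Fintype ι]

theorem laplacian_eq_sum_fderiv_fderiv (b : OrthonormalBasis ι ℝ E)
    (h : DifferentiableAt ℝ (fderiv ℝ f) x) :
    Δ f x = ∑ i, fderiv ℝ (fun y => fderiv ℝ f y (b i)) x (b i) := by
  rw [InnerProductSpace.laplacian_eq_iteratedFDeriv_orthonormalBasis f b]
  refine Finset.sum_congr rfl fun i _ => ?_
  rw [iteratedFDeriv_two_apply, fderiv_clm_apply h (differentiableAt_const _)]
  simp

theorem sum_fderiv_mul_fderiv (b : OrthonormalBasis ι ℝ E) (f g : E → ℝ) (x : E) :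
    ∑ i, fderiv ℝ f x (b i) * fderiv ℝ g x (b i) = ⟪∇ f x, ∇ g x⟫ := by
  simp only [← inner_gradient_left, real_inner_comm (b _) (∇ g x)]
  simpa only [real_inner_comm] using b.sum_inner_mul_inner (∇ f x) (∇ g x)

theorem laplacian_mul (hf : ContDiffAt ℝ 2 f x) (hg : ContDiffAt ℝ 2 g x) :
    Δ (fun y => f y * g y) x = f x * Δ g x + 2 * ⟪∇ f x, ∇ g x⟫ + g x * Δ f x := by
  have hf' := differentiableAt_fderiv_of_contDiffAt_two hf
  have hg' := differentiableAt_fderiv_of_contDiffAt_two hg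
  have hfd := hf.differentiableAt two_ne_zero
  have hgd := hg.differentiableAt two_ne_zero
  set b := stdOrthonormalBasis ℝ E
  rw [laplacian_eq_sum_fderiv_fderiv b (differentiableAt_fderiv_of_contDiffAt_two (hf.mul hg)),
    laplacian_eq_sum_fderiv_fderiv b hf', laplacian_eq_sum_fderiv_fderiv b hg',
    ← sum_fderiv_mul_fderiv b, Finset.mul_sum, Finset.mul_sum, Finset.mul_sum,
    ← Finset.sum_add_distrib, ← Finset.sum_add_distrib]
  refine Finset.sum_congr rfl fun i _ => ?_
  have hfi : DifferentiableAt ℝ (fun y => fderiv ℝ f y (b i)) x :=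
    hf'.clm_apply (differentiableAt_const _)
  have hgi : DifferentiableAt ℝ (fun y => fderiv ℝ g y (b i)) x :=
    hg'.clm_apply (differentiableAt_const _)
  have hmul : (fun y => fderiv ℝ (fun z => f z * g z) y (b i)) =ᶠ[𝓝 x]
      fun y => f y * fderiv ℝ g y (b i) + g y * fderiv ℝ f y (b i) := by
    filter_upwards [eventually_differentiableAt_of_contDiffAt_two hf,
      eventually_differentiableAt_of_contDiffAt_two hg] with y hfy hgy
    rw [fderiv_fun_mul hfy hgy]
    rfl
  rw [hmul.fderiv_eq, fderiv_fun_add (hfd.fun_mul hgi) (hgd.fun_mul hfi), fderiv_fun_mul hfd hgi,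
    fderiv_fun_mul hgd hfi]
  simp only [add_apply, smul_apply, smul_eq_mul]
  ring

theorem laplacian_comp {F F' : ℝ → ℝ} {F'' : ℝ} (hf : ContDiffAt ℝ 2 f x)
    (hF : ∀ᶠ s in 𝓝 (f x), HasDerivAt F (F' s) s) (hF' : HasDerivAt F' F'' (f x)) :
    Δ (fun y => F (f y)) x = F'' * ‖∇ f x‖ ^ 2 + F' (f x) * Δ f x := by
  have hfd := hf.differentiableAt two_ne_zero
  have hf' := differentiableAt_fderiv_of_contDiffAt_two hf
  have hcomp : fderiv ℝ (fun y => F (f y)) =ᶠ[𝓝 x] fun y => F' (f y) • fderiv ℝ f y := by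
    filter_upwards [eventually_differentiableAt_of_contDiffAt_two hf,
      hf.continuousAt.eventually hF] with y hy hFy
    exact (hFy.comp_hasFDerivAt y hy.hasFDerivAt).fderiv
  have hF'f : HasFDerivAt (fun y => F' (f y)) (F'' • fderiv ℝ f x) x :=
    hF'.comp_hasFDerivAt x hfd.hasFDerivAt
  set b := stdOrthonormalBasis ℝ E
  rw [laplacian_eq_sum_fderiv_fderiv b
      ((hF'f.differentiableAt.smul hf').congr_of_eventuallyEq hcomp),
    laplacian_eq_sum_fderiv_fderiv b hf', ← real_inner_self_eq_norm_sq,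
    ← sum_fderiv_mul_fderiv b, Finset.mul_sum, Finset.mul_sum, ← Finset.sum_add_distrib]
  refine Finset.sum_congr rfl fun i _ => ?_
  have hcompi : (fun y => fderiv ℝ (fun z => F (f z)) y (b i)) =ᶠ[𝓝 x]
      fun y => F' (f y) * fderiv ℝ f y (b i) :=
    hcomp.mono fun y hy => congrArg (fun ℓ => ℓ (b i)) hy
  rw [hcompi.fderiv_eq, fderiv_fun_mul hF'f.differentiableAt
    (hf'.clm_apply (differentiableAt_const _)), hF'f.fderiv]
  simp only [add_apply, smul_apply, smul_eq_mul]
  ring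

theorem laplacian_comp_sub (f : E → ℝ) (p x : E) : Δ (fun y => f (y - p)) x = Δ f (x - p) := by
  simp only [InnerProductSpace.laplacian_eq_iteratedFDeriv_stdOrthonormalBasis,
    iteratedFDeriv_comp_sub]

theorem laplacian_comp_add_smul (hf : ContDiff ℝ 2 f) (p : E) (t : ℝ) (x : E) :
    Δ (fun y => f (p + t • y)) x = t ^ 2 * Δ f (p + t • x) := by
  have hderiv : iteratedFDeriv ℝ 2 (fun y => f (p + t • y)) x =
      t ^ 2 • iteratedFDeriv ℝ 2 f (p + t • x) := by
    rw [← iteratedFDeriv_comp_add_left 2 p (t • x)]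
    exact congrFun (iteratedFDeriv_comp_const_smul (f := fun y => f (p + y)) t
      (hf.comp (contDiff_const.add contDiff_id))) x
  simp only [InnerProductSpace.laplacian_eq_iteratedFDeriv_stdOrthonormalBasis, hderiv, smul_apply,
    smul_eq_mul, Finset.mul_sum]

theorem laplacian_const_mul (c : ℝ) (h : ContDiffAt ℝ 2 f x) :
    Δ (fun y => c * f y) x = c * Δ f x :=
  InnerProductSpace.laplacian_smul c h

theorem laplacian_fun_add {g : E → ℝ} (hf : ContDiffAt ℝ 2 f x) (hg : ContDiffAt ℝ 2 g x) :
    Δ (fun y => f y + g y) x = Δ f x + Δ g x :=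
  hf.laplacian_add hg

theorem laplacian_sub_const (c : ℝ) (h : ContDiffAt ℝ 2 f x) : Δ (fun y => f y - c) x = Δ f x := by
  simpa [Pi.sub_def] using h.laplacian_sub (contDiffAt_const (c := c))

theorem laplacian_continuousLinearMap (ℓ : E →L[ℝ] ℝ) (x : E) : Δ (fun y => ℓ y) x = 0 := by
  have h : fderiv ℝ (fun y => ℓ y) = fun _ => ℓ := funext fun _ => ℓ.fderiv
  rw [laplacian_eq_sum_fderiv_fderiv (stdOrthonormalBasis ℝ E) (h ▸ differentiableAt_const _), h]
  simp

theorem gradient_norm_sq (x : E) : ∇ (fun y : E => ‖y‖ ^ 2) x = (2 : ℝ) • x := by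
  refine HasGradientAt.gradient (hasGradientAt_iff_hasFDerivAt.2 ?_)
  convert! (hasStrictFDerivAt_norm_sq x).hasFDerivAt using 1
  ext v
  simp [two_mul]

theorem laplacian_norm_sq (x : E) :
    Δ (fun y : E => ‖y‖ ^ 2) x = 2 * Module.finrank ℝ E := by
  have hC : ContDiffAt ℝ 2 (fun y : E => ‖y‖ ^ 2) x := (contDiff_norm_sq ℝ).contDiffAt
  have h : ∀ v : E, (fun y => fderiv ℝ (fun z : E => ‖z‖ ^ 2) y v) =
      fun y => ((2 : ℝ) • innerSL ℝ v) y := by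
    intro v
    funext y
    simp [real_inner_comm]
  rw [laplacian_eq_sum_fderiv_fderiv (stdOrthonormalBasis ℝ E)
    (differentiableAt_fderiv_of_contDiffAt_two hC)]
  simp only [h, ContinuousLinearMap.fderiv]
  simp [mul_comm]

theorem hasGradientAt_norm (hx : x ≠ 0) : HasGradientAt (fun y : E => ‖y‖) (‖x‖⁻¹ • x) x := by
  have : 0 < ‖x‖ := norm_pos_iff.2 hx
  have hsqrt : HasFDerivAt (fun y : E => √(‖y‖ ^ 2)) _ x :=
    (hasStrictFDerivAt_norm_sq x).hasFDerivAt.sqrt (by positivity)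
  simp only [Real.sqrt_sq (norm_nonneg _)] at hsqrt
  refine hasGradientAt_iff_hasFDerivAt.2 (hsqrt.congr_fderiv ?_)
  ext v
  simp
  field_simp

theorem norm_gradient_norm (hx : x ≠ 0) : ‖∇ (fun y : E => ‖y‖) x‖ = 1 := by
  rw [(hasGradientAt_norm hx).gradient, norm_smul, norm_inv, norm_norm,
    inv_mul_cancel₀ (norm_ne_zero_iff.2 hx)]

/- Read off from `‖·‖² = (s ↦ s²) ∘ ‖·‖` and the chain rule. -/
theorem laplacian_norm (hx : x ≠ 0) :
    Δ (fun y : E => ‖y‖) x = (Module.finrank ℝ E - 1) / ‖x‖ := by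
  have h := laplacian_comp (F := fun s => s ^ 2) (F' := fun s => 2 * s) (F'' := 2)
    (contDiffAt_norm ℝ hx) (.of_forall fun s => by simpa using hasDerivAt_pow 2 s)
    (by simpa using (hasDerivAt_id ‖x‖).const_mul (2 : ℝ))
  rw [laplacian_norm_sq, norm_gradient_norm hx] at h
  rw [eq_div_iff (norm_ne_zero_iff.2 hx)]
  linarith

theorem laplacian_mul_comp_norm {P : E → ℝ} {B B' : ℝ → ℝ} {B'' : ℝ} (hx : x ≠ 0)
    (hP : ContDiffAt ℝ 2 P x) (hB : ContDiffAt ℝ 2 B ‖x‖)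
    (hB' : ∀ᶠ s in 𝓝 ‖x‖, HasDerivAt B (B' s) s) (hB'' : HasDerivAt B' B'' ‖x‖) :
    Δ (fun y => P y * B ‖y‖) x = Δ P x * B ‖x‖ + 2 * fderiv ℝ P x x * (B' ‖x‖ / ‖x‖) +
      P x * (B'' + (Module.finrank ℝ E - 1) / ‖x‖ * B' ‖x‖) := by
  have hnorm : ContDiffAt ℝ 2 (fun y : E => ‖y‖) x := contDiffAt_norm ℝ hx
  have hgrad : ∇ (fun y : E => B ‖y‖) x = B' ‖x‖ • ‖x‖⁻¹ • x := by
    refine HasGradientAt.gradient (hasGradientAt_iff_hasFDerivAt.2 ?_)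
    rw [map_smul]
    exact hB'.self_of_nhds.comp_hasFDerivAt x (hasGradientAt_norm hx).hasFDerivAt
  have hcomp : ContDiffAt ℝ 2 (fun y : E => B ‖y‖) x := hB.comp x hnorm
  rw [laplacian_mul hP hcomp, laplacian_comp hnorm hB' hB'', hgrad,
    norm_gradient_norm hx, laplacian_norm hx, inner_smul_right, inner_smul_right,
    inner_gradient_left]
  ring

theorem laplacian_nonneg_of_isLocalMin (hmin : IsLocalMin f x) (h : ContDiffAt ℝ 2 f x) :
    0 ≤ Δ f x := by
  set b := stdOrthonormalBasis ℝ E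
  rw [laplacian_eq_sum_fderiv_fderiv b (differentiableAt_fderiv_of_contDiffAt_two h)]
  refine Finset.sum_nonneg fun i _ => ?_
  have hzero : x + (0 : ℝ) • b i = x := by simp
  have hline : ContinuousAt (fun t : ℝ => x + t • b i) 0 := by fun_prop
  rw [← deriv_deriv_comp_line h]
  refine deriv_deriv_nonneg_of_isLocalMin ?_ ?_
  · exact (hzero.symm ▸ hmin : IsLocalMin f (x + (0 : ℝ) • b i)).comp_continuous
      (g := fun t : ℝ => x + t • b i) hline
  · exact (hzero.symm ▸ h.continuousAt : ContinuousAt f (x + (0 : ℝ) • b i)).comp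
      (f := fun t : ℝ => x + t • b i) hline

end Laplacian

/-- The `C²` bump `(1 - |y - p|² / ρ²)³`; it is nonpositive outside the ball of radius `ρ`, where
positive functions lie above it for free. -/
noncomputable def bump {E : Type*} [NormedAddCommGroup E] (p : E) (ρ : ℝ) (y : E) : ℝ :=
  (1 - ‖y - p‖ ^ 2 / ρ ^ 2) ^ 3

theorem contDiff_bump {E : Type*} [NormedAddCommGroup E] [InnerProductSpace ℝ E] (p : E) (ρ : ℝ) :
    ContDiff ℝ 2 (bump p ρ) :=
  (contDiff_const.sub (((contDiff_id.sub contDiff_const).norm_sq ℝ).div_const _)).pow 3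

section RadialProfiles

variable {E : Type*} [NormedAddCommGroup E] [InnerProductSpace ℝ E] [FiniteDimensional ℝ E]
  {x : E} {R : ℝ}

theorem hasDerivAt_zpow_mul_log {s : ℝ} (hs : s ≠ 0) (hR : R ≠ 0) (k : ℤ) (α β : ℝ) :
    HasDerivAt (fun s : ℝ => s ^ k * (α + β * Real.log (s / R)))
      (s ^ (k - 1) * ((k * α + β) + k * β * Real.log (s / R))) s := by
  have hlog : HasDerivAt (fun s : ℝ => Real.log (s / R)) s⁻¹ s := by
    convert! ((hasDerivAt_id s).div_const R).log (div_ne_zero hs hR) using 1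
    simp only [id]
    field_simp
  refine ((hasDerivAt_zpow k s (.inl hs)).mul ((hlog.const_mul β).const_add α)).congr_deriv ?_
  rw [zpow_sub_one₀ hs]
  field_simp
  ring

theorem contDiffAt_zpow {s : ℝ} (k : ℤ) (hs : s ≠ 0) : ContDiffAt ℝ 2 (fun s : ℝ => s ^ k) s :=
  (analyticAt_id.fun_zpow hs).contDiffAt

theorem contDiffAt_zpow_mul_log {s : ℝ} (hs : s ≠ 0) (hR : R ≠ 0) (k : ℤ) (α β : ℝ) :
    ContDiffAt ℝ 2 (fun s : ℝ => s ^ k * (α + β * Real.log (s / R))) s :=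
  (contDiffAt_zpow k hs).mul (contDiffAt_const.add
    (contDiffAt_const.mul ((contDiffAt_id.div_const R).log (div_ne_zero hs hR))))

theorem laplacian_mul_norm_zpow_log {P : E → ℝ} (hP : ContDiffAt ℝ 2 P x) (hx : x ≠ 0)
    (hR : R ≠ 0) (k : ℤ) (α β : ℝ) :
    Δ (fun y => P y * (‖y‖ ^ k * (α + β * Real.log (‖y‖ / R)))) x =
      Δ P x * (‖x‖ ^ k * (α + β * Real.log (‖x‖ / R))) +
        ‖x‖ ^ (k - 2) * (2 * fderiv ℝ P x x * (k * α + β + k * β * Real.log (‖x‖ / R)) +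
          P x * ((k - 2 + Module.finrank ℝ E) * (k * α + β + k * β * Real.log (‖x‖ / R)) +
            k * β)) := by
  have hr : ‖x‖ ≠ 0 := norm_ne_zero_iff.2 hx
  rw [laplacian_mul_comp_norm hx hP (contDiffAt_zpow_mul_log hr hR k α β)
    ((eventually_ne_nhds hr).mono fun s hs => hasDerivAt_zpow_mul_log hs hR k α β)
    (hasDerivAt_zpow_mul_log hr hR (k - 1) _ _), sub_sub, one_add_one_eq_two,
    zpow_sub_one₀ hr, zpow_sub₀ hr k 2]
  push_cast
  field_simp
  ring

theorem laplacian_linear_mul_norm_zpow_log (ℓ : E →L[ℝ] ℝ) (hx : x ≠ 0) (hR : R ≠ 0) (k : ℤ)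
    (α β : ℝ) :
    Δ (fun y => ℓ y * (‖y‖ ^ k * (α + β * Real.log (‖y‖ / R)))) x =
      ℓ x * ‖x‖ ^ (k - 2) * ((k + Module.finrank ℝ E) *
        (k * α + β + k * β * Real.log (‖x‖ / R)) + k * β) := by
  rw [laplacian_mul_norm_zpow_log ℓ.contDiff.contDiffAt hx hR, laplacian_continuousLinearMap,
    ℓ.fderiv]
  ring

theorem laplacian_linear_sq (ℓ : E →L[ℝ] ℝ) (x : E) : Δ (fun y => ℓ y ^ 2) x = 2 * ‖ℓ‖ ^ 2 := by
  have hgrad : ‖∇ (fun y => ℓ y) x‖ = ‖ℓ‖ := by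
    rw [gradient, LinearIsometryEquiv.norm_map, ℓ.fderiv]
  rw [laplacian_comp (F := fun s => s ^ 2) (F' := fun s => 2 * s) (F'' := 2) ℓ.contDiff.contDiffAt
    (.of_forall fun s => by simpa using hasDerivAt_pow 2 s)
    (by simpa using (hasDerivAt_id (ℓ x)).const_mul (2 : ℝ)), laplacian_continuousLinearMap, hgrad]
  ring

theorem laplacian_linear_sq_mul_norm_zpow (ℓ : E →L[ℝ] ℝ) (hx : x ≠ 0) (k : ℤ) :
    Δ (fun y => ℓ y ^ 2 * ‖y‖ ^ k) x = 2 * ‖ℓ‖ ^ 2 * ‖x‖ ^ k +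
      k * (k + Module.finrank ℝ E + 2) * ℓ x ^ 2 * ‖x‖ ^ (k - 2) := by
  have hfderiv : fderiv ℝ (fun y => ℓ y ^ 2) x x = 2 * ℓ x ^ 2 := by
    rw [fderiv_fun_pow 2 ℓ.differentiableAt, ℓ.fderiv]
    simp
    ring
  have h := laplacian_mul_norm_zpow_log (P := fun y => ℓ y ^ 2) (R := 1) (α := 1) (β := 0)
    (ℓ.contDiff.contDiffAt.pow 2) hx one_ne_zero k
  simp only [zero_mul, add_zero, mul_zero, mul_one] at h
  rw [h, laplacian_linear_sq, hfderiv]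
  ring

theorem laplacian_bump (p x : E) (ρ : ℝ) :
    Δ (bump p ρ) x =
      6 / ρ ^ 2 * (1 - ‖x - p‖ ^ 2 / ρ ^ 2) * (4 * (‖x - p‖ ^ 2 / ρ ^ 2) -
        Module.finrank ℝ E * (1 - ‖x - p‖ ^ 2 / ρ ^ 2)) := by
  have hprofile : ∀ s : ℝ, HasDerivAt (fun s : ℝ => 1 - s / ρ ^ 2) (-(1 / ρ ^ 2)) s := fun s =>
    ((hasDerivAt_id s).div_const _).const_sub 1
  unfold bump
  rw [laplacian_comp_sub (fun y : E => (1 - ‖y‖ ^ 2 / ρ ^ 2) ^ 3),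
    laplacian_comp (f := fun y : E => ‖y‖ ^ 2) (F := fun s => (1 - s / ρ ^ 2) ^ 3)
      (F' := fun s => 3 * (1 - s / ρ ^ 2) ^ 2 * (-(1 / ρ ^ 2)))
      (contDiff_norm_sq ℝ).contDiffAt
      (.of_forall fun s => ((hprofile s).pow 3).congr_deriv (by simp))
      ((((hprofile _).pow 2).const_mul 3).mul_const _), gradient_norm_sq, laplacian_norm_sq,
    norm_smul]
  simp
  ring

end RadialProfiles

section Coordinates

variable {n : ℕ} (l : Fin n)

theorem contDiff_coord {k : WithTop ℕ∞} : ContDiff ℝ k (fun y : Eucl n => y l) :=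
  (EuclideanSpace.proj l : Eucl n →L[ℝ] ℝ).contDiff

theorem continuous_coord : Continuous (fun y : Eucl n => y l) :=
  (contDiff_coord l (k := 0)).continuous

theorem abs_coord_le_norm (x : Eucl n) : |x l| ≤ ‖x‖ := by
  simpa using PiLp.norm_apply_le x l

theorem coord_div_norm_le_one (x : Eucl n) : x l / ‖x‖ ≤ 1 :=
  div_le_one_of_le₀ ((le_abs_self _).trans (abs_coord_le_norm l x)) (norm_nonneg x)

theorem norm_proj_eq_one : ‖(EuclideanSpace.proj l : Eucl n →L[ℝ] ℝ)‖ = 1 := by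
  refine le_antisymm (ContinuousLinearMap.opNorm_le_bound _ zero_le_one fun x => ?_) ?_
  · simpa using abs_coord_le_norm l x
  · simpa using (EuclideanSpace.proj l : Eucl n →L[ℝ] ℝ).le_opNorm (EuclideanSpace.single l 1)

variable {x : Eucl n}

theorem laplacian_coord_mul_norm_zpow_log (hx : x ≠ 0) {R : ℝ} (hR : R ≠ 0) (k : ℤ) (α β : ℝ) :
    Δ (fun y : Eucl n => y l * (‖y‖ ^ k * (α + β * Real.log (‖y‖ / R)))) x =
      x l * ‖x‖ ^ (k - 2) * ((k + n) * (k * α + β + k * β * Real.log (‖x‖ / R)) + k * β) := by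
  simpa using laplacian_linear_mul_norm_zpow_log (EuclideanSpace.proj l) hx hR k α β

theorem contDiffAt_coord_mul_norm_zpow_log (hx : x ≠ 0) {R : ℝ} (hR : R ≠ 0) (k : ℤ) (α β : ℝ) :
    ContDiffAt ℝ 2 (fun y : Eucl n => y l * (‖y‖ ^ k * (α + β * Real.log (‖y‖ / R)))) x :=
  (contDiff_coord l).contDiffAt.mul ((contDiffAt_zpow_mul_log (norm_ne_zero_iff.2 hx) hR k α β).comp
    x (contDiffAt_norm ℝ hx))

theorem laplacian_coord_sq_mul_norm_zpow (hx : x ≠ 0) (k : ℤ) :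
    Δ (fun y : Eucl n => y l ^ 2 * ‖y‖ ^ k) x =
      2 * ‖x‖ ^ k + k * (k + n + 2) * x l ^ 2 * ‖x‖ ^ (k - 2) := by
  simpa [norm_proj_eq_one] using laplacian_linear_sq_mul_norm_zpow (EuclideanSpace.proj l) hx k

theorem contDiffAt_coord_sq_mul_norm_zpow (hx : x ≠ 0) (k : ℤ) :
    ContDiffAt ℝ 2 (fun y : Eucl n => y l ^ 2 * ‖y‖ ^ k) x :=
  ((contDiff_coord l).contDiffAt.pow 2).mul
    ((contDiffAt_zpow k (norm_ne_zero_iff.2 hx)).comp x (contDiffAt_norm ℝ hx))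

end Coordinates

/-! ### The comparison principle and the logarithmic barrier -/

/-- The part of the half space `{x_l > -1}` outside the closed ball of radius `R`. -/
def halfSpaceExterior {n : ℕ} (l : Fin n) (R : ℝ) : Set (Eucl n) := {y | -1 < y l ∧ R < ‖y‖}

/-- The comparison principle for supersolutions of `-Δu = F(u, x)` in `D`: a `C²` function that
lies below `u` off a compact set, and is a strict subsolution where it lies above `u`, lies below
`u`. The filter `ℱ` is `⊤` for pointwise statements and `ae volume` for almost everywhere ones. -/
def ComparisonOn {n : ℕ} (ℱ : Filter (Eucl n)) (D : Set (Eucl n)) (F : ℝ → Eucl n → ℝ)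
    (u : Eucl n → ℝ) : Prop :=
  ∀ (φ : Eucl n → ℝ) (K : Set (Eucl n)), ContDiffOn ℝ 2 φ D → IsCompact K → K ⊆ D →
    (∀ᶠ x in ℱ, x ∈ D → x ∉ K → φ x ≤ u x) →
    (∀ᶠ x in ℱ, x ∈ K → u x < φ x → -Δ φ x < F (u x) x) →
    ∀ᶠ x in ℱ, x ∈ D → φ x ≤ u x

/-- What the nonexistence argument uses about a positive classical, weak or viscosity supersolution
of `-Δu = F(u, x)` in exterior half-space domains. -/
structure IsComparisonSupersolution {n : ℕ} (ℱ : Filter (Eucl n)) (l : Fin n) (R₀ : ℝ)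
    (F : ℝ → Eucl n → ℝ) (u : Eucl n → ℝ) : Prop where
  pos : ∀ᶠ x in ℱ, x ∈ halfSpaceExterior l R₀ → 0 < u x
  lower_bound : ∀ K : Set (Eucl n), IsCompact K → K ⊆ halfSpaceExterior l R₀ →
    ∃ c > 0, ∀ᶠ x in ℱ, x ∈ K → c ≤ u x
  comparison : ∀ R, R₀ ≤ R → ComparisonOn ℱ (halfSpaceExterior l R) F u

section Comparison

variable {n : ℕ} {ℱ : Filter (Eucl n)} {l : Fin n} {R R₀ : ℝ} {F : ℝ → Eucl n → ℝ}
  {u φ : Eucl n → ℝ}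

theorem halfSpaceExterior_anti {R' : ℝ} (h : R ≤ R') :
    halfSpaceExterior l R' ⊆ halfSpaceExterior l R := fun _ hx => ⟨hx.1, h.trans_lt hx.2⟩

theorem isOpen_halfSpaceExterior (l : Fin n) (R : ℝ) : IsOpen (halfSpaceExterior l R) :=
  (isOpen_lt continuous_const (continuous_coord l)).inter
    (isOpen_lt continuous_const continuous_norm)

theorem isCompact_halfAnnulus (l : Fin n) (R R' : ℝ) :
    IsCompact {x : Eucl n | 0 ≤ x l ∧ R ≤ ‖x‖ ∧ ‖x‖ ≤ R'} := by
  refine Metric.isCompact_of_isClosed_isBounded ?_ ?_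
  · exact (isClosed_le continuous_const (continuous_coord l)).inter
      ((isClosed_le continuous_const continuous_norm).inter
        (isClosed_le continuous_norm continuous_const))
  · exact Metric.isBounded_closedBall.subset fun x hx => mem_closedBall_zero_iff.2 hx.2.2

theorem IsComparisonSupersolution.mono (h : IsComparisonSupersolution ℱ l R₀ F u) (hR : R₀ ≤ R) :
    IsComparisonSupersolution ℱ l R F u where
  pos := h.pos.mono fun _ hx hxD => hx (halfSpaceExterior_anti hR hxD)
  lower_bound K hK hKD := h.lower_bound K hK (hKD.trans (halfSpaceExterior_anti hR))
  comparison _ hR' := h.comparison _ (hR.trans hR')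

theorem ComparisonOn.sub_le_of_le_at_infinity (h : ComparisonOn ℱ (halfSpaceExterior l R) F u)
    (hR : 0 < R) (hpos : ∀ᶠ x in ℱ, x ∈ halfSpaceExterior l R → 0 < u x)
    (hφ : ContDiffOn ℝ 2 φ (halfSpaceExterior l R))
    (hneg : ∀ x ∈ halfSpaceExterior l R, x l < 0 → φ x ≤ 0)
    (hann : ∀ᶠ x in ℱ, 0 ≤ x l → R < ‖x‖ → ‖x‖ ≤ 2 * R → φ x ≤ u x)
    {δ ρ : ℝ} (hδ : 0 < δ) (hρ : ∀ x ∈ halfSpaceExterior l R, 0 ≤ x l → ρ ≤ ‖x‖ → φ x ≤ δ)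
    (hcontact : ∀ᶠ x in ℱ, 0 ≤ x l → 2 * R ≤ ‖x‖ → u x < φ x → -Δ φ x < F (u x) x) :
    ∀ᶠ x in ℱ, x ∈ halfSpaceExterior l R → φ x - δ ≤ u x := by
  have hKD : {x : Eucl n | 0 ≤ x l ∧ 2 * R ≤ ‖x‖ ∧ ‖x‖ ≤ ρ} ⊆ halfSpaceExterior l R :=
    fun x hx => ⟨by linarith [hx.1], by linarith [hx.2.1]⟩
  refine h (fun x => φ x - δ) _ (hφ.sub contDiffOn_const) (isCompact_halfAnnulus l _ _) hKD ?_ ?_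
  · filter_upwards [hpos, hann] with x hux hannx hxD hxK
    rcases lt_or_ge (x l) 0 with hl | hl
    · linarith [hneg x hxD hl, hux hxD]
    rcases le_or_gt ‖x‖ (2 * R) with hnear | hfar
    · linarith [hannx hl hxD.2 hnear]
    · have hρx : ρ ≤ ‖x‖ := le_of_not_ge fun hle => hxK ⟨hl, hfar.le, hle⟩
      linarith [hρ x hxD hl hρx, hux hxD]
  · filter_upwards [hcontact] with x hx hxK hlt
    rw [laplacian_sub_const δ
      (hφ.contDiffAt ((isOpen_halfSpaceExterior l R).mem_nhds (hKD hxK)))]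
    exact hx hxK.1 hxK.2.1 (by linarith)

theorem ComparisonOn.le_of_decay [CountableInterFilter ℱ]
    (h : ComparisonOn ℱ (halfSpaceExterior l R) F u) (hR : 0 < R)
    (hpos : ∀ᶠ x in ℱ, x ∈ halfSpaceExterior l R → 0 < u x)
    (hφ : ContDiffOn ℝ 2 φ (halfSpaceExterior l R))
    (hneg : ∀ x ∈ halfSpaceExterior l R, x l < 0 → φ x ≤ 0)
    (hann : ∀ᶠ x in ℱ, 0 ≤ x l → R < ‖x‖ → ‖x‖ ≤ 2 * R → φ x ≤ u x)
    (hdecay : ∀ δ > 0, ∃ ρ, ∀ x ∈ halfSpaceExterior l R, 0 ≤ x l → ρ ≤ ‖x‖ → φ x ≤ δ)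
    (hcontact : ∀ᶠ x in ℱ, 0 ≤ x l → 2 * R ≤ ‖x‖ → u x < φ x → -Δ φ x < F (u x) x) :
    ∀ᶠ x in ℱ, x ∈ halfSpaceExterior l R → φ x ≤ u x := by
  have hsub : ∀ k : ℕ, ∀ᶠ x in ℱ, x ∈ halfSpaceExterior l R → φ x - 1 / ((k : ℝ) + 1) ≤ u x := by
    intro k
    have hδ : 0 < 1 / ((k : ℝ) + 1) := by positivity
    obtain ⟨ρ, hρ⟩ := hdecay _ hδ
    exact h.sub_le_of_le_at_infinity hR hpos hφ hneg hann hδ hρ hcontact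
  filter_upwards [eventually_countable_forall.2 hsub] with x hx hxD
  refine le_of_forall_pos_le_add fun δ hδ => ?_
  obtain ⟨k, hk⟩ := exists_nat_one_div_lt hδ
  linarith [hx k hxD]

end Comparison

/-- The angular factor of `-Δ` of both barriers below: at `t = x_l / |x|` these equal a radial
function times `n t + (n + 1) t² - 2`. It is negative near the boundary `t = 0`. -/
def angularSource (n : ℕ) (t : ℝ) : ℝ := n * t + (n + 1) * t ^ 2 - 2

theorem angularSource_nonpos {n : ℕ} (hn : 2 ≤ n) {t : ℝ} (h₀ : 0 ≤ t) (h₁ : t ≤ 1 / (2 * n)) :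
    angularSource n t ≤ -1 / 2 := by
  have hn' : (2 : ℝ) ≤ n := by exact_mod_cast hn
  have h_nt : n * t ≤ 1 / 2 := by
    calc n * t ≤ n * (1 / (2 * n)) := by gcongr
      _ = 1 / 2 := by field_simp
  unfold angularSource
  nlinarith

theorem angularSource_le {n : ℕ} {t : ℝ} (h₀ : 0 ≤ t) (h₁ : t ≤ 1) :
    angularSource n t ≤ 2 * n := by
  unfold angularSource
  nlinarith [mul_nonneg n.cast_nonneg (sub_nonneg.2 h₁), mul_nonneg h₀ (sub_nonneg.2 h₁)]

/-- The barrier `x_l |x|⁻ⁿ (a + ε log (|x| / R)) + ε x_l² |x|⁻⁽ⁿ⁺¹⁾`: the fundamental solution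
`x_l |x|⁻ⁿ` with a logarithmic gain, and a term that makes it subharmonic near `{x_l = 0}`. -/
noncomputable def logBarrier {n : ℕ} (l : Fin n) (a ε R : ℝ) (y : Eucl n) : ℝ :=
  y l / ‖y‖ ^ n * (a + ε * Real.log (‖y‖ / R)) + ε * (y l ^ 2 / ‖y‖ ^ (n + 1))

section LogBarrier

variable {n : ℕ} {l : Fin n} {a ε R : ℝ} {x : Eucl n}

theorem logBarrier_eq_zpow (l : Fin n) (a ε R : ℝ) :
    logBarrier l a ε R = (fun y => y l * (‖y‖ ^ (-n : ℤ) * (a + ε * Real.log (‖y‖ / R)))) +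
      fun y => ε * (y l ^ 2 * ‖y‖ ^ (-(n + 1 : ℕ) : ℤ)) := by
  funext y
  simp only [logBarrier, Pi.add_apply, zpow_neg, zpow_natCast, div_eq_mul_inv]
  ring

theorem contDiffAt_logBarrier (hR : R ≠ 0) (hx : x ≠ 0) : ContDiffAt ℝ 2 (logBarrier l a ε R) x :=
  logBarrier_eq_zpow l a ε R ▸ (contDiffAt_coord_mul_norm_zpow_log l hx hR _ _ _).add
    (contDiffAt_const.mul (contDiffAt_coord_sq_mul_norm_zpow l hx _))

theorem neg_laplacian_logBarrier (hR : R ≠ 0) (hx : x ≠ 0) :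
    -Δ (logBarrier l a ε R) x = ε / ‖x‖ ^ (n + 1) * angularSource n (x l / ‖x‖) := by
  have hr : ‖x‖ ≠ 0 := norm_ne_zero_iff.2 hx
  have hsq := contDiffAt_coord_sq_mul_norm_zpow l hx (-(n + 1 : ℕ))
  rw [logBarrier_eq_zpow, (contDiffAt_coord_mul_norm_zpow_log l hx hR _ _ _).laplacian_add
      (contDiffAt_const.mul hsq), laplacian_const_mul ε hsq,
    laplacian_coord_mul_norm_zpow_log l hx hR, laplacian_coord_sq_mul_norm_zpow l hx,
    zpow_sub₀ hr, zpow_sub₀ hr, zpow_neg, zpow_neg, zpow_natCast, zpow_natCast, angularSource]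
  push_cast
  field_simp
  ring

theorem logBarrier_nonpos (hε : 0 ≤ ε) (hεa : ε ≤ a) (hR : 1 ≤ R)
    (hx : x ∈ halfSpaceExterior l R) (hl : x l ≤ 0) : logBarrier l a ε R x ≤ 0 := by
  have hr : R < ‖x‖ := hx.2
  have hr₀ : 0 < ‖x‖ := by linarith
  have hlog : 0 ≤ Real.log (‖x‖ / R) := Real.log_nonneg (by rw [one_le_div₀] <;> linarith)
  have hq : -1 ≤ x l / ‖x‖ := by
    rw [le_div_iff₀ hr₀]
    linarith [hx.1]
  have hfactor : logBarrier l a ε R x =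
      x l / ‖x‖ ^ n * ((a + ε * (x l / ‖x‖)) + ε * Real.log (‖x‖ / R)) := by
    rw [logBarrier]
    field_simp
    ring
  have hgain : 0 ≤ a + ε * (x l / ‖x‖) := by nlinarith
  rw [hfactor]
  exact mul_nonpos_of_nonpos_of_nonneg (div_nonpos_of_nonpos_of_nonneg hl (by positivity))
    (by positivity)

theorem logBarrier_le (hn : 2 ≤ n) (hε : 0 ≤ ε) (hεa : ε ≤ a) (hR : 1 ≤ R) (hr : R < ‖x‖)
    (hl : 0 ≤ x l) : logBarrier l a ε R x ≤ a * ((2 + Real.log ‖x‖) / ‖x‖) := by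
  have hr₀ : 0 < ‖x‖ := by linarith
  have hq : x l / ‖x‖ ≤ 1 := coord_div_norm_le_one l x
  have hq₀ : 0 ≤ x l / ‖x‖ := by positivity
  have hlog : 0 ≤ Real.log (‖x‖ / R) := Real.log_nonneg (by rw [one_le_div₀] <;> linarith)
  have hlog_le : Real.log (‖x‖ / R) ≤ Real.log ‖x‖ :=
    Real.log_le_log (by positivity) (div_le_self hr₀.le hR)
  have hpow : 1 / ‖x‖ ^ (n - 1) ≤ 1 / ‖x‖ := by
    gcongr
    exact le_self_pow₀ (by linarith) (by lia)
  have hsq : (x l / ‖x‖) ^ 2 ≤ 1 := pow_le_one₀ hq₀ hq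
  obtain ⟨m, rfl⟩ : ∃ m, n = m + 1 := ⟨n - 1, by lia⟩
  rw [Nat.add_sub_cancel] at hpow
  calc logBarrier l a ε R x
      = 1 / ‖x‖ ^ m * (x l / ‖x‖ * (a + ε * Real.log (‖x‖ / R)) + ε * (x l / ‖x‖) ^ 2) := by
        rw [logBarrier]
        field_simp
        ring
    _ ≤ 1 / ‖x‖ * (1 * (a + a * Real.log ‖x‖) + a * 1) := by
        have ha : 0 ≤ a := hε.trans hεa
        gcongr
    _ = a * ((2 + Real.log ‖x‖) / ‖x‖) := by ring

theorem logBarrier_le_two_mul (hn : 2 ≤ n) (hε : 0 ≤ ε) (hεa : ε ≤ a) (hR : 1 ≤ R)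
    (hr : R < ‖x‖) (hl : 0 ≤ x l) : logBarrier l a ε R x ≤ 2 * a := by
  have hr₀ : 0 < ‖x‖ := by linarith
  have hquot : (2 + Real.log ‖x‖) / ‖x‖ ≤ 2 := by
    rw [div_le_iff₀ hr₀]
    linarith [Real.log_le_sub_one_of_pos hr₀]
  linarith [logBarrier_le hn hε hεa hR hr hl, mul_le_mul_of_nonneg_left hquot (hε.trans hεa)]

theorem exists_forall_logBarrier_le (hn : 2 ≤ n) (hε : 0 ≤ ε) (hεa : ε ≤ a) (hR : 1 ≤ R)
    {δ : ℝ} (hδ : 0 < δ) :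
    ∃ ρ, ∀ x ∈ halfSpaceExterior l R, 0 ≤ x l → ρ ≤ ‖x‖ → logBarrier l a ε R x ≤ δ := by
  have hlim : Tendsto (fun r : ℝ => a * ((2 + Real.log r) / r)) atTop (𝓝 0) := by
    have hlog : Tendsto (fun r : ℝ => Real.log r / r) atTop (𝓝 0) :=
      Real.isLittleO_log_id_atTop.tendsto_div_nhds_zero
    simpa [add_div] using ((tendsto_id.const_div_atTop (2 : ℝ)).add hlog).const_mul a
  obtain ⟨ρ, hρ⟩ := eventually_atTop.1 (hlim.eventually_le_const hδ)
  exact ⟨ρ, fun x hx hl hρx => (logBarrier_le hn hε hεa hR hx.2 hl).trans (hρ _ hρx)⟩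

theorem ComparisonOn.logBarrier_le {ℱ : Filter (Eucl n)} [CountableInterFilter ℱ]
    {F : ℝ → Eucl n → ℝ} {u : Eucl n → ℝ} (h : ComparisonOn ℱ (halfSpaceExterior l R) F u)
    (hn : 2 ≤ n) (hR : 1 ≤ R) (hε : 0 ≤ ε) (hεa : ε ≤ a)
    (hpos : ∀ᶠ x in ℱ, x ∈ halfSpaceExterior l R → 0 < u x)
    (hann : ∀ᶠ x in ℱ, 0 ≤ x l → R < ‖x‖ → ‖x‖ ≤ 2 * R → 2 * a ≤ u x)
    (hcontact : ∀ᶠ x in ℱ, 0 ≤ x l → 2 * R ≤ ‖x‖ → u x < logBarrier l a ε R x →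
      ε / ‖x‖ ^ (n + 1) * angularSource n (x l / ‖x‖) < F (u x) x) :
    ∀ᶠ x in ℱ, x ∈ halfSpaceExterior l R → logBarrier l a ε R x ≤ u x := by
  have hne : ∀ x : Eucl n, R < ‖x‖ → x ≠ 0 := fun x hx => norm_pos_iff.1 (by linarith)
  have hR₀ : R ≠ 0 := by positivity
  refine h.le_of_decay (by linarith) hpos
    (fun x hx => (contDiffAt_logBarrier hR₀ (hne x hx.2)).contDiffWithinAt)
    (fun x hx hl => logBarrier_nonpos hε hεa hR hx hl.le) ?_
    (fun δ hδ => exists_forall_logBarrier_le hn hε hεa hR hδ) ?_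
  · filter_upwards [hann] with x hx hl hr hr'
    exact (logBarrier_le_two_mul hn hε hεa hR hr hl).trans (hx hl hr hr')
  · filter_upwards [hcontact] with x hx hl hr hlt
    rw [neg_laplacian_logBarrier hR₀ (hne x (by linarith))]
    exact hx hl hr hlt

end LogBarrier

/-! ### Critical sources and linear growth in cones -/

/-- The exponent `(n + 1 - γ) / (n - 1)`, critical at `0`: on the fundamental solution `x_l |x|⁻ⁿ`
the source `|x|^{-γ} s^σ` has the size `|x|⁻⁽ⁿ⁺¹⁾` of the Laplacian of its product with a
logarithm. -/
noncomputable def criticalExponent (n : ℕ) (γ : ℝ) : ℝ := ((n : ℝ) + 1 - γ) / ((n : ℝ) - 1)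

/-- `F` is bounded below by the critical powers `c |x|^{-γ} s^σ` for small `s`, where
`σ = criticalExponent n γ`, and `c |x|^{-γ} s^{γ-1}` for large `s`. -/
structure IsCriticalSource {n : ℕ} (l : Fin n) (R γ c : ℝ) (F : ℝ → Eucl n → ℝ) : Prop where
  const_pos : 0 < c
  le_of_le_one : ∀ s, 0 < s → s ≤ 1 → ∀ x ∈ halfSpaceExterior l R,
    c * ‖x‖ ^ (-γ) * s ^ criticalExponent n γ ≤ F s x
  le_of_one_le : ∀ s, 1 ≤ s → ∀ x ∈ halfSpaceExterior l R, c * ‖x‖ ^ (-γ) * s ^ (γ - 1) ≤ F s x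

section CriticalSource

variable {n : ℕ} {ℱ : Filter (Eucl n)} {l : Fin n} {R R₀ γ c a ε s : ℝ} {F : ℝ → Eucl n → ℝ}
  {u : Eucl n → ℝ} {x : Eucl n}

theorem IsCriticalSource.mono (h : IsCriticalSource l R₀ γ c F) (hR : R₀ ≤ R) :
    IsCriticalSource l R γ c F where
  const_pos := h.const_pos
  le_of_le_one s hs hs₁ x hx := h.le_of_le_one s hs hs₁ x (halfSpaceExterior_anti hR hx)
  le_of_one_le s hs x hx := h.le_of_one_le s hs x (halfSpaceExterior_anti hR hx)

theorem IsCriticalSource.pos (h : IsCriticalSource l R γ c F) (hR : 0 ≤ R) (hs : 0 < s)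
    (hx : x ∈ halfSpaceExterior l R) : 0 < F s x := by
  have hr : 0 < ‖x‖ := hR.trans_lt hx.2
  have hc := h.const_pos
  rcases le_total s 1 with hs₁ | hs₁
  · exact (by positivity : _ < _).trans_le (h.le_of_le_one s hs hs₁ x hx)
  · exact (by positivity : _ < _).trans_le (h.le_of_one_le s hs₁ x hx)

theorem sub_one_mul_criticalExponent (hn : 2 ≤ n) (γ : ℝ) :
    ((n : ℝ) - 1) * criticalExponent n γ = n + 1 - γ := by
  have hn' : (2 : ℝ) ≤ n := by exact_mod_cast hn
  exact mul_div_cancel₀ _ (by linarith)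

theorem one_lt_criticalExponent (hn : 2 ≤ n) (hγ : γ < 2) : 1 < criticalExponent n γ := by
  have hn' : (2 : ℝ) ≤ n := by exact_mod_cast hn
  rw [criticalExponent, one_lt_div] <;> linarith

theorem rpow_neg_mul_rpow_criticalExponent (hn : 2 ≤ n) {b r : ℝ} (hb : 0 ≤ b) (hr : 0 < r) :
    r ^ (-γ) * (b * (r / r ^ n)) ^ criticalExponent n γ =
      b ^ criticalExponent n γ / r ^ (n + 1) := by
  have hbase : r / r ^ n = r ^ (1 - (n : ℝ)) := by
    rw [Real.rpow_sub hr, Real.rpow_one, Real.rpow_natCast]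
  have hexp : -γ + (1 - (n : ℝ)) * criticalExponent n γ = -((n + 1 : ℕ) : ℝ) := by
    push_cast
    linarith [sub_one_mul_criticalExponent hn γ]
  rw [hbase, Real.mul_rpow hb (by positivity), ← Real.rpow_mul hr.le, mul_left_comm,
    ← Real.rpow_add hr, hexp, Real.rpow_neg hr.le, Real.rpow_natCast, div_eq_mul_inv]

theorem IsComparisonSupersolution.exists_le_halfAnnulus
    (hS : IsComparisonSupersolution ℱ l R₀ F u) (hRR : R₀ < R) :
    ∃ a > 0, 2 * a ≤ 1 ∧ ∀ᶠ x in ℱ, 0 ≤ x l → R < ‖x‖ → ‖x‖ ≤ 2 * R → 2 * a ≤ u x := by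
  obtain ⟨c, hc, hcu⟩ := hS.lower_bound {x | 0 ≤ x l ∧ R ≤ ‖x‖ ∧ ‖x‖ ≤ 2 * R}
    (isCompact_halfAnnulus l _ _) fun x hx => ⟨by linarith [hx.1], by linarith [hx.2.1]⟩
  refine ⟨min c 1 / 2, by positivity, by linarith [min_le_right c 1], ?_⟩
  filter_upwards [hcu] with x hx hl hr hr'
  linarith [hx ⟨hl, hr.le, hr'⟩, min_le_left c 1]

theorem IsComparisonSupersolution.fundamental_le [CountableInterFilter ℱ] (hn : 2 ≤ n)
    (hS : IsComparisonSupersolution ℱ l R F u) (hR : 1 ≤ R)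
    (hF : ∀ s, 0 < s → ∀ x ∈ halfSpaceExterior l R, 0 < F s x) (ha : 0 ≤ a)
    (hann : ∀ᶠ x in ℱ, 0 ≤ x l → R < ‖x‖ → ‖x‖ ≤ 2 * R → 2 * a ≤ u x) :
    ∀ᶠ x in ℱ, x ∈ halfSpaceExterior l R → a * (x l / ‖x‖ ^ n) ≤ u x := by
  have hbarrier := (hS.comparison R le_rfl).logBarrier_le hn hR le_rfl ha hS.pos hann <| by
    filter_upwards [hS.pos] with x hux hl hr _
    have hxD : x ∈ halfSpaceExterior l R := ⟨by linarith, by linarith⟩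
    simpa using hF _ (hux hxD) x hxD
  filter_upwards [hbarrier] with x hx hxD
  simpa [logBarrier, mul_comm] using hx hxD

theorem IsCriticalSource.angularSource_lt (hF : IsCriticalSource l R γ c F) (hn : 2 ≤ n)
    (hγ : γ < 2) (hR : 0 ≤ R) (ha : 0 < a) (hε : 0 < ε)
    (hεc : ε * (2 * n + 1) ≤ c * (a / (2 * n)) ^ criticalExponent n γ)
    (hx : x ∈ halfSpaceExterior l R) (hl : 0 ≤ x l) (hs : 0 < s) (hs₁ : s ≤ 1)
    (hxs : a * (x l / ‖x‖ ^ n) ≤ s) :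
    ε / ‖x‖ ^ (n + 1) * angularSource n (x l / ‖x‖) < F s x := by
  have hr : 0 < ‖x‖ := hR.trans_lt hx.2
  have ht₀ : 0 ≤ x l / ‖x‖ := by positivity
  rcases le_total (x l / ‖x‖) (1 / (2 * n)) with ht | ht
  · refine lt_of_le_of_lt ?_ (hF.pos hR hs hx)
    have hneg := angularSource_nonpos hn ht₀ ht
    exact mul_nonpos_of_nonneg_of_nonpos (by positivity) (by linarith)
  · have hc := hF.const_pos
    have hs_low : a / (2 * n) * (‖x‖ / ‖x‖ ^ n) ≤ s := by
      calc a / (2 * n) * (‖x‖ / ‖x‖ ^ n) = a * (1 / (2 * n) * (‖x‖ / ‖x‖ ^ n)) := by ring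
        _ ≤ a * (x l / ‖x‖ * (‖x‖ / ‖x‖ ^ n)) := by gcongr
        _ = a * (x l / ‖x‖ ^ n) := by field_simp
        _ ≤ s := hxs
    have hσ : 0 ≤ criticalExponent n γ := by linarith [one_lt_criticalExponent hn hγ]
    calc ε / ‖x‖ ^ (n + 1) * angularSource n (x l / ‖x‖)
        < ε / ‖x‖ ^ (n + 1) * (2 * n + 1) := by
          have hle := angularSource_le (n := n) ht₀ (coord_div_norm_le_one l x)
          gcongr
          linarith
      _ = ε * (2 * n + 1) / ‖x‖ ^ (n + 1) := by ring
      _ ≤ c * (a / (2 * n)) ^ criticalExponent n γ / ‖x‖ ^ (n + 1) := by gcongr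
      _ = c * ‖x‖ ^ (-γ) * (a / (2 * n) * (‖x‖ / ‖x‖ ^ n)) ^ criticalExponent n γ := by
          rw [mul_assoc, rpow_neg_mul_rpow_criticalExponent hn (by positivity) hr, mul_div_assoc]
      _ ≤ c * ‖x‖ ^ (-γ) * s ^ criticalExponent n γ := by gcongr
      _ ≤ F s x := hF.le_of_le_one s hs hs₁ x hx

theorem IsComparisonSupersolution.exists_log_le [CountableInterFilter ℱ] (hn : 2 ≤ n)
    (hS : IsComparisonSupersolution ℱ l R₀ F u) (hF : IsCriticalSource l R γ c F) (hγ : γ < 2)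
    (hRR : R₀ < R) (hR : 1 ≤ R) :
    ∃ ε > 0, ∀ᶠ x in ℱ, x ∈ halfSpaceExterior l R → 0 ≤ x l →
      ε * (x l / ‖x‖ ^ n) * Real.log (‖x‖ / R) ≤ u x := by
  obtain ⟨a, ha, ha₁, hann⟩ := hS.exists_le_halfAnnulus hRR
  have hSR := hS.mono hRR.le
  have hR₀ : 0 ≤ R := by linarith
  have hfund := hSR.fundamental_le hn hR (fun s hs x hx => hF.pos hR₀ hs hx) ha.le hann
  have hc := hF.const_pos
  set ε : ℝ := min a (c * (a / (2 * n)) ^ criticalExponent n γ / (2 * n + 1))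
  have hε : 0 < ε := by positivity
  have hεa : ε ≤ a := min_le_left _ _
  have hεc : ε * (2 * n + 1) ≤ c * (a / (2 * n)) ^ criticalExponent n γ :=
    (le_div_iff₀ (by positivity)).1 (min_le_right _ _)
  have hbarrier := (hSR.comparison R le_rfl).logBarrier_le hn hR hε.le hεa hSR.pos hann <| by
    filter_upwards [hSR.pos, hfund] with x hux hxf hl hr hlt
    have hxD : x ∈ halfSpaceExterior l R := ⟨by linarith, by linarith⟩
    have hu₁ : u x ≤ 1 :=
      hlt.le.trans ((logBarrier_le_two_mul hn hε.le hεa hR hxD.2 hl).trans ha₁)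
    exact hF.angularSource_lt hn hγ hR₀ ha hε hεc hxD hl (hux hxD) hu₁ (hxf hxD)
  refine ⟨ε, hε, ?_⟩
  filter_upwards [hbarrier] with x hx hxD hl
  have hrest : 0 ≤ x l / ‖x‖ ^ n * a + ε * (x l ^ 2 / ‖x‖ ^ (n + 1)) := by positivity
  calc ε * (x l / ‖x‖ ^ n) * Real.log (‖x‖ / R) ≤ logBarrier l a ε R x := by
        rw [logBarrier]
        linarith
    _ ≤ u x := hx hxD

end CriticalSource

section Bump

variable {n : ℕ} {ℱ : Filter (Eucl n)} {l : Fin n} {R ρ t T : ℝ} {F : ℝ → Eucl n → ℝ}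
  {u : Eucl n → ℝ} {p x : Eucl n}

theorem bump_nonpos (hρ : 0 < ρ) (hx : ρ ≤ ‖x - p‖) : bump p ρ x ≤ 0 := by
  refine Odd.pow_nonpos (by decide) ?_
  rw [sub_nonpos, one_le_div (by positivity)]
  gcongr

theorem bump_le_one (p : Eucl n) (ρ : ℝ) (x : Eucl n) : bump p ρ x ≤ 1 := by
  have hq : 0 ≤ ‖x - p‖ ^ 2 / ρ ^ 2 := by positivity
  rcases le_total 0 (1 - ‖x - p‖ ^ 2 / ρ ^ 2) with hz | hz
  · exact pow_le_one₀ hz (by linarith)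
  · exact (Odd.pow_nonpos (by decide) hz).trans zero_le_one

theorem le_bump (hρ : 0 < ρ) (hx : ‖x - p‖ ≤ ρ / 2) : (3 / 4) ^ 3 ≤ bump p ρ x := by
  have hq : ‖x - p‖ ^ 2 / ρ ^ 2 ≤ 1 / 4 := by
    rw [div_le_iff₀ (by positivity)]
    calc ‖x - p‖ ^ 2 ≤ (ρ / 2) ^ 2 := by gcongr
      _ = 1 / 4 * ρ ^ 2 := by ring
  unfold bump
  gcongr
  linarith

theorem neg_laplacian_bump (p x : Eucl n) (ρ : ℝ) :
    -Δ (bump p ρ) x = 6 / ρ ^ 2 * ((1 - ‖x - p‖ ^ 2 / ρ ^ 2) *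
      ((n + 4) * (1 - ‖x - p‖ ^ 2 / ρ ^ 2) - 4)) := by
  rw [laplacian_bump, finrank_euclideanSpace_fin]
  ring

theorem neg_laplacian_bump_le (hρ : 0 < ρ) (hx : ‖x - p‖ ≤ ρ) :
    -Δ (bump p ρ) x ≤ 6 * n / ρ ^ 2 := by
  have hq : ‖x - p‖ ^ 2 / ρ ^ 2 ≤ 1 := by
    rw [div_le_one (by positivity)]
    gcongr
  have hq₀ : 0 ≤ ‖x - p‖ ^ 2 / ρ ^ 2 := by positivity
  have hn : (0 : ℝ) ≤ n := n.cast_nonneg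
  rw [neg_laplacian_bump, mul_div_right_comm]
  gcongr
  generalize ‖x - p‖ ^ 2 / ρ ^ 2 = q at *
  nlinarith [mul_nonneg hn hq₀, mul_nonneg hq₀ (sub_nonneg.2 hq),
    mul_nonneg (mul_nonneg hn hq₀) (sub_nonneg.2 hq)]

theorem neg_laplacian_bump_nonpos (hρ : 0 < ρ) (hx : ‖x - p‖ ≤ ρ)
    (hsmall : bump p ρ x ≤ (4 / ((n : ℝ) + 4)) ^ 3) : -Δ (bump p ρ) x ≤ 0 := by
  have hq : ‖x - p‖ ^ 2 / ρ ^ 2 ≤ 1 := by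
    rw [div_le_one (by positivity)]
    gcongr
  have hz : 1 - ‖x - p‖ ^ 2 / ρ ^ 2 ≤ 4 / ((n : ℝ) + 4) :=
    le_of_pow_le_pow_left₀ three_ne_zero (by positivity) hsmall
  rw [le_div_iff₀ (by positivity)] at hz
  rw [neg_laplacian_bump]
  exact mul_nonpos_of_nonneg_of_nonpos (by positivity)
    (mul_nonpos_of_nonneg_of_nonpos (by linarith) (by linarith))

theorem ComparisonOn.bump_le_of_bump_le (h : ComparisonOn ℱ (halfSpaceExterior l R) F u)
    (hpos : ∀ᶠ x in ℱ, x ∈ halfSpaceExterior l R → 0 < u x)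
    (hF : ∀ s, 0 < s → ∀ x ∈ halfSpaceExterior l R, 0 < F s x) (hρ : 0 < ρ)
    (hball : Metric.closedBall p ρ ⊆ halfSpaceExterior l R) (ht : 0 ≤ t) (hT : 0 ≤ T)
    (hle : ∀ᶠ x in ℱ, x ∈ halfSpaceExterior l R → t * bump p ρ x ≤ u x)
    (hsource : ∀ y ∈ Metric.closedBall p ρ, ∀ s, 0 < s → (4 / ((n : ℝ) + 4)) ^ 3 * t ≤ s → s < T →
      6 * n / ρ ^ 2 * T < F s y) :
    ∀ᶠ x in ℱ, x ∈ halfSpaceExterior l R → T * bump p ρ x ≤ u x := by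
  refine h _ _ (contDiff_const.mul (contDiff_bump p ρ)).contDiffOn (isCompact_closedBall p ρ)
    hball ?_ ?_
  · filter_upwards [hpos] with x hux hxD hxball
    have hfar : ρ ≤ ‖x - p‖ := by
      rw [mem_closedBall_iff_norm, not_le] at hxball
      exact hxball.le
    exact (mul_nonpos_of_nonneg_of_nonpos hT (bump_nonpos hρ hfar)).trans (hux hxD).le
  · filter_upwards [hpos, hle] with x hux htx hxball hlt
    have hxD := hball hxball
    have hxp := mem_closedBall_iff_norm.1 hxball
    rw [laplacian_const_mul T (contDiff_bump p ρ).contDiffAt, ← mul_neg]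
    rcases le_total (bump p ρ x) ((4 / ((n : ℝ) + 4)) ^ 3) with hsmall | hlarge
    · exact (mul_nonpos_of_nonneg_of_nonpos hT (neg_laplacian_bump_nonpos hρ hxp hsmall)).trans_lt
        (hF _ (hux hxD) x hxD)
    · have hs_low : (4 / ((n : ℝ) + 4)) ^ 3 * t ≤ u x := by
        rw [mul_comm]
        exact (mul_le_mul_of_nonneg_left hlarge ht).trans (htx hxD)
      have hs_high : u x < T := hlt.trans_le (mul_le_of_le_one_right hT (bump_le_one p ρ x))
      calc T * -Δ (bump p ρ) x ≤ T * (6 * n / ρ ^ 2) := by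
            gcongr
            exact neg_laplacian_bump_le hρ hxp
        _ = 6 * n / ρ ^ 2 * T := mul_comm _ _
        _ < F (u x) x := hsource x hxball _ (hux hxD) hs_low hs_high

theorem ComparisonOn.bump_le_of_le_two_mul (h : ComparisonOn ℱ (halfSpaceExterior l R) F u)
    (hpos : ∀ᶠ x in ℱ, x ∈ halfSpaceExterior l R → 0 < u x)
    (hF : ∀ s, 0 < s → ∀ x ∈ halfSpaceExterior l R, 0 < F s x) (hρ : 0 < ρ)
    (hball : Metric.closedBall p ρ ⊆ halfSpaceExterior l R) (ht : 0 ≤ t) (hT : 0 ≤ T)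
    (hTt : T ≤ 2 * t)
    (hle : ∀ᶠ x in ℱ, x ∈ halfSpaceExterior l R → t * bump p ρ x ≤ u x)
    (hsource : ∀ y ∈ Metric.closedBall p ρ, ∀ s, 0 < s → (4 / ((n : ℝ) + 4)) ^ 3 * t ≤ s → s < T →
      12 * n / ((4 / ((n : ℝ) + 4)) ^ 3 * ρ ^ 2) * s < F s y) :
    ∀ᶠ x in ℱ, x ∈ halfSpaceExterior l R → T * bump p ρ x ≤ u x := by
  refine h.bump_le_of_bump_le hpos hF hρ hball ht hT hle fun y hy s hs hs_low hs_high => ?_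
  set c₁ : ℝ := (4 / ((n : ℝ) + 4)) ^ 3
  have hc₁ : 0 < c₁ := by positivity
  have hTs : T ≤ 2 * s / c₁ := by
    rw [le_div_iff₀ hc₁]
    calc T * c₁ ≤ 2 * t * c₁ := by gcongr
      _ = 2 * (c₁ * t) := by ring
      _ ≤ 2 * s := by gcongr
  calc 6 * n / ρ ^ 2 * T ≤ 6 * n / ρ ^ 2 * (2 * s / c₁) := by gcongr
    _ = 12 * n / (c₁ * ρ ^ 2) * s := by
      field_simp
      ring
    _ < F s y := hsource y hy s hs hs_low hs_high

theorem ComparisonOn.bump_le_of_doubling (h : ComparisonOn ℱ (halfSpaceExterior l R) F u)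
    (hpos : ∀ᶠ x in ℱ, x ∈ halfSpaceExterior l R → 0 < u x)
    (hF : ∀ s, 0 < s → ∀ x ∈ halfSpaceExterior l R, 0 < F s x) (hρ : 0 < ρ)
    (hball : Metric.closedBall p ρ ⊆ halfSpaceExterior l R) (ht : 0 < t) (hT : 0 ≤ T)
    (hle : ∀ᶠ x in ℱ, x ∈ Metric.closedBall p ρ → t ≤ u x)
    (hsource : ∀ y ∈ Metric.closedBall p ρ, ∀ s, 0 < s → (4 / ((n : ℝ) + 4)) ^ 3 * t ≤ s → s < T →
      12 * n / ((4 / ((n : ℝ) + 4)) ^ 3 * ρ ^ 2) * s < F s y) :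
    ∀ᶠ x in ℱ, x ∈ halfSpaceExterior l R → T * bump p ρ x ≤ u x := by
  have hdouble : ∀ k : ℕ, ∀ᶠ x in ℱ, x ∈ halfSpaceExterior l R →
      min (2 ^ k * t) T * bump p ρ x ≤ u x := by
    intro k
    induction k with
    | zero =>
      filter_upwards [hpos, hle] with x hux htx hxD
      have hmin : 0 ≤ min (2 ^ 0 * t) T := by positivity
      rcases le_total ‖x - p‖ ρ with hxp | hxp
      · calc min (2 ^ 0 * t) T * bump p ρ x ≤ 2 ^ 0 * t :=
            (mul_le_of_le_one_right hmin (bump_le_one p ρ x)).trans (min_le_left _ _)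
          _ ≤ u x := by simpa using htx (mem_closedBall_iff_norm.2 hxp)
      · exact (mul_nonpos_of_nonneg_of_nonpos hmin (bump_nonpos hρ hxp)).trans (hux hxD).le
    | succ k ih =>
      have htk : t ≤ 2 ^ k * t := le_mul_of_one_le_left ht.le (one_le_pow₀ one_le_two)
      have hstep : (2 : ℝ) ^ (k + 1) * t = 2 * (2 ^ k * t) := by ring
      rcases le_or_gt T (2 ^ k * t) with hTk | hTk
      · rw [min_eq_right hTk] at ih
        rwa [min_eq_right (by linarith)]
      rw [min_eq_left hTk.le] at ih
      refine h.bump_le_of_le_two_mul hpos hF hρ hball (by positivity) (by positivity)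
        ((min_le_left _ _).trans hstep.le) ih fun y hy s hs hs_low hs_high => ?_
      exact hsource y hy s hs (le_trans (by gcongr) hs_low) (hs_high.trans_le (min_le_right _ _))
  obtain ⟨k, hk⟩ := pow_unbounded_of_one_lt (T / t) (one_lt_two (α := ℝ))
  have hTk : T ≤ 2 ^ k * t := ((div_lt_iff₀ ht).1 hk).le
  simpa [min_eq_right hTk] using hdouble k

end Bump

section LinearGrowth

variable {n : ℕ} {ℱ : Filter (Eucl n)} {l : Fin n} {R R₀ γ b c C r : ℝ} {F : ℝ → Eucl n → ℝ}
  {u : Eucl n → ℝ}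

theorem two_rpow_neg_abs_mul_rpow_le {z : ℝ} (hr : 0 < r) (hrz : r / 2 ≤ z) (hzr : z ≤ 2 * r) :
    2 ^ (-|γ|) * r ^ (-γ) ≤ z ^ (-γ) := by
  rcases le_total 0 γ with hγ | hγ
  · rw [abs_of_nonneg hγ, ← Real.mul_rpow zero_le_two hr.le]
    exact Real.rpow_le_rpow_of_nonpos (by linarith) hzr (by linarith)
  · have hhalf : (2 : ℝ) ^ (-|γ|) * r ^ (-γ) = (r / 2) ^ (-γ) := by
      rw [abs_of_nonpos hγ, neg_neg, Real.div_rpow hr.le zero_le_two, Real.rpow_neg zero_le_two,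
        div_inv_eq_mul, mul_comm]
    rw [hhalf]
    exact Real.rpow_le_rpow (by positivity) hrz (by linarith)

theorem exists_forall_mul_lt_rpow_criticalExponent (hn : 2 ≤ n) (hγ : γ < 2) (hb : 0 < b)
    (hR : 0 < R) (C : ℝ) :
    ∃ R₁ ≥ 2 * R, ∀ r ≥ R₁, ∀ s > 0, b * (r / r ^ n) * Real.log (r / (2 * R)) ≤ s →
      C * s < r ^ (2 - γ) * s ^ criticalExponent n γ := by
  set τ : ℝ := criticalExponent n γ - 1
  have hτ : 0 < τ := sub_pos.2 (one_lt_criticalExponent hn hγ)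
  have hτ_mul : ((n : ℝ) - 1) * τ = 2 - γ := by
    rw [mul_sub, sub_one_mul_criticalExponent hn]
    ring
  have hlim : Tendsto (fun r : ℝ => (b * Real.log (r / (2 * R))) ^ τ) atTop atTop :=
    (tendsto_rpow_atTop hτ).comp ((Real.tendsto_log_atTop.comp
      (tendsto_id.atTop_div_const (by positivity))).const_mul_atTop hb)
  obtain ⟨R₁, hR₁⟩ := eventually_atTop.1 (hlim.eventually_gt_atTop C)
  refine ⟨max R₁ (2 * R), le_max_right _ _, fun r hr s hs hrs => ?_⟩
  have hRr : 2 * R ≤ r := (le_max_right _ _).trans hr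
  have hr₀ : 0 < r := by linarith
  have hlog : 0 ≤ Real.log (r / (2 * R)) :=
    Real.log_nonneg (by rwa [one_le_div₀ (by positivity)])
  have hlog_le : b * Real.log (r / (2 * R)) ≤ r ^ ((n : ℝ) - 1) * s := by
    rw [Real.rpow_sub hr₀, Real.rpow_natCast, Real.rpow_one]
    calc b * Real.log (r / (2 * R)) = r ^ n / r * (b * (r / r ^ n) * Real.log (r / (2 * R))) := by
          field_simp
      _ ≤ r ^ n / r * s := by gcongr
  calc C * s < (b * Real.log (r / (2 * R))) ^ τ * s :=
        mul_lt_mul_of_pos_right (hR₁ r ((le_max_left _ _).trans hr)) hs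
    _ ≤ (r ^ ((n : ℝ) - 1) * s) ^ τ * s := by gcongr
    _ = r ^ (2 - γ) * s ^ (τ + 1) := by
        rw [Real.mul_rpow (by positivity) hs.le, ← Real.rpow_mul hr₀.le, hτ_mul,
          Real.rpow_add hs, Real.rpow_one, mul_assoc]
    _ = r ^ (2 - γ) * s ^ criticalExponent n γ := by rw [sub_add_cancel]

theorem exists_forall_mul_lt_rpow_sub_one (hγ : γ < 2) (hC : 0 < C) :
    ∃ η > 0, ∀ r > 0, ∀ s > 0, s < η * r → C * s < r ^ (2 - γ) * s ^ (γ - 1) := by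
  have hγ' : 0 < 2 - γ := by linarith
  refine ⟨(1 / C) ^ (2 - γ)⁻¹, by positivity, fun r hr s hs hsr => ?_⟩
  have hpow : s ^ (2 - γ) < 1 / C * r ^ (2 - γ) := by
    calc s ^ (2 - γ) < ((1 / C) ^ (2 - γ)⁻¹ * r) ^ (2 - γ) := Real.rpow_lt_rpow hs.le hsr hγ'
      _ = 1 / C * r ^ (2 - γ) := by
        rw [Real.mul_rpow (by positivity) hr.le, Real.rpow_inv_rpow (by positivity) hγ'.ne']
  calc C * s = C * s ^ (2 - γ) * s ^ (γ - 1) := by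
        rw [mul_assoc, ← Real.rpow_add hs]
        norm_num
    _ < C * (1 / C * r ^ (2 - γ)) * s ^ (γ - 1) := by gcongr
    _ = r ^ (2 - γ) * s ^ (γ - 1) := by field_simp

theorem IsCriticalSource.exists_mul_lt (hF : IsCriticalSource l R γ c F) (hn : 2 ≤ n) (hγ : γ < 2)
    (hb : 0 < b) (hC : 0 < C) (hR : 0 < R) :
    ∃ η > 0, ∃ R₁ ≥ 2 * R, ∀ r ≥ R₁, ∀ y ∈ halfSpaceExterior l R, r / 2 ≤ ‖y‖ → ‖y‖ ≤ 2 * r →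
      ∀ s > 0, b * (r / r ^ n) * Real.log (r / (2 * R)) ≤ s → s < η * r →
        C / r ^ 2 * s < F s y := by
  have hc := hF.const_pos
  set κ : ℝ := c * 2 ^ (-|γ|)
  have hκ : 0 < κ := by positivity
  obtain ⟨R₁, hR₁, hsmall⟩ := exists_forall_mul_lt_rpow_criticalExponent hn hγ hb hR (C / κ)
  obtain ⟨η, hη, hlarge⟩ := exists_forall_mul_lt_rpow_sub_one hγ (C := C / κ) (by positivity)
  refine ⟨η, hη, R₁, hR₁, fun r hr y hy hry hyr s hs hs_low hs_high => ?_⟩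
  have hr₀ : 0 < r := by linarith
  have hscale : ∀ G : ℝ, 0 ≤ G → C / κ * s < r ^ (2 - γ) * G →
      C / r ^ 2 * s < c * ‖y‖ ^ (-γ) * G := by
    intro G hG hlt
    have hpow : r ^ (2 - γ) = r ^ 2 * r ^ (-γ) := by
      rw [sub_eq_add_neg, Real.rpow_add hr₀, Real.rpow_two]
    calc C / r ^ 2 * s = κ / r ^ 2 * (C / κ * s) := by field_simp
      _ < κ / r ^ 2 * (r ^ (2 - γ) * G) := by gcongr
      _ = c * (2 ^ (-|γ|) * r ^ (-γ)) * G := by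
          rw [hpow]
          field_simp
          ring
      _ ≤ c * ‖y‖ ^ (-γ) * G := by
          gcongr
          exact two_rpow_neg_abs_mul_rpow_le hr₀ hry hyr
  rcases le_total s 1 with hs₁ | hs₁
  · exact (hscale _ (by positivity) (hsmall r hr s hs hs_low)).trans_le
      (hF.le_of_le_one s hs hs₁ y hy)
  · exact (hscale _ (by positivity) (hlarge r hr₀ s hs hs_high)).trans_le
      (hF.le_of_one_le s hs₁ y hy)

theorem coord_norm_bounds_of_mem_closedBall {θ : ℝ} (hθ₁ : θ ≤ 1) {p y : Eucl n}
    (hp : θ / 2 * ‖p‖ ≤ p l) (hy : y ∈ Metric.closedBall p (θ / 4 * ‖p‖)) :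
    θ / 4 * ‖p‖ ≤ y l ∧ ‖p‖ / 2 ≤ ‖y‖ ∧ ‖y‖ ≤ 2 * ‖p‖ := by
  have hyp : ‖y - p‖ ≤ θ / 4 * ‖p‖ := mem_closedBall_iff_norm.1 hy
  have hcoord : |y l - p l| ≤ ‖y - p‖ := by simpa using abs_coord_le_norm l (y - p)
  have hsmall : θ / 4 * ‖p‖ ≤ ‖p‖ / 2 := by nlinarith [norm_nonneg p]
  have hnorm := abs_le.1 ((abs_norm_sub_norm_le y p).trans hyp)
  have hl := abs_le.1 (hcoord.trans hyp)
  exact ⟨by linarith, by linarith, by linarith [norm_nonneg p]⟩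

theorem IsComparisonSupersolution.exists_bump_le [CountableInterFilter ℱ] (hn : 2 ≤ n)
    (hS : IsComparisonSupersolution ℱ l R₀ F u) (hF : IsCriticalSource l R γ c F) (hγ : γ < 2)
    (hRR : R₀ < R) (hR : 1 ≤ R) {θ : ℝ} (hθ : 0 < θ) (hθ₁ : θ ≤ 1) :
    ∃ η > 0, ∃ R₁ > 2 * R, ∀ p : Eucl n, R₁ ≤ ‖p‖ → θ / 2 * ‖p‖ ≤ p l →
      ∀ᶠ x in ℱ, x ∈ halfSpaceExterior l R → η * ‖p‖ * bump p (θ / 4 * ‖p‖) x ≤ u x := by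
  obtain ⟨ε, hε, hlow⟩ := hS.exists_log_le hn hF hγ hRR hR
  have hSR := hS.mono hRR.le
  have hR₀ : 0 < R := by linarith
  set c₁ : ℝ := (4 / ((n : ℝ) + 4)) ^ 3
  have : 0 < c₁ := by positivity
  set b : ℝ := ε * θ / (4 * 2 ^ n)
  have : 0 < b := by positivity
  obtain ⟨η, hη, R₁, hR₁, hsource⟩ := hF.exists_mul_lt hn hγ (b := c₁ * b)
    (C := 12 * n / (c₁ * (θ / 4) ^ 2)) (by positivity) (by positivity) hR₀
  refine ⟨η, hη, R₁ + 2 * R, by linarith, fun p hp hpl => ?_⟩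
  have hr : 0 < ‖p‖ := by linarith
  have hgeom := fun y => coord_norm_bounds_of_mem_closedBall (y := y) hθ₁ hpl
  have hball : Metric.closedBall p (θ / 4 * ‖p‖) ⊆ halfSpaceExterior l R := fun y hy => by
    obtain ⟨hyl, hpy, -⟩ := hgeom y hy
    exact ⟨by linarith [show 0 < θ / 4 * ‖p‖ by positivity], by linarith⟩
  have hlog : 0 < Real.log (‖p‖ / (2 * R)) :=
    Real.log_pos (by rw [one_lt_div (by positivity)]; linarith)
  refine (hSR.comparison R le_rfl).bump_le_of_doubling
    (t := b * (‖p‖ / ‖p‖ ^ n) * Real.log (‖p‖ / (2 * R))) hSR.pos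
    (fun s hs x hx => hF.pos hR₀.le hs hx) (by positivity) hball (by positivity) (by positivity)
    ?_ ?_
  · filter_upwards [hlow] with y hy hyball
    obtain ⟨hyl, hpy, hyp⟩ := hgeom y hyball
    have hyl₀ : 0 ≤ y l := le_trans (by positivity) hyl
    calc b * (‖p‖ / ‖p‖ ^ n) * Real.log (‖p‖ / (2 * R))
        = ε * (θ / 4 * ‖p‖ / (2 * ‖p‖) ^ n) * Real.log (‖p‖ / 2 / R) := by
          rw [mul_pow, div_div]
          ring
      _ ≤ ε * (y l / ‖y‖ ^ n) * Real.log (‖y‖ / R) := by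
          have hy₀ : 0 < ‖y‖ := by linarith
          have hlog' : 0 ≤ Real.log (‖p‖ / 2 / R) := by rw [div_div]; exact hlog.le
          gcongr
      _ ≤ u y := hy (hball hyball) hyl₀
  · intro y hy s hs hs_low hs_high
    obtain ⟨-, hpy, hyp⟩ := hgeom y hy
    refine (hsource ‖p‖ (by linarith) y (hball hy) hpy hyp s hs ?_ hs_high).trans_eq' ?_
    · rwa [mul_assoc c₁, mul_assoc c₁]
    · rw [mul_pow, ← mul_assoc, div_div]

theorem IsComparisonSupersolution.exists_linear_le [CountableInterFilter ℱ] (hn : 2 ≤ n)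
    (hS : IsComparisonSupersolution ℱ l R₀ F u) (hF : IsCriticalSource l R γ c F) (hγ : γ < 2)
    (hRR : R₀ < R) (hR : 1 ≤ R) {θ : ℝ} (hθ : 0 < θ) (hθ₁ : θ ≤ 1) :
    ∃ η > 0, ∃ R₁ ≥ R, ∀ᶠ x in ℱ, R₁ ≤ ‖x‖ → θ * ‖x‖ ≤ x l → η * ‖x‖ ≤ u x := by
  obtain ⟨η, hη, R₁, hR₁, hbump⟩ := hS.exists_bump_le hn hF hγ hRR hR hθ hθ₁
  obtain ⟨S, hScountable, hSdense⟩ := TopologicalSpace.exists_countable_dense (Eucl n)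
  have hall : ∀ᶠ x in ℱ, ∀ p ∈ S, R₁ ≤ ‖p‖ → θ / 2 * ‖p‖ ≤ p l →
      x ∈ halfSpaceExterior l R → η * ‖p‖ * bump p (θ / 4 * ‖p‖) x ≤ u x := by
    rw [eventually_countable_ball hScountable]
    intro p _
    by_cases hp : R₁ ≤ ‖p‖ ∧ θ / 2 * ‖p‖ ≤ p l
    · filter_upwards [hbump p hp.1 hp.2] with x hx _ _ using hx
    · exact .of_forall fun x hpR hpl => absurd ⟨hpR, hpl⟩ hp
  refine ⟨η / 4, by positivity, 2 * R₁, by linarith, ?_⟩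
  filter_upwards [hall] with x hx hxR hxl
  have hx₀ : 0 < ‖x‖ := by linarith
  have hxD : x ∈ halfSpaceExterior l R := ⟨by linarith [mul_pos hθ hx₀], by linarith⟩
  obtain ⟨p, hpS, hxp⟩ := hSdense.exists_dist_lt x (show 0 < θ / 16 * ‖x‖ by positivity)
  rw [dist_eq_norm] at hxp
  have hsmall : θ / 16 * ‖x‖ ≤ ‖x‖ / 16 := by nlinarith
  have hnorm := abs_le.1 ((abs_norm_sub_norm_le x p).trans hxp.le)
  have hcoord : |x l - p l| ≤ ‖x - p‖ := by simpa using abs_coord_le_norm l (x - p)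
  have hl := abs_le.1 (hcoord.trans hxp.le)
  have hθp : θ * ‖p‖ ≤ θ * (17 / 16 * ‖x‖) := by
    gcongr
    linarith
  have hθx : θ * (15 / 16 * ‖x‖) ≤ θ * ‖p‖ := by
    gcongr
    linarith
  have hp₀ : 0 < ‖p‖ := by linarith
  calc η / 4 * ‖x‖ ≤ η * ‖p‖ * (3 / 4) ^ 3 := by nlinarith
    _ ≤ η * ‖p‖ * bump p (θ / 4 * ‖p‖) x := by
        gcongr
        exact le_bump (by positivity) (by linarith)
    _ ≤ u x := hx p hpS (by linarith) (by linarith) hxD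

end LinearGrowth

/-! ### The linear barrier and nonexistence -/

/-- The barrier `ε (x_l log (L / |x|) + x_l² / |x| - κ |x| - 2 R log (L / R))`. For fixed
`ε log (L / R)` and `L → ∞` it is of size `R` near `{|x| = R}` while its Laplacian has size
`ε / |x|`. The last two terms make it nonpositive outside a cone and outside `{2R ≤ |x| ≤ L}`. -/
noncomputable def linearBarrier {n : ℕ} (l : Fin n) (ε κ R L : ℝ) (y : Eucl n) : ℝ :=
  ε * (y l * Real.log (L / ‖y‖) + y l ^ 2 / ‖y‖ - κ * ‖y‖ - 2 * R * Real.log (L / R))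

theorem coord_le_norm {n : ℕ} (l : Fin n) (x : Eucl n) : x l ≤ ‖x‖ :=
  (le_abs_self _).trans (abs_coord_le_norm l x)

section LinearBarrier

variable {n : ℕ} {l : Fin n} {ε θ κ L R : ℝ} {x : Eucl n}

theorem linearBarrier_eq_zpow (l : Fin n) (ε κ R L : ℝ) :
    linearBarrier l ε κ R L = fun y =>
      ε * (y l * (‖y‖ ^ (0 : ℤ) * (0 + (-1) * Real.log (‖y‖ / L))) +
        (y l ^ 2 * ‖y‖ ^ (-1 : ℤ) + (-κ) * ‖y‖) - 2 * R * Real.log (L / R)) := by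
  funext y
  rw [linearBarrier, ← inv_div ‖y‖ L, Real.log_inv, zpow_zero, zpow_neg_one]
  ring

theorem contDiffAt_linearBarrier (hL : L ≠ 0) (hx : x ≠ 0) :
    ContDiffAt ℝ 2 (linearBarrier l ε κ R L) x :=
  linearBarrier_eq_zpow l ε κ R L ▸ contDiffAt_const.mul
    (((contDiffAt_coord_mul_norm_zpow_log l hx hL _ _ _).add
      ((contDiffAt_coord_sq_mul_norm_zpow l hx _).add
        (contDiffAt_const.mul (contDiffAt_norm ℝ hx)))).sub contDiffAt_const)

theorem neg_laplacian_linearBarrier (hL : L ≠ 0) (hx : x ≠ 0) :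
    -Δ (linearBarrier l ε κ R L) x =
      ε / ‖x‖ * (angularSource n (x l / ‖x‖) + κ * (n - 1)) := by
  have hr : ‖x‖ ≠ 0 := norm_ne_zero_iff.2 hx
  have hlog := contDiffAt_coord_mul_norm_zpow_log l hx hL 0 0 (-1)
  have hsq := contDiffAt_coord_sq_mul_norm_zpow l hx (-1)
  have hnorm : ContDiffAt ℝ 2 (fun y : Eucl n => (-κ) * ‖y‖) x :=
    contDiffAt_const.mul (contDiffAt_norm ℝ hx)
  have hsum := hlog.add (hsq.add hnorm)
  rw [linearBarrier_eq_zpow, laplacian_const_mul ε (hsum.sub contDiffAt_const),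
    laplacian_sub_const _ hsum, laplacian_fun_add hlog (hsq.add hnorm), laplacian_fun_add hsq hnorm,
    laplacian_const_mul (-κ) (contDiffAt_norm ℝ hx), laplacian_norm hx,
    laplacian_coord_mul_norm_zpow_log l hx hL, laplacian_coord_sq_mul_norm_zpow l hx,
    finrank_euclideanSpace_fin, zpow_sub₀ hr, zpow_sub₀ hr, zpow_neg_one, zpow_zero,
    angularSource]
  push_cast
  field_simp
  ring

theorem linearBarrier_nonpos_of_coord_nonpos (hε : 0 ≤ ε) (hR : 1 ≤ R) (hκR : 4 ≤ κ * R)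
    (hRL : R ≤ L) (hx : x ∈ halfSpaceExterior l R) (hl : x l ≤ 0) :
    linearBarrier l ε κ R L x ≤ 0 := by
  obtain ⟨hxl, hr⟩ := hx
  have hr₀ : 0 < ‖x‖ := by linarith
  have hL : 0 < L := by linarith
  have hκ : 0 < κ := pos_of_mul_pos_left (by linarith : 0 < κ * R) (by linarith)
  have hκr : 4 ≤ κ * ‖x‖ := hκR.trans (by gcongr)
  have hlogR : 0 ≤ Real.log (L / R) := Real.log_nonneg (by rw [one_le_div₀] <;> linarith)
  have hlog : -(κ * ‖x‖ / 4) ≤ Real.log (L / ‖x‖) := by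
    have hquot : ‖x‖ / L ≤ κ * ‖x‖ / 4 := by
      rw [div_le_div_iff₀ hL four_pos]
      calc ‖x‖ * 4 ≤ ‖x‖ * (κ * R) := by gcongr
        _ ≤ ‖x‖ * (κ * L) := by gcongr
        _ = κ * ‖x‖ * L := by ring
    rw [← inv_div ‖x‖ L, Real.log_inv, neg_le_neg_iff]
    exact (Real.log_le_self (by positivity)).trans hquot
  have hmain : x l * Real.log (L / ‖x‖) ≤ κ * ‖x‖ / 4 := by
    have hstep : x l * Real.log (L / ‖x‖) ≤ x l * -(κ * ‖x‖ / 4) :=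
      mul_le_mul_of_nonpos_left hlog hl
    nlinarith
  have hsq : x l ^ 2 / ‖x‖ ≤ 1 := by
    rw [div_le_one hr₀]
    nlinarith
  have hlast : 0 ≤ 2 * R * Real.log (L / R) := by positivity
  exact mul_nonpos_of_nonneg_of_nonpos hε (by linarith)

theorem coord_mul_log_le (hR : 0 < R) (hRL : R ≤ L) (hr : R < ‖x‖) (hl : 0 ≤ x l)
    (hann : ‖x‖ ≤ 2 * R ∨ L ≤ ‖x‖) :
    x l * Real.log (L / ‖x‖) ≤ 2 * R * Real.log (L / R) := by
  have hr₀ : 0 < ‖x‖ := by linarith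
  have hlogR : 0 ≤ Real.log (L / R) := Real.log_nonneg (by rwa [one_le_div₀ hR])
  have hlog : Real.log (L / ‖x‖) ≤ Real.log (L / R) :=
    Real.log_le_log (div_pos (by linarith) hr₀) (div_le_div_of_nonneg_left (by linarith) hR hr.le)
  rcases hann with hnear | hfar
  · calc x l * Real.log (L / ‖x‖) ≤ x l * Real.log (L / R) := by gcongr
      _ ≤ 2 * R * Real.log (L / R) := by
        gcongr
        exact (coord_le_norm l x).trans hnear
  · have hlog₀ : Real.log (L / ‖x‖) ≤ 0 :=
      Real.log_nonpos (div_nonneg (by linarith) hr₀.le) ((div_le_one hr₀).2 hfar)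
    exact (mul_nonpos_of_nonneg_of_nonpos hl hlog₀).trans (by positivity)

theorem sq_coord_div_norm_le_norm (l : Fin n) (x : Eucl n) : x l ^ 2 / ‖x‖ ≤ ‖x‖ := by
  refine div_le_of_le_mul₀ (norm_nonneg x) (norm_nonneg x) ?_
  rw [← sq, ← sq_abs]
  gcongr
  exact abs_coord_le_norm l x

theorem linearBarrier_le_of_mul_log_le (hε : 0 ≤ ε) (hκ : 0 ≤ κ)
    (hlog : x l * Real.log (L / ‖x‖) ≤ 2 * R * Real.log (L / R)) :
    linearBarrier l ε κ R L x ≤ ε * ‖x‖ := by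
  unfold linearBarrier
  gcongr
  linarith [sq_coord_div_norm_le_norm l x, mul_nonneg hκ (norm_nonneg x)]

theorem linearBarrier_nonpos_of_mul_log_le (hε : 0 ≤ ε) (hr : 0 < ‖x‖) (hl : 0 ≤ x l)
    (hlθ : x l ≤ θ * ‖x‖) (hlog : x l * Real.log (L / ‖x‖) ≤ 2 * R * Real.log (L / R)) :
    linearBarrier l ε (θ ^ 2) R L x ≤ 0 := by
  have hsq : x l ^ 2 / ‖x‖ ≤ θ ^ 2 * ‖x‖ := by
    rw [div_le_iff₀ hr]
    calc x l ^ 2 ≤ (θ * ‖x‖) ^ 2 := by gcongr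
      _ = θ ^ 2 * ‖x‖ * ‖x‖ := by ring
  exact mul_nonpos_of_nonneg_of_nonpos hε (by linarith)

theorem linearBarrier_le (hε : 0 ≤ ε) (hκ : 0 ≤ κ) (hR : 0 < R) (hRL : R ≤ L) (hr : R ≤ ‖x‖)
    (hl : 0 ≤ x l) : linearBarrier l ε κ R L x ≤ (ε * Real.log (L / R) + ε) * ‖x‖ := by
  have hr₀ : 0 < ‖x‖ := by linarith
  have hlogR : 0 ≤ Real.log (L / R) := Real.log_nonneg (by rwa [one_le_div₀ hR])
  have hlog : Real.log (L / ‖x‖) ≤ Real.log (L / R) :=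
    Real.log_le_log (div_pos (by linarith) hr₀) (div_le_div_of_nonneg_left (by linarith) hR hr)
  have hmul : x l * Real.log (L / ‖x‖) ≤ ‖x‖ * Real.log (L / R) :=
    (mul_le_mul_of_nonneg_left hlog hl).trans
      (mul_le_mul_of_nonneg_right (coord_le_norm l x) hlogR)
  have hlast : 0 ≤ κ * ‖x‖ + 2 * R * Real.log (L / R) := by positivity
  calc linearBarrier l ε κ R L x ≤ ε * (‖x‖ * Real.log (L / R) + ‖x‖) :=
        mul_le_mul_of_nonneg_left (by linarith [sq_coord_div_norm_le_norm l x]) hε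
    _ = (ε * Real.log (L / R) + ε) * ‖x‖ := by ring

theorem le_linearBarrier (hε : 0 ≤ ε) (hθ : 0 ≤ θ) (hθ₁ : θ ≤ 1 / 2) (hR : 0 < R) (hL : 0 < L)
    (hlogR : 3 ≤ Real.log (L / R)) (hl : 4 * R ≤ x l) (hr : ‖x‖ ≤ 8 * R) :
    ε * (2 * R * Real.log (L / R) - 12 * R) ≤ linearBarrier l ε (θ ^ 2) R L x := by
  have hr₀ : 0 < ‖x‖ := by linarith [coord_le_norm l x]
  have hlog : Real.log (L / R) - 3 ≤ Real.log (L / ‖x‖) := by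
    have hlog_eight : Real.log 8 ≤ 3 := by
      rw [show (8 : ℝ) = 2 ^ 3 by norm_num, Real.log_pow]
      push_cast
      linarith [Real.log_two_lt_d9]
    calc Real.log (L / R) - 3 ≤ Real.log (L / R) - Real.log 8 := by gcongr
      _ = Real.log (L / (8 * R)) := by
        rw [← Real.log_div (by positivity) (by norm_num), div_div, mul_comm R]
      _ ≤ Real.log (L / ‖x‖) := Real.log_le_log (by positivity) (by gcongr)
  have hmain : 4 * R * (Real.log (L / R) - 3) ≤ x l * Real.log (L / ‖x‖) := by
    have : 0 ≤ Real.log (L / R) - 3 := by linarith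
    have hl₀ : 0 ≤ x l := by linarith
    gcongr
  have hsq : θ ^ 2 * ‖x‖ ≤ x l ^ 2 / ‖x‖ := by
    rw [le_div_iff₀ hr₀]
    calc θ ^ 2 * ‖x‖ * ‖x‖ = (θ * ‖x‖) ^ 2 := by ring
      _ ≤ (1 / 2 * (8 * R)) ^ 2 := by gcongr
      _ = (4 * R) ^ 2 := by ring
      _ ≤ x l ^ 2 := by gcongr
  exact mul_le_mul_of_nonneg_left (by linarith) hε

theorem ComparisonOn.linearBarrier_le {ℱ : Filter (Eucl n)} {F : ℝ → Eucl n → ℝ}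
    {u : Eucl n → ℝ} (h : ComparisonOn ℱ (halfSpaceExterior l R) F u) (hR : 1 ≤ R)
    (hθR : 4 ≤ θ ^ 2 * R) (hRL : R ≤ L) (hε : 0 ≤ ε)
    (hpos : ∀ᶠ x in ℱ, x ∈ halfSpaceExterior l R → 0 < u x)
    (hcone : ∀ᶠ x in ℱ, R ≤ ‖x‖ → θ * ‖x‖ ≤ x l → ε * ‖x‖ ≤ u x)
    (hcontact : ∀ᶠ x in ℱ, 0 ≤ x l → 2 * R ≤ ‖x‖ → u x < linearBarrier l ε (θ ^ 2) R L x →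
      ε / ‖x‖ * (angularSource n (x l / ‖x‖) + θ ^ 2 * (n - 1)) < F (u x) x) :
    ∀ᶠ x in ℱ, x ∈ halfSpaceExterior l R → linearBarrier l ε (θ ^ 2) R L x ≤ u x := by
  have hR₀ : 0 < R := by linarith
  have hL : L ≠ 0 := by linarith
  have hne : ∀ x : Eucl n, R < ‖x‖ → x ≠ 0 := fun x hx => norm_pos_iff.1 (by linarith)
  refine h _ _ (fun x hx => (contDiffAt_linearBarrier hL (hne x hx.2)).contDiffWithinAt)
    (isCompact_halfAnnulus l (2 * R) L) (fun x hx => ⟨by linarith [hx.1], by linarith [hx.2.1]⟩)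
    ?_ ?_
  · filter_upwards [hpos, hcone] with x hux hxcone hxD hxK
    rcases le_total (x l) 0 with hl | hl
    · exact (linearBarrier_nonpos_of_coord_nonpos hε hR hθR hRL hxD hl).trans (hux hxD).le
    have hann : ‖x‖ ≤ 2 * R ∨ L ≤ ‖x‖ := by
      by_contra! hx
      exact hxK ⟨hl, hx.1.le, hx.2.le⟩
    have hlog := coord_mul_log_le hR₀ hRL hxD.2 hl hann
    rcases le_total (x l) (θ * ‖x‖) with hlθ | hlθ
    · exact (linearBarrier_nonpos_of_mul_log_le hε (hR₀.trans hxD.2) hl hlθ hlog).trans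
        (hux hxD).le
    · exact (linearBarrier_le_of_mul_log_le hε (sq_nonneg θ) hlog).trans (hxcone hxD.2.le hlθ)
  · filter_upwards [hcontact] with x hx hxK hlt
    rw [neg_laplacian_linearBarrier hL (hne x (by linarith [hxK.2.1]))]
    exact hx hxK.1 hxK.2.1 hlt

end LinearBarrier

section LinearBarrierComparison

variable {n : ℕ} {ℱ : Filter (Eucl n)} {l : Fin n} {R₀ R γ c η M : ℝ} {F : ℝ → Eucl n → ℝ}
  {u : Eucl n → ℝ}

theorem exists_linearBarrier_params {m A : ℝ} (hR : 0 < R) (hη : 0 < η) (hm : 0 < m)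
    (hM : 0 < M) (hA : 0 < A) :
    ∃ ε L : ℝ, 0 < ε ∧ ε ≤ 1 ∧ ε ≤ η ∧ ε * A ≤ m ∧ R ≤ L ∧ 3 ≤ Real.log (L / R) ∧
      ε * Real.log (L / R) = M := by
  set ε : ℝ := min (min 1 η) (min (m / A) (M / 3))
  have hε : 0 < ε := by positivity
  refine ⟨ε, R * Real.exp (M / ε), hε, (min_le_left _ _).trans (min_le_left _ _),
    (min_le_left _ _).trans (min_le_right _ _), ?_,
    le_mul_of_one_le_right hR.le (Real.one_le_exp (by positivity)), ?_, ?_⟩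
  · exact (le_div_iff₀ hA).1 ((min_le_right _ _).trans (min_le_left _ _))
  · rw [mul_div_cancel_left₀ _ hR.ne', Real.log_exp, le_div_comm₀ three_pos hε]
    exact (min_le_right _ _).trans (min_le_right _ _)
  · rw [mul_div_cancel_left₀ _ hR.ne', Real.log_exp, mul_div_cancel₀ _ hε.ne']

theorem min_rpow_le_rpow {a b z k : ℝ} (ha : 0 < a) (haz : a ≤ z) (hzb : z ≤ b) :
    min (a ^ k) (b ^ k) ≤ z ^ k := by
  rcases le_total 0 k with hk | hk
  · exact (min_le_left _ _).trans (Real.rpow_le_rpow ha.le haz hk)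
  · exact (min_le_right _ _).trans (Real.rpow_le_rpow_of_nonpos (by linarith) hzb hk)

theorem IsCriticalSource.angularSource_add_lt (hF : IsCriticalSource l R γ c F) (hn : 2 ≤ n)
    (hR : 0 ≤ R) {ε s : ℝ} {x : Eucl n} (hε : 0 < ε) (hη : 0 < η)
    (hεc : ε * (2 * n + 1) ≤ c * min (η ^ (γ - 1)) (M ^ (γ - 1)))
    (hx : x ∈ halfSpaceExterior l R) (hl : 0 ≤ x l) (hs : 0 < s) (hsM : s ≤ M * ‖x‖)
    (hcone : 1 / (2 * n) * ‖x‖ ≤ x l → 1 ≤ s ∧ η * ‖x‖ ≤ s) :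
    ε / ‖x‖ * (angularSource n (x l / ‖x‖) + (1 / (2 * n)) ^ 2 * (n - 1)) < F s x := by
  have hn' : (2 : ℝ) ≤ n := by exact_mod_cast hn
  have hr : 0 < ‖x‖ := hR.trans_lt hx.2
  have ht₀ : 0 ≤ x l / ‖x‖ := by positivity
  have hκ : (1 / (2 * (n : ℝ))) ^ 2 * (n - 1) ≤ 1 / 4 := by
    rw [div_pow, one_pow, one_div_mul_eq_div, div_le_iff₀ (by positivity)]
    nlinarith
  rcases le_total (x l / ‖x‖) (1 / (2 * n)) with ht | ht
  · refine lt_of_le_of_lt ?_ (hF.pos hR hs hx)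
    have hneg := angularSource_nonpos hn ht₀ ht
    exact mul_nonpos_of_nonneg_of_nonpos (by positivity) (by linarith)
  · have hc := hF.const_pos
    obtain ⟨hs₁, hs_low⟩ := hcone ((le_div_iff₀ hr).1 ht)
    have hangular := angularSource_le (n := n) ht₀ (coord_div_norm_le_one l x)
    calc ε / ‖x‖ * (angularSource n (x l / ‖x‖) + (1 / (2 * n)) ^ 2 * (n - 1))
        < ε / ‖x‖ * (2 * n + 1) := mul_lt_mul_of_pos_left (by linarith) (by positivity)
      _ = ε * (2 * n + 1) / ‖x‖ := by ring
      _ ≤ c * (s / ‖x‖) ^ (γ - 1) / ‖x‖ :=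
          div_le_div_of_nonneg_right (hεc.trans (mul_le_mul_of_nonneg_left
            (min_rpow_le_rpow hη ((le_div_iff₀ hr).2 hs_low) ((div_le_iff₀ hr).2 hsM)) hc.le)) hr.le
      _ = c * ‖x‖ ^ (-γ) * s ^ (γ - 1) := by
          rw [Real.div_rpow hs.le hr.le, Real.rpow_neg hr.le, Real.rpow_sub_one hr.ne']
          field_simp
      _ ≤ F s x := hF.le_of_one_le s hs₁ x hx

theorem IsComparisonSupersolution.le_of_linear_le (hn : 2 ≤ n)
    (hS : IsComparisonSupersolution ℱ l R F u) (hF : IsCriticalSource l R γ c F)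
    (hRn : 16 * (n : ℝ) ^ 2 ≤ R) (hη : 0 < η) (hRη : 1 / η ≤ R)
    (hlin : ∀ᶠ x in ℱ, R ≤ ‖x‖ → 1 / (2 * n) * ‖x‖ ≤ x l → η * ‖x‖ ≤ u x) (hM : 0 < M) :
    ∀ᶠ x in ℱ, 4 * R ≤ x l → ‖x‖ ≤ 8 * R → R * (2 * M - 12) ≤ u x := by
  have hn' : (2 : ℝ) ≤ n := by exact_mod_cast hn
  have hR : 1 ≤ R := by nlinarith
  have hR₀ : 0 < R := by linarith
  have hc := hF.const_pos
  have hθ : 1 / (2 * (n : ℝ)) ≤ 1 / 2 := by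
    gcongr
    linarith
  have hθR : 4 ≤ (1 / (2 * (n : ℝ))) ^ 2 * R := by
    rw [div_pow, one_pow, one_div_mul_eq_div, le_div_iff₀ (by positivity)]
    linarith
  obtain ⟨ε, L, hε, hε₁, hεη, hεc, hRL, hlog, hεM⟩ := exists_linearBarrier_params
    (m := c * min (η ^ (γ - 1)) ((M + 1) ^ (γ - 1))) (A := 2 * n + 1) hR₀ hη (by positivity) hM
    (by positivity)
  have hbarrier := (hS.comparison R le_rfl).linearBarrier_le (θ := 1 / (2 * n)) hR hθR hRL hε.le
    hS.pos (hlin.mono fun x hx hr hl => (by gcongr : ε * ‖x‖ ≤ η * ‖x‖).trans (hx hr hl)) <| by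
      filter_upwards [hS.pos, hlin] with x hux hxlin hl hr hlt
      have hxD : x ∈ halfSpaceExterior l R := ⟨by linarith, by linarith⟩
      refine hF.angularSource_add_lt hn hR₀.le hε hη hεc hxD hl (hux hxD) ?_ fun hcone => ?_
      · calc u x ≤ (ε * Real.log (L / R) + ε) * ‖x‖ := hlt.le.trans
              (linearBarrier_le hε.le (sq_nonneg _) hR₀ hRL hxD.2.le hl)
          _ ≤ (M + 1) * ‖x‖ := by
              rw [hεM]
              gcongr
      · have hlow := hxlin hxD.2.le hcone
        have hηr : 1 ≤ η * ‖x‖ := by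
          rw [← div_le_iff₀' hη]
          linarith
        exact ⟨hηr.trans hlow, hlow⟩
  filter_upwards [hbarrier] with x hx hl hr
  have hxD : x ∈ halfSpaceExterior l R := ⟨by linarith, by linarith [coord_le_norm l x]⟩
  calc R * (2 * M - 12) ≤ 2 * R * M - ε * (12 * R) := by nlinarith
    _ = ε * (2 * R * Real.log (L / R) - 12 * R) := by
        rw [← hεM]
        ring
    _ ≤ linearBarrier l ε ((1 / (2 * n)) ^ 2) R L x :=
        le_linearBarrier hε.le (by positivity) hθ hR₀ (hR₀.trans_le hRL) hlog hl hr
    _ ≤ u x := hx hxD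

theorem IsComparisonSupersolution.false [CountableInterFilter ℱ] (hn : 2 ≤ n)
    (hS : IsComparisonSupersolution ℱ l R₀ F u) (hF : IsCriticalSource l R₀ γ c F) (hγ : γ < 2)
    (hfreq : ∀ U : Set (Eucl n), IsOpen U → U.Nonempty → ∃ᶠ x in ℱ, x ∈ U) : False := by
  set R : ℝ := max 1 (R₀ + 1)
  have hR : 1 ≤ R := le_max_left _ _
  have hRR : R₀ < R := by linarith [le_max_right 1 (R₀ + 1)]
  have hn₀ : (1 : ℝ) ≤ 2 * n := by norm_cast; lia
  obtain ⟨η, hη, R₁, hR₁, hlin⟩ := hS.exists_linear_le hn (hF.mono hRR.le) hγ hRR hR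
    (θ := 1 / (2 * n)) (by positivity) (div_le_one_of_le₀ hn₀ (by positivity))
  set R₂ : ℝ := max R₁ (max (16 * (n : ℝ) ^ 2) (1 / η))
  have hR₂ : R₁ ≤ R₂ := le_max_left _ _
  have hRR₂ : R₀ ≤ R₂ := by linarith
  have hR₂₀ : 0 < R₂ := by linarith
  have hunbounded : ∀ k : ℕ, ∀ᶠ x in ℱ, 4 * R₂ ≤ x l → ‖x‖ ≤ 8 * R₂ →
      R₂ * (2 * ((k : ℝ) + 1) - 12) ≤ u x := fun k =>
    (hS.mono hRR₂).le_of_linear_le hn (hF.mono hRR₂) ((le_max_left _ _).trans (le_max_right _ _))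
      hη ((le_max_right _ _).trans (le_max_right _ _))
      (hlin.mono fun x hx hr => hx (hR₂.trans hr)) (by positivity)
  have hregion : ∃ᶠ x in ℱ, x ∈ {x : Eucl n | 4 * R₂ < x l ∧ ‖x‖ < 8 * R₂} := by
    refine hfreq _ ((isOpen_lt continuous_const (continuous_coord l)).inter
      (isOpen_lt continuous_norm continuous_const)) ⟨EuclideanSpace.single l (6 * R₂), ?_, ?_⟩
    · simpa using mul_lt_mul_of_pos_right (by norm_num : (4 : ℝ) < 6) hR₂₀
    · rw [PiLp.norm_single, Real.norm_eq_abs, abs_of_pos (by positivity)]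
      gcongr
      norm_num
  obtain ⟨x, ⟨hl, hr⟩, hx⟩ :=
    (hregion.and_eventually (eventually_countable_forall.2 hunbounded)).exists
  obtain ⟨k, hk⟩ := exists_nat_gt (|u x| / R₂ + 12)
  have hku := hx k hl.le hr.le
  have hquot : |u x| / R₂ < 2 * ((k : ℝ) + 1) - 12 := by
    linarith [show 0 ≤ |u x| / R₂ by positivity]
  rw [div_lt_iff₀' hR₂₀] at hquot
  linarith [le_abs_self (u x)]

end LinearBarrierComparison

section Translation

variable {n : ℕ} {ℱ : Filter (Eucl n)} {l : Fin n} {R r₀ γ c : ℝ} {F : ℝ → Eucl n → ℝ}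
  {g : ℝ → ℝ} {u : Eucl n → ℝ} {p y : Eucl n}

theorem upperHalfSpace_eq (hl : (l : ℕ) + 1 = n) : upperHalfSpace n = {x | 0 < x l} := by
  ext x
  constructor
  · rintro ⟨i, hi, hx⟩
    have hil : i = l := Fin.ext (by lia)
    exact hil ▸ hx
  · exact fun hx => ⟨l, hl, hx⟩

theorem isOpen_halfSpace_diff_closedBall (l : Fin n) (r₀ : ℝ) :
    IsOpen ({x : Eucl n | 0 < x l} \ Metric.closedBall 0 r₀) :=
  (isOpen_lt continuous_const (continuous_coord l)).sdiff Metric.isClosed_closedBall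

theorem add_single_mem_halfSpace_diff_closedBall (hy : y ∈ halfSpaceExterior l (1 + r₀)) :
    y + EuclideanSpace.single l 1 ∈ {x : Eucl n | 0 < x l} \ Metric.closedBall 0 r₀ := by
  refine ⟨?_, ?_⟩
  · have hcoord : (y + EuclideanSpace.single l (1 : ℝ)).ofLp l = y l + 1 := by simp
    exact (neg_lt_iff_pos_add.1 hy.1).trans_eq hcoord.symm
  · have hsub := norm_sub_le (y + EuclideanSpace.single l 1) (EuclideanSpace.single l 1)
    rw [add_sub_cancel_right, PiLp.norm_single, norm_one] at hsub
    rw [mem_closedBall_zero_iff, not_le]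
    linarith [hy.2]

theorem ComparisonOn.translate {D : Set (Eucl n)} (p : Eucl n)
    (h : ComparisonOn ℱ ((fun x => x - p) ⁻¹' D) F u) :
    ComparisonOn (ℱ.map fun x => x - p) D (fun s y => F s (y + p)) (fun y => u (y + p)) := by
  intro φ K hφ hK hKD hout hcontact
  simp only [eventually_map, sub_add_cancel] at *
  refine h (fun x => φ (x - p)) ((fun x => x - p) ⁻¹' K)
    (hφ.comp (contDiff_id.sub contDiff_const).contDiffOn fun x hx => hx)
    ((Homeomorph.subRight p).isCompact_preimage.2 hK) (preimage_mono hKD) hout ?_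
  filter_upwards [hcontact] with x hx
  rw [laplacian_comp_sub]
  exact hx

theorem isComparisonSupersolution_translate
    (hpos : ∀ᶠ x in ℱ, x ∈ {x : Eucl n | 0 < x l} \ Metric.closedBall 0 r₀ → 0 < u x)
    (hlow : ∀ K, IsCompact K → K ⊆ {x : Eucl n | 0 < x l} \ Metric.closedBall 0 r₀ →
      ∃ c > 0, ∀ᶠ x in ℱ, x ∈ K → c ≤ u x)
    (hcomp : ∀ D, IsOpen D → D ⊆ {x : Eucl n | 0 < x l} \ Metric.closedBall 0 r₀ →
      ComparisonOn ℱ D F u) :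
    IsComparisonSupersolution (ℱ.map fun x => x - EuclideanSpace.single l 1) l (1 + r₀)
      (fun s y => F s (y + EuclideanSpace.single l 1))
      (fun y => u (y + EuclideanSpace.single l 1)) := by
  set p : Eucl n := EuclideanSpace.single l 1
  have hmem : ∀ x, x - p ∈ halfSpaceExterior l (1 + r₀) →
      x ∈ {x : Eucl n | 0 < x l} \ Metric.closedBall 0 r₀ := fun x hx => by
    simpa only [p, sub_add_cancel] using add_single_mem_halfSpace_diff_closedBall hx
  refine ⟨?_, fun K hK hKD => ?_, fun R hR => ?_⟩
  · simpa only [eventually_map, sub_add_cancel] using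
      hpos.mono fun x hx hxD => hx (hmem x hxD)
  · simp only [eventually_map, sub_add_cancel]
    exact hlow ((fun x => x - p) ⁻¹' K) ((Homeomorph.subRight p).isCompact_preimage.2 hK)
      fun x hx => hmem x (hKD hx)
  · exact (hcomp _ ((isOpen_halfSpaceExterior l R).preimage (continuous_sub_right p))
      fun x hx => hmem x (halfSpaceExterior_anti hR hx)).translate p

theorem isCriticalSource_translate (hR : 2 ≤ R) (hp : ‖p‖ ≤ 1) (hc : 0 < c)
    (hg_zero : ∀ s, 0 < s → s ≤ 1 → c * s ^ criticalExponent n γ ≤ g s)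
    (hg_top : ∀ s, 1 ≤ s → c * s ^ (γ - 1) ≤ g s) :
    IsCriticalSource l R γ (2 ^ (-|γ|) * c) (fun s y => ‖y + p‖ ^ (-γ) * g s) := by
  have hlow : ∀ s k : ℝ, 0 ≤ s → c * s ^ k ≤ g s → ∀ y ∈ halfSpaceExterior l R,
      2 ^ (-|γ|) * c * ‖y‖ ^ (-γ) * s ^ k ≤ ‖y + p‖ ^ (-γ) * g s := by
    intro s k hs hgs y ⟨_, hy⟩
    have hupper := norm_add_le y p
    have hlower := norm_sub_le (y + p) p
    rw [add_sub_cancel_right] at hlower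
    calc 2 ^ (-|γ|) * c * ‖y‖ ^ (-γ) * s ^ k = 2 ^ (-|γ|) * ‖y‖ ^ (-γ) * (c * s ^ k) := by ring
      _ ≤ ‖y + p‖ ^ (-γ) * g s := by
        gcongr
        exact two_rpow_neg_abs_mul_rpow_le (by linarith) (by linarith) (by linarith)
  exact ⟨by positivity, fun s hs hs₁ => hlow s (criticalExponent n γ) hs.le (hg_zero s hs hs₁),
    fun s hs₁ => hlow s (γ - 1) (zero_le_one.trans hs₁) (hg_top s hs₁)⟩

theorem false_of_comparisonOn [CountableInterFilter ℱ] (hn : 2 ≤ n) (hγ : γ < 2) (hr₀ : 0 ≤ r₀)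
    (hc : 0 < c) (hg_zero : ∀ s, 0 < s → s ≤ 1 → c * s ^ criticalExponent n γ ≤ g s)
    (hg_top : ∀ s, 1 ≤ s → c * s ^ (γ - 1) ≤ g s)
    (hpos : ∀ᶠ x in ℱ, x ∈ {x : Eucl n | 0 < x l} \ Metric.closedBall 0 r₀ → 0 < u x)
    (hlow : ∀ K, IsCompact K → K ⊆ {x : Eucl n | 0 < x l} \ Metric.closedBall 0 r₀ →
      ∃ c > 0, ∀ᶠ x in ℱ, x ∈ K → c ≤ u x)
    (hcomp : ∀ D, IsOpen D → D ⊆ {x : Eucl n | 0 < x l} \ Metric.closedBall 0 r₀ →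
      ComparisonOn ℱ D (fun s x => ‖x‖ ^ (-γ) * g s) u)
    (hfreq : ∀ U : Set (Eucl n), IsOpen U → U.Nonempty → ∃ᶠ x in ℱ, x ∈ U) : False := by
  have hS := (isComparisonSupersolution_translate hpos hlow hcomp).mono
    (by linarith : 1 + r₀ ≤ 2 + r₀)
  refine hS.false hn (isCriticalSource_translate (by linarith) (by simp) hc hg_zero hg_top) hγ
    fun U hU ⟨y, hy⟩ => frequently_map.2 <|
      hfreq ((fun x => x - EuclideanSpace.single l 1) ⁻¹' U) (hU.preimage (continuous_sub_right _))
      ⟨y + EuclideanSpace.single l 1, ?_⟩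
  rwa [mem_preimage, add_sub_cancel_right]

end Translation

theorem exists_pos_le_of_le_off_isCompact {X : Type*} [TopologicalSpace X] {h : X → ℝ}
    {s K : Set X} {a : ℝ} (hK : IsCompact K) (hcont : ContinuousOn h K) (hpos : ∀ x ∈ K, 0 < h x)
    (ha : 0 < a) (hoff : ∀ x ∈ s, x ∉ K → a ≤ h x) : ∃ c > 0, ∀ x ∈ s, c ≤ h x := by
  obtain ⟨c, hc, hcK⟩ := hK.exists_forall_le' hcont hpos
  refine ⟨min a c, lt_min ha hc, fun x hx => ?_⟩
  by_cases hxK : x ∈ K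
  · exact (min_le_right _ _).trans (hcK x hxK)
  · exact (min_le_left _ _).trans (hoff x hx hxK)

theorem exists_pos_eventually_lt_of_liminf_pos {ι : Type*} {h : ι → ℝ} {ℓ : Filter ι}
    (hl : (0 : EReal) < liminf (fun s => (h s : EReal)) ℓ) : ∃ a > 0, ∀ᶠ s in ℓ, a < h s := by
  obtain ⟨a, ha₀, ha⟩ := EReal.lt_iff_exists_real_btwn.1 hl
  exact ⟨a, by exact_mod_cast ha₀,
    (eventually_lt_of_lt_liminf ha).mono fun s hs => by exact_mod_cast hs⟩

section LowerLimits

variable {g : ℝ → ℝ} {k : ℝ}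

theorem continuousOn_rpow_mul (hg : ContinuousOn g (Ioi 0)) (k : ℝ) :
    ContinuousOn (fun s : ℝ => s ^ k * g s) (Ioi 0) :=
  (continuousOn_id.rpow_const fun _ hs => Or.inl (ne_of_gt hs)).mul hg

theorem mul_rpow_le_of_le_rpow_neg_mul {c s : ℝ} (hs : 0 < s) (h : c ≤ s ^ (-k) * g s) :
    c * s ^ k ≤ g s := by
  rwa [Real.rpow_neg hs.le, inv_mul_eq_div, le_div_iff₀ (by positivity)] at h

theorem exists_mul_rpow_le_near_zero (hg : ContinuousOn g (Ioi 0)) (hpos : ∀ s, 0 < s → 0 < g s)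
    (hl : (0 : EReal) < liminf (fun s : ℝ => ((s ^ (-k) * g s : ℝ) : EReal)) (𝓝[>] 0)) :
    ∃ c > 0, ∀ s, 0 < s → s ≤ 1 → c * s ^ k ≤ g s := by
  obtain ⟨a, ha, hev⟩ := exists_pos_eventually_lt_of_liminf_pos hl
  obtain ⟨s₀, hs₀, hnear⟩ := mem_nhdsGT_iff_exists_Ioo_subset.1 hev
  have hpos_Icc : ∀ s ∈ Icc s₀ 1, 0 < s := fun s hs => lt_of_lt_of_le hs₀ hs.1
  obtain ⟨c, hc, hle⟩ := exists_pos_le_of_le_off_isCompact (s := Ioc 0 1) (isCompact_Icc (a := s₀))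
    ((continuousOn_rpow_mul hg (-k)).mono hpos_Icc)
    (fun s hs => mul_pos (Real.rpow_pos_of_pos (hpos_Icc s hs) _) (hpos s (hpos_Icc s hs))) ha
    fun s hs hs' => (hnear ⟨hs.1, not_le.1 fun h => hs' ⟨h, hs.2⟩⟩).le
  exact ⟨c, hc, fun s hs hs₁ => mul_rpow_le_of_le_rpow_neg_mul hs (hle s ⟨hs, hs₁⟩)⟩

theorem exists_mul_rpow_le_near_top (hg : ContinuousOn g (Ioi 0)) (hpos : ∀ s, 0 < s → 0 < g s)
    (hl : (0 : EReal) < liminf (fun s : ℝ => ((s ^ (-k) * g s : ℝ) : EReal)) atTop) :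
    ∃ c > 0, ∀ s, 1 ≤ s → c * s ^ k ≤ g s := by
  obtain ⟨a, ha, hev⟩ := exists_pos_eventually_lt_of_liminf_pos hl
  obtain ⟨s₀, hfar⟩ := eventually_atTop.1 hev
  have hpos_Icc : ∀ s ∈ Icc 1 s₀, 0 < s := fun s hs => zero_lt_one.trans_le hs.1
  obtain ⟨c, hc, hle⟩ := exists_pos_le_of_le_off_isCompact (s := Ici 1) (isCompact_Icc (b := s₀))
    ((continuousOn_rpow_mul hg (-k)).mono hpos_Icc)
    (fun s hs => mul_pos (Real.rpow_pos_of_pos (hpos_Icc s hs) _) (hpos s (hpos_Icc s hs))) ha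
    fun s hs hs' => (hfar s (not_le.1 fun h => hs' ⟨hs, h⟩).le).le
  exact ⟨c, hc, fun s hs =>
    mul_rpow_le_of_le_rpow_neg_mul (zero_lt_one.trans_le hs) (hle s hs)⟩

theorem exists_critical_lower_bound {σ γ : ℝ} (hg : ContinuousOn g (Ioi 0))
    (hpos : ∀ s, 0 < s → 0 < g s)
    (hl_zero : (0 : EReal) < liminf (fun s : ℝ => ((s ^ (-σ) * g s : ℝ) : EReal)) (𝓝[>] 0))
    (hl_top : (0 : EReal) < liminf (fun s : ℝ => ((s ^ (1 - γ) * g s : ℝ) : EReal)) atTop) :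
    ∃ c > 0, (∀ s, 0 < s → s ≤ 1 → c * s ^ σ ≤ g s) ∧ ∀ s, 1 ≤ s → c * s ^ (γ - 1) ≤ g s := by
  obtain ⟨c₀, hc₀, hzero⟩ := exists_mul_rpow_le_near_zero hg hpos hl_zero
  obtain ⟨c₁, hc₁, htop⟩ := exists_mul_rpow_le_near_top (k := γ - 1) hg hpos
    (by simpa only [neg_sub] using hl_top)
  refine ⟨min c₀ c₁, lt_min hc₀ hc₁, fun s hs hs₁ => (hzero s hs hs₁).trans' ?_,
    fun s hs => (htop s hs).trans' ?_⟩
  · gcongr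
    exact min_le_left _ _
  · gcongr
    exact min_le_right _ _

end LowerLimits

/-! ### Classical and viscosity supersolutions -/

section Cutoff

variable {E : Type*} [NormedAddCommGroup E] {D K : Set E} {φ χ : E → ℝ} {x : E}

theorem exists_contDiff_cutoff [NormedSpace ℝ E] [FiniteDimensional ℝ E] (hK : IsCompact K)
    (hD : IsOpen D) (hKD : K ⊆ D) :
    ∃ χ : E → ℝ, ContDiff ℝ ∞ χ ∧ HasCompactSupport χ ∧ tsupport χ ⊆ D ∧
      (∀ᶠ x in 𝓝ˢ K, χ x = 1) ∧ ∀ x, χ x ∈ Icc (0 : ℝ) 1 := by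
  have : ProperSpace E := FiniteDimensional.proper ℝ E
  obtain ⟨K', hK', hKK', hK'D⟩ := exists_compact_between hK hD hKD
  obtain ⟨χ, hone, hzero, hIcc⟩ := exists_contMDiffMap_one_nhds_of_subset_interior
    (n := ⊤) (modelWithCornersSelf ℝ E) hK.isClosed hKK'
  have hsub : tsupport χ ⊆ K' := closure_minimal
    (fun x hx => not_imp_comm.1 (hzero x) hx) hK'.isClosed
  exact ⟨χ, χ.contMDiff.contDiff, hK'.of_isClosed_subset (isClosed_tsupport _) hsub,
    hsub.trans hK'D, hone, hIcc⟩

theorem contDiff_cutoff_mul [NormedSpace ℝ E] {k : WithTop ℕ∞} (hφ : ContDiffOn ℝ k φ D)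
    (hD : IsOpen D) (hχ : ContDiff ℝ k χ) (hsupp : tsupport χ ⊆ D) :
    ContDiff ℝ k (fun x => χ x * φ x) := by
  refine contDiff_iff_contDiffAt.2 fun x => ?_
  by_cases hx : x ∈ tsupport χ
  · exact hχ.contDiffAt.mul (hφ.contDiffAt (hD.mem_nhds (hsupp hx)))
  · refine (contDiffAt_const (c := (0 : ℝ))).congr_of_eventuallyEq ?_
    filter_upwards [notMem_tsupport_iff_eventuallyEq.1 hx] with y hy
    rw [hy, Pi.zero_apply, zero_mul]

theorem laplacian_cutoff_mul [InnerProductSpace ℝ E] [FiniteDimensional ℝ E]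
    (hχ : ∀ᶠ x in 𝓝ˢ K, χ x = 1) (hx : x ∈ K) : Δ (fun x => χ x * φ x) x = Δ φ x := by
  have heq : (fun x => χ x * φ x) =ᶠ[𝓝 x] φ := by
    filter_upwards [hχ.filter_mono (nhds_le_nhdsSet hx)] with y hy
    rw [hy, one_mul]
  exact (InnerProductSpace.laplacian_congr_nhds heq).self_of_nhds

end Cutoff

section Pointwise

variable {n : ℕ} {Ω D : Set (Eucl n)} {f : ℝ → Eucl n → ℝ} {u : Eucl n → ℝ}

theorem IsViscositySupersolution.comparisonOn (hu : IsViscositySupersolution Ω f u)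
    (hD : IsOpen D) (hDΩ : D ⊆ Ω) : ComparisonOn ⊤ D f u := by
  intro φ K hφ hK hKD hout hcontact
  rw [eventually_top] at *
  by_contra! hcon
  obtain ⟨x, hxD, hx⟩ := hcon
  have hxK : x ∈ K := by
    by_contra hxK
    exact (hout x hxD hxK).not_gt hx
  have hneg : ContinuousOn (fun y => -φ y) K := (hφ.continuousOn.mono hKD).neg
  have hlsc : LowerSemicontinuousOn (fun y => u y - φ y) K := by
    simpa only [sub_eq_add_neg] using
      (hu.lowerSemicontinuousOn.mono (hKD.trans hDΩ)).add hneg.lowerSemicontinuousOn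
  obtain ⟨x₀, hx₀K, hmin⟩ := hlsc.exists_isMinOn ⟨x, hxK⟩ hK
  have hx₀_neg : u x₀ - φ x₀ < 0 := (hmin hxK).trans_lt (sub_neg.2 hx)
  obtain ⟨χ, hχ, -, hχD, hχ_one, -⟩ := exists_contDiff_cutoff hK hD hKD
  have hlocal : IsLocalMin (fun y => u y - χ y * φ y) x₀ := by
    filter_upwards [hD.mem_nhds (hKD hx₀K), hχ_one.filter_mono (nhds_le_nhdsSet hx₀K)]
      with y hyD hy
    rw [hy, hχ_one.self_of_nhdsSet x₀ hx₀K, one_mul, one_mul]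
    by_cases hyK : y ∈ K
    · exact hmin hyK
    · linarith [hout y hyD hyK]
  have hsuper := hu.le_neg_laplacian x₀ (hDΩ (hKD hx₀K)) _
    (contDiff_cutoff_mul hφ hD (contDiff_infty.1 hχ 2) hχD).contDiffOn hlocal
  rw [laplacian_cutoff_mul hχ_one hx₀K] at hsuper
  exact hsuper.not_gt (hcontact x₀ hx₀K (sub_neg.1 hx₀_neg))

theorem IsClassicalSupersolution.isViscositySupersolution (hΩ : IsOpen Ω)
    (hu : IsClassicalSupersolution Ω f u) : IsViscositySupersolution Ω f u where
  lowerSemicontinuousOn := hu.contDiffOn.continuousOn.lowerSemicontinuousOn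
  le_neg_laplacian x₀ hx₀ φ hφ hmin := by
    have hu_at := hu.contDiffOn.contDiffAt (hΩ.mem_nhds hx₀)
    have hφ_at := hφ.contDiffAt (hΩ.mem_nhds hx₀)
    have hΔ : 0 ≤ Δ (u - φ) x₀ := laplacian_nonneg_of_isLocalMin hmin (hu_at.sub hφ_at)
    rw [hu_at.laplacian_sub hφ_at] at hΔ
    linarith [hu.le_neg_laplacian x₀ hx₀]

theorem exists_pos_le_of_lowerSemicontinuousOn {X : Type*} [TopologicalSpace X] {v : X → ℝ}
    {K : Set X} (hv : LowerSemicontinuousOn v K) (hK : IsCompact K) (hpos : ∀ x ∈ K, 0 < v x) :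
    ∃ c > 0, ∀ x ∈ K, c ≤ v x := by
  rcases K.eq_empty_or_nonempty with rfl | hne
  · exact ⟨1, one_pos, fun _ => False.elim⟩
  · obtain ⟨x₀, hx₀, hmin⟩ := hv.exists_isMinOn hne hK
    exact ⟨v x₀, hpos x₀ hx₀, fun x hx => hmin hx⟩

end Pointwise

/-! ### Weak supersolutions -/

/-- The `i`-th partial derivative. Weak gradients are tested coordinate by coordinate, so the
integrations by parts below are done in coordinates too. -/
noncomputable def partialDeriv {n : ℕ} (i : Fin n) (φ : Eucl n → ℝ) (x : Eucl n) : ℝ :=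
  fderiv ℝ φ x (EuclideanSpace.single i 1)

section PartialDeriv

variable {n : ℕ} {φ v w : Eucl n → ℝ} {x : Eucl n}

theorem laplacian_eq_sum_partialDeriv (h : ContDiffAt ℝ 2 φ x) :
    Δ φ x = ∑ i, partialDeriv i (partialDeriv i φ) x := by
  simp only [laplacian_eq_sum_fderiv_fderiv (EuclideanSpace.basisFun (Fin n) ℝ)
    (differentiableAt_fderiv_of_contDiffAt_two h), EuclideanSpace.basisFun_apply]
  rfl

theorem contDiff_partialDeriv {k m : WithTop ℕ∞} (h : ContDiff ℝ k φ) (hm : m + 1 ≤ k)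
    (i : Fin n) : ContDiff ℝ m (partialDeriv i φ) :=
  (h.fderiv_right hm).clm_apply contDiff_const

theorem continuous_partialDeriv (h : ContDiff ℝ 1 φ) (i : Fin n) :
    Continuous (partialDeriv i φ) :=
  (contDiff_partialDeriv (m := 0) h (by norm_num) i).continuous

theorem contDiff_one_partialDeriv (h : ContDiff ℝ 2 φ) (i : Fin n) :
    ContDiff ℝ 1 (partialDeriv i φ) :=
  contDiff_partialDeriv h (by norm_num) i

theorem continuous_laplacian (h : ContDiff ℝ 2 φ) : Continuous (Δ φ) := by
  have hsum : Δ φ = fun x => ∑ i, partialDeriv i (partialDeriv i φ) x :=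
    funext fun x => laplacian_eq_sum_partialDeriv h.contDiffAt
  rw [hsum]
  exact continuous_finsetSum _ fun i _ =>
    continuous_partialDeriv (contDiff_one_partialDeriv h i) i

theorem tsupport_partialDeriv_subset (i : Fin n) (φ : Eucl n → ℝ) :
    tsupport (partialDeriv i φ) ⊆ tsupport φ :=
  tsupport_fderiv_apply_subset ℝ _

theorem hasCompactSupport_partialDeriv (h : HasCompactSupport φ) (i : Fin n) :
    HasCompactSupport (partialDeriv i φ) :=
  h.fderiv_apply ℝ _

theorem laplacian_eq_zero_of_notMem_tsupport (hx : x ∉ tsupport φ) : Δ φ x = 0 := by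
  have hzero : φ =ᶠ[𝓝 x] fun _ => 0 := notMem_tsupport_iff_eventuallyEq.1 hx
  rw [(InnerProductSpace.laplacian_congr_nhds hzero).self_of_nhds,
    InnerProductSpace.laplacian_const, Pi.zero_apply]

theorem hasCompactSupport_laplacian (h : HasCompactSupport φ) : HasCompactSupport (Δ φ) :=
  h.mono' fun _ hx => not_imp_comm.1 laplacian_eq_zero_of_notMem_tsupport hx

theorem integrable_mul_of_hasCompactSupport (hv : Continuous v) (hw : Continuous w)
    (hc : HasCompactSupport w) : Integrable (fun x => v x * w x) :=
  (hv.mul hw).integrable_of_hasCompactSupport hc.mul_left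

theorem integral_mul_partialDeriv (hv : ContDiff ℝ 1 v) (hw : ContDiff ℝ 1 w)
    (hc : HasCompactSupport w) (i : Fin n) :
    ∫ x, v x * partialDeriv i w x = -∫ x, partialDeriv i v x * w x :=
  integral_mul_fderiv_eq_neg_fderiv_mul_of_integrable
    (integrable_mul_of_hasCompactSupport (continuous_partialDeriv hv i) hw.continuous hc)
    (integrable_mul_of_hasCompactSupport hv.continuous (continuous_partialDeriv hw i)
      (hasCompactSupport_partialDeriv hc i))
    (integrable_mul_of_hasCompactSupport hv.continuous hw.continuous hc)
    (fun x _ => hv.differentiable one_ne_zero x) (fun x _ => hw.differentiable one_ne_zero x)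

theorem integral_sum_partialDeriv_mul_partialDeriv (hv : ContDiff ℝ 2 v) (hw : ContDiff ℝ 1 w)
    (hc : HasCompactSupport w) :
    ∫ x, ∑ i, partialDeriv i v x * partialDeriv i w x = -∫ x, Δ v x * w x := by
  have hdv := contDiff_one_partialDeriv hv
  simp only [laplacian_eq_sum_partialDeriv hv.contDiffAt, Finset.sum_mul]
  rw [integral_finsetSum, integral_finsetSum, ← Finset.sum_neg_distrib]
  · exact Finset.sum_congr rfl fun i _ => integral_mul_partialDeriv (hdv i) hw hc i
  · exact fun i _ => integrable_mul_of_hasCompactSupport (continuous_partialDeriv (hdv i) i)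
      hw.continuous hc
  · exact fun i _ => integrable_mul_of_hasCompactSupport (hdv i).continuous
      (continuous_partialDeriv hw i) (hasCompactSupport_partialDeriv hc i)

theorem integral_mul_laplacian (hv : ContDiff ℝ 2 v) (hw : ContDiff ℝ 2 w)
    (hc : HasCompactSupport w) : ∫ x, v x * Δ w x = ∫ x, Δ v x * w x := by
  have hdw := contDiff_one_partialDeriv hw
  have hv₁ : ContDiff ℝ 1 v := hv.of_le one_le_two
  calc ∫ x, v x * Δ w x = ∑ i, ∫ x, v x * partialDeriv i (partialDeriv i w) x := by
        simp only [laplacian_eq_sum_partialDeriv hw.contDiffAt, Finset.mul_sum]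
        exact integral_finsetSum _ fun i _ => integrable_mul_of_hasCompactSupport hv.continuous
          (continuous_partialDeriv (hdw i) i)
          (hasCompactSupport_partialDeriv (hasCompactSupport_partialDeriv hc i) i)
    _ = -∫ x, ∑ i, partialDeriv i v x * partialDeriv i w x := by
        rw [integral_finsetSum _ fun i _ => integrable_mul_of_hasCompactSupport
          (continuous_partialDeriv hv₁ i) (hdw i).continuous (hasCompactSupport_partialDeriv hc i),
          ← Finset.sum_neg_distrib]
        exact Finset.sum_congr rfl fun i _ =>
          integral_mul_partialDeriv hv₁ (hdw i) (hasCompactSupport_partialDeriv hc i) i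
    _ = ∫ x, Δ v x * w x := by
        rw [integral_sum_partialDeriv_mul_partialDeriv hv (hw.of_le one_le_two) hc, neg_neg]

end PartialDeriv

section NegativePartPowers

theorem hasDerivAt_min_zero_pow (k : ℕ) (s : ℝ) :
    HasDerivAt (fun s : ℝ => min s 0 ^ (k + 2)) ((k + 2 : ℕ) * min s 0 ^ (k + 1)) s := by
  rcases lt_trichotomy s 0 with hs | rfl | hs
  · have heq : (fun s : ℝ => min s 0 ^ (k + 2)) =ᶠ[𝓝 s] fun s => s ^ (k + 2) := by
      filter_upwards [gt_mem_nhds hs] with t ht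
      rw [min_eq_left ht.le]
    rw [min_eq_left hs.le]
    exact (hasDerivAt_pow (k + 2) s).congr_of_eventuallyEq heq
  · have hO : (fun s : ℝ => min s 0 ^ (k + 2)) =O[𝓝 0] fun s : ℝ => ‖s - 0‖ ^ (k + 2) := by
      refine Asymptotics.IsBigO.of_bound 1 (Eventually.of_forall fun t => ?_)
      rw [norm_pow, norm_pow, one_mul, norm_norm, sub_zero]
      gcongr
      rcases le_total t 0 with h | h
      · rw [min_eq_left h]
      · rw [min_eq_right h, norm_zero]
        exact norm_nonneg t
    simpa using (hO.hasFDerivAt (by lia)).hasDerivAt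
  · have heq : (fun s : ℝ => min s 0 ^ (k + 2)) =ᶠ[𝓝 s] fun _ => 0 := by
      filter_upwards [lt_mem_nhds hs] with t ht
      rw [min_eq_right ht.le, zero_pow (by lia)]
    rw [min_eq_right hs.le, zero_pow (by lia), mul_zero]
    exact (hasDerivAt_const s (0 : ℝ)).congr_of_eventuallyEq heq

theorem contDiff_min_zero_pow (k : ℕ) : ContDiff ℝ (k + 1) (fun s : ℝ => min s 0 ^ (k + 2)) := by
  have hderiv : ∀ k : ℕ, deriv (fun s : ℝ => min s 0 ^ (k + 2)) =
      fun s => ((k + 2 : ℕ) : ℝ) * min s 0 ^ (k + 1) :=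
    fun k => funext fun s => (hasDerivAt_min_zero_pow k s).deriv
  induction k with
  | zero =>
    rw [Nat.cast_zero, zero_add, contDiff_one_iff_deriv, hderiv]
    exact ⟨fun s => (hasDerivAt_min_zero_pow 0 s).differentiableAt, by fun_prop⟩
  | succ k ih =>
    rw [contDiff_succ_iff_deriv, hderiv]
    exact ⟨fun s => (hasDerivAt_min_zero_pow (k + 1) s).differentiableAt, by simp,
      contDiff_const.mul (by exact_mod_cast ih)⟩

theorem contDiff_min_zero_pow_three : ContDiff ℝ 2 (fun s : ℝ => min s 0 ^ 3) := by
  exact_mod_cast contDiff_min_zero_pow 1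

theorem laplacian_min_zero_pow_three_le {E : Type*} [NormedAddCommGroup E]
    [InnerProductSpace ℝ E] [FiniteDimensional ℝ E] {v : E → ℝ} {x : E}
    (hv : ContDiffAt ℝ 2 v x) :
    Δ (fun y => min (v y) 0 ^ 3) x ≤ 3 * min (v x) 0 ^ 2 * Δ v x := by
  have hderiv₂ : HasDerivAt (fun s : ℝ => 3 * min s 0 ^ 2) (6 * min (v x) 0) (v x) := by
    exact ((hasDerivAt_min_zero_pow 0 (v x)).const_mul 3).congr_deriv (by norm_num [← mul_assoc])
  have hderiv : ∀ s : ℝ, HasDerivAt (fun s : ℝ => min s 0 ^ 3) (3 * min s 0 ^ 2) s := fun s => by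
    simpa using hasDerivAt_min_zero_pow 1 s
  rw [laplacian_comp (F := fun s => min s 0 ^ 3) hv (Eventually.of_forall hderiv) hderiv₂]
  linarith [mul_nonneg (neg_nonneg.2 (min_le_right (v x) 0)) (sq_nonneg ‖∇ v x‖)]

end NegativePartPowers

section Convolution

variable {n : ℕ} {ρ w : Eucl n → ℝ}

theorem partialDeriv_convolution (hρ : ContDiff ℝ 1 ρ) (hc : HasCompactSupport ρ)
    (hw : LocallyIntegrable w) (i : Fin n) :
    partialDeriv i (convolution ρ w (ContinuousLinearMap.lsmul ℝ ℝ) volume) =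
      convolution (partialDeriv i ρ) w (ContinuousLinearMap.lsmul ℝ ℝ) volume := by
  have hflip : ∀ κ : Eucl n → ℝ, convolution κ w (ContinuousLinearMap.lsmul ℝ ℝ) volume =
      convolution w κ (ContinuousLinearMap.lsmul ℝ ℝ).flip volume :=
    fun κ => (convolution_flip (ContinuousLinearMap.lsmul ℝ ℝ)).symm
  funext x
  rw [hflip, hflip, partialDeriv,
    (hc.hasFDerivAt_convolution_right _ hw hρ x).fderiv,
    convolution_precompR_apply _ hw (hc.fderiv ℝ) (hρ.continuous_fderiv one_ne_zero)]
  rfl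

theorem integrable_sub_mul_of_hasCompactSupport (hρ : Continuous ρ) (hc : HasCompactSupport ρ)
    (hw : LocallyIntegrable w) (x : Eucl n) : Integrable (fun t => ρ (x - t) * w t) := by
  simpa using (hc.convolutionExists_left
    (ContinuousLinearMap.lsmul ℝ ℝ) hρ hw x).integrable_swap

theorem laplacian_convolution (hρ : ContDiff ℝ 2 ρ) (hc : HasCompactSupport ρ)
    (hw : LocallyIntegrable w) (x : Eucl n) :
    Δ (convolution ρ w (ContinuousLinearMap.lsmul ℝ ℝ) volume) x = ∫ t, Δ ρ (x - t) * w t := by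
  have hdρ := contDiff_one_partialDeriv hρ
  have hdc := hasCompactSupport_partialDeriv hc
  rw [laplacian_eq_sum_partialDeriv (hc.contDiff_convolution_left _ hρ hw).contDiffAt]
  simp only [laplacian_eq_sum_partialDeriv hρ.contDiffAt, Finset.sum_mul]
  rw [integral_finsetSum]
  · refine Finset.sum_congr rfl fun i _ => ?_
    rw [partialDeriv_convolution (hρ.of_le one_le_two) hc hw,
      partialDeriv_convolution (hdρ i) (hdc i) hw, convolution_eq_swap]
    rfl
  · exact fun i _ => integrable_sub_mul_of_hasCompactSupport (continuous_partialDeriv (hdρ i) i)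
      (hasCompactSupport_partialDeriv (hdc i) i) hw x

end Convolution

section Distributional

variable {n : ℕ} {Ω K : Set (Eucl n)} {f : ℝ → Eucl n → ℝ} {u ψ η : Eucl n → ℝ} {M : ℝ}

/-- The inequality `h ≤ -Δ w` in the sense of distributions in `N`. -/
def DistribLeNegLaplacian (N : Set (Eucl n)) (h w : Eucl n → ℝ) : Prop :=
  ∀ η : Eucl n → ℝ, IsTestFunctionOn N η → (∀ x, 0 ≤ η x) →
    ∫ x, h x * η x ≤ -∫ x, w x * Δ η x

theorem integrableOn_of_memLp_two {X F : Type*} [TopologicalSpace X] [MeasurableSpace X]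
    {μ : Measure X} [IsFiniteMeasureOnCompacts μ] [NormedAddCommGroup F] {v : X → F} {K : Set X}
    (h : MemLp v 2 (μ.restrict K)) (hK : IsCompact K) : IntegrableOn v K μ := by
  have : IsFiniteMeasure (μ.restrict K) := isFiniteMeasure_restrict.2 hK.measure_lt_top.ne
  exact h.integrable one_le_two

theorem integrable_mul_of_tsupport_subset (hu : IntegrableOn u K) (hK : IsCompact K)
    (hη : Continuous η) (hsub : tsupport η ⊆ K) : Integrable (fun x => u x * η x) :=
  (integrableOn_iff_integrable_of_support_subset fun _ hx =>
    hsub (subset_tsupport _ (right_ne_zero_of_mul hx))).1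
    (hu.mul_continuousOn hη.continuousOn hK)

theorem IsTestFunctionOn.contDiff_two (h : IsTestFunctionOn Ω η) : ContDiff ℝ 2 η :=
  contDiff_infty.1 h.contDiff 2

theorem IsTestFunctionOn.partialDeriv (h : IsTestFunctionOn Ω η) (i : Fin n) :
    IsTestFunctionOn Ω (partialDeriv i η) where
  contDiff := contDiff_partialDeriv h.contDiff (by simp) i
  hasCompactSupport := hasCompactSupport_partialDeriv h.hasCompactSupport i
  tsupport_subset := (tsupport_partialDeriv_subset i η).trans h.tsupport_subset

theorem IsTestFunctionOn.mono (h : IsTestFunctionOn K η) (hsub : K ⊆ Ω) :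
    IsTestFunctionOn Ω η where
  contDiff := h.contDiff
  hasCompactSupport := h.hasCompactSupport
  tsupport_subset := h.tsupport_subset.trans hsub

theorem IsTestFunctionOn.eq_zero_of_notMem (h : IsTestFunctionOn Ω η) {x : Eucl n} (hx : x ∉ Ω) :
    η x = 0 :=
  image_eq_zero_of_notMem_tsupport fun hx' => hx (h.tsupport_subset hx')

theorem IsTestFunctionOn.laplacian_eq_zero_of_notMem (h : IsTestFunctionOn Ω η) {x : Eucl n}
    (hx : x ∉ Ω) : Δ η x = 0 :=
  laplacian_eq_zero_of_notMem_tsupport fun hx' => hx (h.tsupport_subset hx')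

theorem fderiv_apply_eq_sum (v x : Eucl n) :
    fderiv ℝ η x v = ∑ i, v i * partialDeriv i η x := by
  have hv : v = ∑ i, v i • EuclideanSpace.single i (1 : ℝ) := by
    ext j
    simp [Pi.single_apply]
  conv_lhs => rw [hv]
  simp only [map_sum, map_smul, smul_eq_mul, partialDeriv]

theorem inner_gradient_eq_sum (v x : Eucl n) : ⟪v, ∇ η x⟫ = ∑ i, v i * partialDeriv i η x := by
  rw [real_inner_comm, gradient, InnerProductSpace.toDual_symm_apply, fderiv_apply_eq_sum]

theorem integral_inner_gradient {V : Eucl n → Eucl n} (hV : IsW12LocWithGradient Ω u V)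
    (hη : IsTestFunctionOn Ω η) : ∫ x in Ω, ⟪V x, ∇ η x⟫ = -∫ x in Ω, u x * Δ η x := by
  have hK := hη.hasCompactSupport.isCompact
  have hu := integrableOn_of_memLp_two (hV.memLp _ hK hη.tsupport_subset) hK
  have hV_coord : ∀ i, IntegrableOn (fun x => V x i) (tsupport η) := fun i =>
    (EuclideanSpace.proj i : Eucl n →L[ℝ] ℝ).integrable_comp
      (integrableOn_of_memLp_two (hV.memLp_gradient _ hK hη.tsupport_subset) hK)
  simp only [laplacian_eq_sum_partialDeriv hη.contDiff_two.contDiffAt,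
    Finset.mul_sum, inner_gradient_eq_sum]
  rw [integral_finsetSum, integral_finsetSum, ← Finset.sum_neg_distrib]
  · refine Finset.sum_congr rfl fun i _ => ?_
    rw [← neg_eq_iff_eq_neg]
    exact (hV.isWeakGradient _ (hη.partialDeriv i) i).symm
  · exact fun i _ => (integrable_mul_of_tsupport_subset hu hK
      ((hη.partialDeriv i).partialDeriv i).contDiff.continuous
      ((tsupport_partialDeriv_subset i _).trans (tsupport_partialDeriv_subset i _))).integrableOn
  · exact fun i _ => (integrable_mul_of_tsupport_subset (hV_coord i) hK
      (hη.partialDeriv i).contDiff.continuous (tsupport_partialDeriv_subset i _)).integrableOn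

theorem IsWeakSupersolution.integrable_mul (hu : IsWeakSupersolution Ω f u)
    (hη : IsTestFunctionOn Ω η) (hη₀ : ∀ x, 0 ≤ η x) :
    Integrable (fun x => f (u x) x * η x) := by
  obtain ⟨V, -, h⟩ := hu
  refine (integrableOn_iff_integrable_of_support_subset fun x hx => ?_).1 (h η hη hη₀).1
  exact not_imp_comm.1 hη.eq_zero_of_notMem (right_ne_zero_of_mul hx)

theorem IsWeakSupersolution.integral_le (hu : IsWeakSupersolution Ω f u)
    (hη : IsTestFunctionOn Ω η) (hη₀ : ∀ x, 0 ≤ η x) :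
    ∫ x, f (u x) x * η x ≤ -∫ x, u x * Δ η x := by
  obtain ⟨V, hV, h⟩ := hu
  have hle := (h η hη hη₀).2
  rw [integral_inner_gradient hV hη] at hle
  rwa [setIntegral_eq_integral_of_forall_compl_eq_zero fun x hx => by
      rw [hη.eq_zero_of_notMem hx, mul_zero],
    setIntegral_eq_integral_of_forall_compl_eq_zero fun x hx => by
      rw [hη.laplacian_eq_zero_of_notMem hx, mul_zero]] at hle

theorem IsWeakSupersolution.integrableOn (hu : IsWeakSupersolution Ω f u) (hK : IsCompact K)
    (hKΩ : K ⊆ Ω) : IntegrableOn u K := by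
  obtain ⟨V, hV, -⟩ := hu
  exact integrableOn_of_memLp_two (hV.memLp K hK hKΩ) hK

theorem IsWeakSupersolution.aestronglyMeasurable (hu : IsWeakSupersolution Ω f u)
    (hΩ : IsOpen Ω) (hK : IsCompact K) (hKΩ : K ⊆ Ω) :
    AEStronglyMeasurable (fun x => f (u x) x) (volume.restrict K) := by
  obtain ⟨χ, hχ, hχc, hχΩ, hχ_one, hχ_mem⟩ := exists_contDiff_cutoff hK hΩ hKΩ
  refine
    (hu.integrable_mul ⟨hχ, hχc, hχΩ⟩ fun x => (hχ_mem x).1).aestronglyMeasurable.restrict.congr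
    ?_
  filter_upwards [ae_restrict_mem hK.measurableSet] with x hx
  rw [hχ_one.self_of_nhdsSet x hx, mul_one]

theorem IsWeakSupersolution.integrableOn_min (hu : IsWeakSupersolution Ω f u) (hΩ : IsOpen Ω)
    (hf : ∀ᵐ x ∂(volume.restrict K), 0 < f (u x) x) (hK : IsCompact K) (hKΩ : K ⊆ Ω)
    (hM : 0 ≤ M) : IntegrableOn (fun x => min (f (u x) x) M) K := by
  have : IsFiniteMeasure (volume.restrict K) := isFiniteMeasure_restrict.2 hK.measure_lt_top.ne
  refine Integrable.of_bound (C := M)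
    ((hu.aestronglyMeasurable hΩ hK hKΩ).inf aestronglyMeasurable_const) ?_
  filter_upwards [hf] with x hx
  rw [Real.norm_eq_abs, abs_of_nonneg (le_min hx.le hM)]
  exact min_le_right _ _

theorem IsWeakSupersolution.integral_min_mul_le (hu : IsWeakSupersolution Ω f u) (hΩ : IsOpen Ω)
    (hf : ∀ᵐ x ∂(volume.restrict K), 0 < f (u x) x) (hK : IsCompact K) (hKΩ : K ⊆ Ω)
    (hM : 0 ≤ M) (hη : IsTestFunctionOn K η) (hη₀ : ∀ x, 0 ≤ η x) :
    ∫ x, min (f (u x) x) M * η x ≤ -∫ x, u x * Δ η x :=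
  (integral_mono
    (integrable_mul_of_tsupport_subset (hu.integrableOn_min hΩ hf hK hKΩ hM) hK
      hη.contDiff.continuous hη.tsupport_subset)
    (hu.integrable_mul (hη.mono hKΩ) hη₀)
    fun x => mul_le_mul_of_nonneg_right (min_le_left _ _) (hη₀ x)).trans
    (hu.integral_le (hη.mono hKΩ) hη₀)

theorem IsWeakSupersolution.distribLeNegLaplacian (hu : IsWeakSupersolution Ω f u)
    (hΩ : IsOpen Ω) (hf : ∀ᵐ x ∂(volume.restrict K), 0 < f (u x) x) (hK : IsCompact K)
    (hKΩ : K ⊆ Ω) (hψ : ContDiff ℝ 2 ψ) (hM : 0 ≤ M) :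
    DistribLeNegLaplacian K (fun x => K.indicator (fun x => min (f (u x) x) M) x + Δ ψ x)
      (fun x => K.indicator u x - ψ x) := by
  intro η hη hη₀
  have hη₂ := hη.contDiff_two
  have hΔη := continuous_laplacian hη₂
  have hΔη_supp : tsupport (Δ η) ⊆ K := closure_minimal
    (fun x hx => not_imp_comm.1 hη.laplacian_eq_zero_of_notMem hx) hK.isClosed
  have hleft : ∀ x, (K.indicator (fun x => min (f (u x) x) M) x + Δ ψ x) * η x =
      min (f (u x) x) M * η x + Δ ψ x * η x := fun x => by
    by_cases hx : x ∈ K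
    · rw [indicator_of_mem hx, add_mul]
    · simp only [hη.eq_zero_of_notMem hx, mul_zero, add_zero]
  have hright : ∀ x, (K.indicator u x - ψ x) * Δ η x = u x * Δ η x - ψ x * Δ η x := fun x => by
    by_cases hx : x ∈ K
    · rw [indicator_of_mem hx, sub_mul]
    · simp only [hη.laplacian_eq_zero_of_notMem hx, mul_zero, sub_zero]
  simp only [hleft, hright]
  rw [integral_add (integrable_mul_of_tsupport_subset (hu.integrableOn_min hΩ hf hK hKΩ hM) hK
      hη.contDiff.continuous hη.tsupport_subset)
    (integrable_mul_of_hasCompactSupport (continuous_laplacian hψ) hη₂.continuous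
      hη.hasCompactSupport),
    integral_sub (integrable_mul_of_tsupport_subset (hu.integrableOn hK hKΩ) hK hΔη hΔη_supp)
    (integrable_mul_of_hasCompactSupport hψ.continuous hΔη
      (hasCompactSupport_laplacian hη.hasCompactSupport)),
    integral_mul_laplacian hψ hη₂ hη.hasCompactSupport]
  linarith [hu.integral_min_mul_le hΩ hf hK hKΩ hM hη hη₀]

end Distributional

section Mollification

variable {n : ℕ} {N : Set (Eucl n)} {h w η : Eucl n → ℝ} {c B C δ : ℝ}

/-- The mollification of `w`, that is, its convolution with a normalized bump function. -/
noncomputable def mollify (b : ContDiffBump (0 : Eucl n)) (w : Eucl n → ℝ) : Eucl n → ℝ :=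
  convolution (b.normed volume) w (ContinuousLinearMap.lsmul ℝ ℝ) volume

theorem mollify_apply (b : ContDiffBump (0 : Eucl n)) (w : Eucl n → ℝ) (x : Eucl n) :
    mollify b w x = ∫ t, b.normed volume (x - t) * w t := by
  rw [mollify, convolution_eq_swap]; rfl

theorem contDiff_mollify (b : ContDiffBump (0 : Eucl n)) (hw : LocallyIntegrable w)
    (k : ℕ) : ContDiff ℝ k (mollify b w) :=
  b.hasCompactSupport_normed.contDiff_convolution_left _ b.contDiff_normed hw

theorem le_mollify (b : ContDiffBump (0 : Eucl n)) (hw : LocallyIntegrable w)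
    (hc : ∀ᵐ x, c ≤ w x) (x : Eucl n) : c ≤ mollify b w x := by
  have hint : ∀ {v : Eucl n → ℝ}, LocallyIntegrable v →
      Integrable (fun t => b.normed volume (x - t) * v t) := fun hv =>
    integrable_sub_mul_of_hasCompactSupport b.continuous_normed b.hasCompactSupport_normed hv x
  calc c = ∫ t, b.normed volume (x - t) * c := by
        rw [integral_mul_const, integral_sub_left_eq_self (fun t => b.normed volume t) volume x,
          b.integral_normed, one_mul]
    _ ≤ ∫ t, b.normed volume (x - t) * w t :=
        integral_mono_ae (hint (locallyIntegrable_const c)) (hint hw)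
          (hc.mono fun t ht => mul_le_mul_of_nonneg_left ht (b.nonneg_normed _))
    _ = mollify b w x := (mollify_apply b w x).symm

theorem mollify_neg (b : ContDiffBump (0 : Eucl n)) (w : Eucl n → ℝ) (x : Eucl n) :
    mollify b (fun y => -w y) x = -mollify b w x := by
  simp only [mollify_apply, mul_neg, integral_neg]

theorem abs_mollify_le (b : ContDiffBump (0 : Eucl n)) (hw : LocallyIntegrable w)
    (hc : ∀ᵐ x, |w x| ≤ c) (x : Eucl n) : |mollify b w x| ≤ c := by
  have hneg : -c ≤ mollify b (fun y => -w y) x :=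
    le_mollify b hw.neg (hc.mono fun y hy => neg_le_neg (abs_le.1 hy).2) x
  rw [mollify_neg] at hneg
  exact abs_le.2 ⟨le_mollify b hw (hc.mono fun y hy => (abs_le.1 hy).1) x, neg_le_neg_iff.1 hneg⟩

theorem exists_seq_tendsto_mollify (hδ : 0 < δ) :
    ∃ b : ℕ → ContDiffBump (0 : Eucl n), (∀ k, (b k).rOut ≤ δ) ∧
      ∀ w : Eucl n → ℝ, LocallyIntegrable w →
        ∀ᵐ x, Tendsto (fun k => mollify (b k) w x) atTop (𝓝 (w x)) := by
  have hpos : ∀ k : ℕ, 0 < δ / (k + 1) := fun k => by positivity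
  refine ⟨fun k => ⟨δ / (k + 1) / 2, δ / (k + 1), half_pos (hpos k), half_lt_self (hpos k)⟩,
    fun k => div_le_self hδ.le (by linarith [k.cast_nonneg (α := ℝ)]), fun w hw =>
    ContDiffBump.ae_convolution_tendsto_right_of_locallyIntegrable (K := 2) ?_
      (Eventually.of_forall fun k => by linarith) hw⟩
  simpa [div_eq_mul_inv] using (tendsto_one_div_add_atTop_nhds_zero_nat (𝕜 := ℝ)).const_mul δ

theorem DistribLeNegLaplacian.mollify_le (H : DistribLeNegLaplacian N h w)
    (hw : LocallyIntegrable w) (b : ContDiffBump (0 : Eucl n)) {x : Eucl n}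
    (hx : Metric.closedBall x b.rOut ⊆ N) : mollify b h x ≤ -Δ (mollify b w) x := by
  set ρ : Eucl n → ℝ := b.normed volume
  have hρ : ContDiff ℝ 2 ρ := b.contDiff_normed
  have hΔρ : ∀ t, Δ (fun t => ρ (x - t)) t = Δ ρ (x - t) := fun t => by
    simpa only [neg_one_smul, ← sub_eq_add_neg, neg_one_sq, one_mul] using
      laplacian_comp_add_smul hρ x (-1) t
  have hsupp : tsupport (fun t => ρ (x - t)) ⊆ Metric.closedBall x b.rOut := by
    refine closure_minimal (fun t ht => ?_) Metric.isClosed_closedBall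
    have hmem : x - t ∈ Function.support ρ := ht
    rw [b.support_normed_eq, mem_ball_zero_iff, ← dist_eq_norm] at hmem
    exact Metric.mem_closedBall'.2 hmem.le
  have htest : IsTestFunctionOn N (fun t => ρ (x - t)) :=
    ⟨b.contDiff_normed.comp (contDiff_const.sub contDiff_id),
      (isCompact_closedBall _ _).of_isClosed_subset (isClosed_tsupport _) hsupp, hsupp.trans hx⟩
  have hle := H _ htest fun t => b.nonneg_normed _
  simp only [hΔρ] at hle
  rw [mollify_apply, mollify, laplacian_convolution hρ b.hasCompactSupport_normed hw]
  simpa only [ρ, mul_comm] using hle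

theorem integral_min_zero_pow_three_mul_laplacian_le {v q : Eucl n → ℝ} (hv : ContDiff ℝ 2 v)
    (hq : Continuous q) (hη : ContDiff ℝ 2 η) (hηc : HasCompactSupport η) (hη₀ : ∀ x, 0 ≤ η x)
    (hle : ∀ x ∈ tsupport η, q x ≤ -Δ v x) :
    ∫ x, min (v x) 0 ^ 3 * Δ η x ≤ -∫ x, 3 * min (v x) 0 ^ 2 * q x * η x := by
  have hv_cube : ContDiff ℝ 2 (fun x => min (v x) 0 ^ 3) := contDiff_min_zero_pow_three.comp hv
  have hv_cont := hv.continuous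
  rw [integral_mul_laplacian hv_cube hη hηc, ← integral_neg]
  refine integral_mono (integrable_mul_of_hasCompactSupport (continuous_laplacian hv_cube)
    hη.continuous hηc) (integrable_mul_of_hasCompactSupport (by fun_prop)
    hη.continuous hηc).neg fun x => ?_
  change _ ≤ -(_ * η x)
  rw [← neg_mul]
  by_cases hx : x ∈ tsupport η
  · refine mul_le_mul_of_nonneg_right ?_ (hη₀ x)
    have hmul := mul_le_mul_of_nonneg_left (hle x hx)
      (by positivity : 0 ≤ 3 * min (v x) 0 ^ 2)
    linarith [laplacian_min_zero_pow_three_le (x := x) hv.contDiffAt]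
  · rw [image_eq_zero_of_notMem_tsupport hx, mul_zero, mul_zero]

theorem abs_min_zero_le {s : ℝ} (hs : -B ≤ s) : |min s 0| ≤ |B| := by
  rw [abs_of_nonpos (min_le_right _ _), neg_le]
  exact le_min ((neg_le_neg (le_abs_self B)).trans hs) (neg_nonpos.2 (abs_nonneg B))

theorem tendsto_integral_mul_of_abs_le {X : Type*} [MeasurableSpace X] {μ : Measure X}
    {F : ℕ → X → ℝ} {f ζ : X → ℝ} (hF : ∀ k, AEStronglyMeasurable (F k) μ)
    (hFC : ∀ k x, |F k x| ≤ C) (hlim : ∀ᵐ x ∂μ, Tendsto (fun k => F k x) atTop (𝓝 (f x)))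
    (hζ : Integrable ζ μ) :
    Tendsto (fun k => ∫ x, F k x * ζ x ∂μ) atTop (𝓝 (∫ x, f x * ζ x ∂μ)) := by
  refine tendsto_integral_of_dominated_convergence (fun x => C * ‖ζ x‖)
    (fun k => (hF k).mul hζ.aestronglyMeasurable) (hζ.norm.const_mul C)
    (fun k => Eventually.of_forall fun x => ?_) (hlim.mono fun x hx => hx.mul_const _)
  rw [norm_mul]
  exact mul_le_mul_of_nonneg_right (hFC k x) (norm_nonneg _)

theorem DistribLeNegLaplacian.integral_min_zero_pow_three_le (H : DistribLeNegLaplacian N h w)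
    (hh : AEStronglyMeasurable h) (hhC : ∀ᵐ x, |h x| ≤ C) (hw : LocallyIntegrable w)
    (hwB : ∀ᵐ x, -B ≤ w x) (hη : ContDiff ℝ 2 η) (hηc : HasCompactSupport η)
    (hη₀ : ∀ x, 0 ≤ η x) (hδ : 0 < δ) (hN : ∀ x ∈ tsupport η, Metric.closedBall x δ ⊆ N) :
    ∫ x, min (w x) 0 ^ 3 * Δ η x ≤ -∫ x, 3 * min (w x) 0 ^ 2 * h x * η x := by
  obtain ⟨b, hbδ, hlim⟩ := exists_seq_tendsto_mollify (n := n) hδ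
  have hh_loc : LocallyIntegrable h := (locallyIntegrable_const C).mono hh
    (hhC.mono fun x hx => hx.trans (le_abs_self C))
  have hw_cont : ∀ k, Continuous (mollify (b k) w) := fun k => (contDiff_mollify _ hw 0).continuous
  have hh_cont : ∀ k, Continuous (mollify (b k) h) :=
    fun k => (contDiff_mollify _ hh_loc 0).continuous
  have hminB : ∀ k x, |min (mollify (b k) w x) 0| ≤ |B| :=
    fun k x => abs_min_zero_le (le_mollify _ hw hwB x)
  refine le_of_tendsto_of_tendsto'
    (tendsto_integral_mul_of_abs_le (C := |B| ^ 3)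
      (F := fun k x => min (mollify (b k) w x) 0 ^ 3)
      (fun k => Continuous.aestronglyMeasurable (by fun_prop)) (fun k x => ?_) ?_
      ((continuous_laplacian hη).integrable_of_hasCompactSupport (hasCompactSupport_laplacian hηc)))
    (tendsto_integral_mul_of_abs_le (C := 3 * |B| ^ 2 * C)
      (F := fun k x => 3 * min (mollify (b k) w x) 0 ^ 2 * mollify (b k) h x)
      (fun k => Continuous.aestronglyMeasurable (by fun_prop)) (fun k x => ?_) ?_
      (hη.continuous.integrable_of_hasCompactSupport hηc)).neg
    fun k => integral_min_zero_pow_three_mul_laplacian_le (contDiff_mollify (b k) hw 2)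
      (hh_cont k) hη hηc hη₀ fun x hx =>
        H.mollify_le hw (b k) ((Metric.closedBall_subset_closedBall (hbδ k)).trans (hN x hx))
  · rw [abs_pow]
    exact pow_le_pow_left₀ (abs_nonneg _) (hminB k x) 3
  · filter_upwards [hlim w hw] with x hx
    exact (hx.min tendsto_const_nhds).pow 3
  · rw [abs_mul, abs_mul, abs_pow, abs_of_pos (three_pos : (0 : ℝ) < 3)]
    exact mul_le_mul (mul_le_mul_of_nonneg_left (pow_le_pow_left₀ (abs_nonneg _) (hminB k x) 2)
      three_pos.le) (abs_mollify_le (b k) hh_loc hhC x) (abs_nonneg _) (by positivity)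
  · filter_upwards [hlim w hw, hlim h hh_loc] with x hxw hxh
    exact (((hxw.min tendsto_const_nhds).pow 2).const_mul 3).mul hxh

end Mollification

section WeakComparison

theorem exists_laplacian_neg {E : Type*} [NormedAddCommGroup E] [InnerProductSpace ℝ E]
    [FiniteDimensional ℝ E] [Nontrivial E] {K D : Set E} (hK : IsCompact K) (hD : IsOpen D)
    (hKD : K ⊆ D) :
    ∃ η : E → ℝ, ContDiff ℝ 2 η ∧ HasCompactSupport η ∧ tsupport η ⊆ D ∧ (∀ x, 0 ≤ η x) ∧
      ∀ x ∈ K, Δ η x < 0 := by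
  obtain ⟨χ, hχ, hχc, hχD, hχ_one, hχ_Icc⟩ := exists_contDiff_cutoff hK hD hKD
  obtain ⟨C, hC⟩ := hχc.isCompact.exists_bound_of_continuousOn (f := fun x : E => ‖x‖ ^ 2)
    (by fun_prop)
  have hsq : ContDiff ℝ 2 (fun x : E => ‖x‖ ^ 2) := contDiff_norm_sq ℝ
  have hneg : ∀ x : E, Δ (fun y : E => C - ‖y‖ ^ 2) x = -(2 * Module.finrank ℝ E) := fun x => by
    rw [← laplacian_norm_sq x, InnerProductSpace.laplacian_congr_nhds
      (f₂ := fun y : E => -1 * (‖y‖ ^ 2 - C)) (Eventually.of_forall fun y => by ring)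
      |>.self_of_nhds, laplacian_const_mul _ (hsq.sub contDiff_const).contDiffAt,
      laplacian_sub_const _ hsq.contDiffAt, neg_one_mul]
  refine ⟨fun x => χ x * (C - ‖x‖ ^ 2), (hχ.of_le (by norm_cast)).mul (contDiff_const.sub hsq),
    hχc.mul_right, (closure_mono (Function.support_mul_subset_left _ _)).trans hχD, fun x => ?_,
    fun x hx => ?_⟩
  · by_cases hx : x ∈ tsupport χ
    · exact mul_nonneg (hχ_Icc x).1 (sub_nonneg.2 ((le_abs_self _).trans (hC x hx)))
    · simp only [image_eq_zero_of_notMem_tsupport hx, zero_mul, le_refl]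
  · have hdim : (0 : ℝ) < Module.finrank ℝ E := by exact_mod_cast Module.finrank_pos
    rw [laplacian_cutoff_mul hχ_one hx, hneg]
    linarith

variable {n : ℕ} {K D Ω : Set (Eucl n)} {h w u : Eucl n → ℝ} {f : ℝ → Eucl n → ℝ} {B C : ℝ}

-- Testing with a function `η` such that `Δη < 0` on `K` makes both sides of
-- `∫ (min w 0)³ Δη ≤ -3 ∫ (min w 0)² h η` vanish.
theorem DistribLeNegLaplacian.ae_nonneg [NeZero n] (H : DistribLeNegLaplacian D h w)
    (hh : AEStronglyMeasurable h) (hhC : ∀ᵐ x, |h x| ≤ C) (hw : LocallyIntegrable w)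
    (hwB : ∀ᵐ x, -B ≤ w x) (hK : IsCompact K) (hKD : K ⊆ interior D)
    (hout : ∀ᵐ x, x ∈ D → x ∉ K → 0 ≤ w x) (hneg : ∀ᵐ x, x ∈ K → w x < 0 → 0 ≤ h x) :
    ∀ᵐ x, x ∈ D → 0 ≤ w x := by
  obtain ⟨η, hη, hηc, hηD, hη₀, hηK⟩ := exists_laplacian_neg hK isOpen_interior hKD
  obtain ⟨δ, hδ, hδD⟩ := hηc.isCompact.exists_cthickening_subset_open isOpen_interior hηD
  have hle := H.integral_min_zero_pow_three_le hh hhC hw hwB hη hηc hη₀ hδ fun x hx =>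
    (Metric.closedBall_subset_cthickening hx δ).trans (hδD.trans interior_subset)
  have hright : 0 ≤ ∫ x, 3 * min (w x) 0 ^ 2 * h x * η x := by
    refine integral_nonneg_of_ae ?_
    filter_upwards [hout, hneg] with x hxout hxneg
    by_cases hxη : x ∈ tsupport η
    · rcases le_or_gt 0 (w x) with hwx | hwx
      · simp [min_eq_right hwx]
      · have hxK : x ∈ K := by_contra fun hxK =>
          (hxout (interior_subset (hηD hxη)) hxK).not_gt hwx
        exact mul_nonneg (mul_nonneg (by positivity) (hxneg hxK hwx)) (hη₀ x)
    · simp [image_eq_zero_of_notMem_tsupport hxη]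
  have hnonneg : 0 ≤ᵐ[volume] fun x => min (w x) 0 ^ 3 * Δ η x := by
    filter_upwards [hout] with x hxout
    by_cases hxK : x ∈ K
    · exact mul_nonneg_of_nonpos_of_nonpos
        (Odd.pow_nonpos (by decide) (min_le_right _ _)) (hηK x hxK).le
    · by_cases hxη : x ∈ tsupport η
      · simp [min_eq_right (hxout (interior_subset (hηD hxη)) hxK)]
      · simp [laplacian_eq_zero_of_notMem_tsupport hxη]
  have hint : Integrable (fun x => min (w x) 0 ^ 3 * Δ η x) := by
    refine ((continuous_laplacian hη).integrable_of_hasCompactSupport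
      (hasCompactSupport_laplacian hηc)).bdd_mul (c := |B| ^ 3)
      ((hw.aestronglyMeasurable.inf aestronglyMeasurable_const).pow 3) ?_
    filter_upwards [hwB] with x hx
    rw [norm_pow]
    exact pow_le_pow_left₀ (norm_nonneg _) (abs_min_zero_le hx) 3
  have hzero := (integral_eq_zero_iff_of_nonneg_ae hnonneg hint).1
    (le_antisymm (by linarith) (integral_nonneg_of_ae hnonneg))
  filter_upwards [hzero, hout] with x hx hxout hxD
  by_cases hxK : x ∈ K
  · exact min_eq_right_iff.1
      (pow_eq_zero_iff three_ne_zero |>.1 ((mul_eq_zero.1 hx).resolve_right (hηK x hxK).ne))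
  · exact hxout hxD hxK

theorem IsWeakSupersolution.le_of_contDiff [NeZero n] {K₁ : Set (Eucl n)} {ψ : Eucl n → ℝ}
    (hΩ : IsOpen Ω) (hu : IsWeakSupersolution Ω f u) (hpos : ∀ᵐ x, x ∈ Ω → 0 < u x)
    (hf : ∀ s, 0 < s → ∀ x ∈ Ω, 0 < f s x) (hK : IsCompact K) (hK₁ : IsCompact K₁)
    (hKK₁ : K ⊆ interior K₁) (hK₁Ω : K₁ ⊆ Ω) (hψ : ContDiff ℝ 2 ψ) (hψc : HasCompactSupport ψ)
    (hout : ∀ᵐ x, x ∈ K₁ → x ∉ K → ψ x ≤ u x)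
    (hcontact : ∀ᵐ x, x ∈ K → u x < ψ x → -Δ ψ x ≤ f (u x) x) :
    ∀ᵐ x, x ∈ K₁ → ψ x ≤ u x := by
  have hΔψ := continuous_laplacian hψ
  obtain ⟨B, hB⟩ := hψc.exists_bound_of_continuous hψ.continuous
  obtain ⟨M, hM⟩ := (hasCompactSupport_laplacian hψc).exists_bound_of_continuous hΔψ
  have hM₀ : 0 ≤ M := (norm_nonneg _).trans (hM 0)
  have hfpos : ∀ᵐ x, x ∈ K₁ → 0 < f (u x) x :=
    hpos.mono fun x hx hxK => hf _ (hx (hK₁Ω hxK)) x (hK₁Ω hxK)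
  have hsuper := hu.distribLeNegLaplacian hΩ
    ((ae_restrict_iff' hK₁.measurableSet).2 hfpos) hK₁ hK₁Ω hψ hM₀
  have hnonneg := hsuper.ae_nonneg (B := B) (C := M + M) ?_ ?_ ?_ ?_ hK hKK₁ ?_ ?_
  · filter_upwards [hnonneg] with x hx hxK₁
    simpa only [indicator_of_mem hxK₁, sub_nonneg] using hx hxK₁
  · exact ((aestronglyMeasurable_indicator_iff hK₁.measurableSet).2
      ((hu.aestronglyMeasurable hΩ hK₁ hK₁Ω).inf aestronglyMeasurable_const)).add
      hΔψ.aestronglyMeasurable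
  · filter_upwards [hfpos] with x hx
    refine (abs_add_le _ _).trans (add_le_add ?_ (hM x))
    by_cases hxK : x ∈ K₁
    · rw [indicator_of_mem hxK, abs_of_nonneg (le_min (hx hxK).le hM₀)]
      exact min_le_right _ _
    · simpa [indicator_of_notMem hxK] using hM₀
  · exact ((hu.integrableOn hK₁ hK₁Ω).integrable_indicator hK₁.measurableSet).locallyIntegrable.sub
      hψ.continuous.locallyIntegrable
  · filter_upwards [hpos] with x hx
    have hu₀ : 0 ≤ K₁.indicator u x := indicator_apply_nonneg fun hxK => (hx (hK₁Ω hxK)).le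
    linarith [(abs_le.1 (hB x)).2]
  · filter_upwards [hout] with x hx hxK₁ hxK
    rw [indicator_of_mem hxK₁, sub_nonneg]
    exact hx hxK₁ hxK
  · filter_upwards [hcontact] with x hx hxK hwx
    have hxK₁ := interior_subset (hKK₁ hxK)
    rw [indicator_of_mem hxK₁, sub_neg] at hwx
    rw [indicator_of_mem hxK₁, ← neg_le_iff_add_nonneg]
    exact le_min (hx hxK hwx) (neg_le.1 (abs_le.1 (hM x)).1)

theorem IsWeakSupersolution.comparisonOn [NeZero n] (hΩ : IsOpen Ω)
    (hu : IsWeakSupersolution Ω f u) (hpos : ∀ᵐ x ∂(volume.restrict Ω), 0 < u x)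
    (hf : ∀ s, 0 < s → ∀ x ∈ Ω, 0 < f s x) (hD : IsOpen D) (hDΩ : D ⊆ Ω) :
    ComparisonOn (ae volume) D f u := by
  intro φ K hφ hK hKD hout hcontact
  obtain ⟨χ, hχ, hχc, hχD, hχ_one, hχ_Icc⟩ := exists_contDiff_cutoff hK hD hKD
  obtain ⟨K₁, hK₁, hKK₁, hK₁D⟩ := exists_compact_between hK hD hKD
  have hχK : ∀ x ∈ K, χ x = 1 := fun x hxK => hχ_one.self_of_nhdsSet x hxK
  rw [ae_restrict_iff' hΩ.measurableSet] at hpos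
  have hle := hu.le_of_contDiff hΩ hpos hf hK hK₁ hKK₁ (hK₁D.trans hDΩ)
    (contDiff_cutoff_mul hφ hD (hχ.of_le (by norm_cast)) hχD) hχc.mul_right ?_ ?_
  · filter_upwards [hle, hout] with x hx hxout hxD
    by_cases hxK : x ∈ K
    · simpa only [hχK x hxK, one_mul] using hx (interior_subset (hKK₁ hxK))
    · exact hxout hxD hxK
  · filter_upwards [hpos, hout] with x hx hxout hxK₁ hxK
    calc χ x * φ x ≤ χ x * u x :=
          mul_le_mul_of_nonneg_left (hxout (hK₁D hxK₁) hxK) (hχ_Icc x).1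
      _ ≤ u x := mul_le_of_le_one_left (hx (hDΩ (hK₁D hxK₁))).le (hχ_Icc x).2
  · filter_upwards [hcontact] with x hx hxK hlt
    rw [hχK x hxK, one_mul] at hlt
    rw [laplacian_cutoff_mul hχ_one hxK]
    exact (hx hxK hlt).le

end WeakComparison

section MeanValue

variable {n : ℕ} {w : Eucl n → ℝ} {y : Eucl n} {R d : ℝ}

/-- The weight `((1 - |z|²)₊)²` of the mean value inequality for superharmonic functions, for which
`z * quadraticWeight z` is the gradient of a `C²` function with compact support. -/
noncomputable def quadraticWeight (z : Eucl n) : ℝ := min (‖z‖ ^ 2 - 1) 0 ^ 2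

theorem continuous_quadraticWeight : Continuous (quadraticWeight (n := n)) := by
  unfold quadraticWeight
  fun_prop

theorem hasCompactSupport_min_norm_sq_pow {k : ℕ} (hk : k ≠ 0) :
    HasCompactSupport (fun z : Eucl n => min (‖z‖ ^ 2 - 1) 0 ^ k) := by
  refine HasCompactSupport.intro (isCompact_closedBall 0 1) fun z hz => ?_
  rw [mem_closedBall_zero_iff, not_le] at hz
  rw [min_eq_right (by nlinarith), zero_pow hk]

theorem hasCompactSupport_quadraticWeight : HasCompactSupport (quadraticWeight (n := n)) :=
  hasCompactSupport_min_norm_sq_pow two_ne_zero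

theorem quadraticWeight_nonneg (z : Eucl n) : 0 ≤ quadraticWeight z := sq_nonneg _

theorem integral_quadraticWeight_pos : 0 < ∫ z : Eucl n, quadraticWeight z :=
  continuous_quadraticWeight.integral_pos_of_hasCompactSupport_nonneg_nonzero
    hasCompactSupport_quadraticWeight quadraticWeight_nonneg
    (x := 0) (by simp [quadraticWeight])

theorem one_fourth_le_quadraticWeight {z : Eucl n} (hz : ‖z‖ ≤ 2 / 3) :
    1 / 4 ≤ quadraticWeight z := by
  have hsq : ‖z‖ ^ 2 ≤ 4 / 9 := by nlinarith [norm_nonneg z]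
  rw [quadraticWeight, min_eq_left (by linarith)]
  nlinarith

theorem integrable_mul_quadraticWeight {v : Eucl n → ℝ} (hv : Continuous v) :
    Integrable (fun z => v z * quadraticWeight z) :=
  integrable_mul_of_hasCompactSupport hv continuous_quadraticWeight
    hasCompactSupport_quadraticWeight

theorem partialDeriv_min_norm_sq_pow_three (i : Fin n) (z : Eucl n) :
    partialDeriv i (fun z : Eucl n => min (‖z‖ ^ 2 - 1) 0 ^ 3) z =
      6 * (z i * quadraticWeight z) := by
  have hsub : HasFDerivAt (fun z : Eucl n => ‖z‖ ^ 2 - 1) _ z :=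
    (hasStrictFDerivAt_norm_sq z).hasFDerivAt.sub_const 1
  have hcomp := (hasDerivAt_min_zero_pow 1 (‖z‖ ^ 2 - 1)).comp_hasFDerivAt z hsub
  have hcube : HasFDerivAt (fun z : Eucl n => min (‖z‖ ^ 2 - 1) 0 ^ 3) _ z := hcomp
  rw [partialDeriv, hcube.fderiv, quadraticWeight]
  simp [EuclideanSpace.inner_single_right]
  ring

theorem integral_fderiv_self_mul_quadraticWeight (hw : ContDiff ℝ 2 w) :
    6 * ∫ z, fderiv ℝ w z z * quadraticWeight z =
      -∫ z, Δ w z * min (‖z‖ ^ 2 - 1) 0 ^ 3 := by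
  have hcube : ContDiff ℝ 1 (fun z : Eucl n => min (‖z‖ ^ 2 - 1) 0 ^ 3) :=
    (contDiff_min_zero_pow_three.of_le one_le_two).comp
      ((contDiff_norm_sq ℝ).sub contDiff_const)
  rw [← integral_sum_partialDeriv_mul_partialDeriv hw hcube
    (hasCompactSupport_min_norm_sq_pow three_ne_zero), ← integral_const_mul]
  refine integral_congr_ae (Eventually.of_forall fun z => ?_)
  simp only [partialDeriv_min_norm_sq_pow_three, fderiv_apply_eq_sum, Finset.sum_mul,
    Finset.mul_sum]
  exact Finset.sum_congr rfl fun i _ => by ring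

theorem hasDerivAt_integral_mul_quadraticWeight (hw : ContDiff ℝ 2 w) (hwc : HasCompactSupport w)
    (y : Eucl n) (R : ℝ) :
    HasDerivAt (fun R : ℝ => ∫ z, w (y + R • z) * quadraticWeight z)
      (∫ z, fderiv ℝ w (y + R • z) z * quadraticWeight z) R := by
  have hw_cont := hw.continuous
  have hdw : Continuous (fderiv ℝ w) := hw.continuous_fderiv two_ne_zero
  obtain ⟨C, hC⟩ := (hwc.fderiv ℝ).exists_bound_of_continuous hdw
  refine (hasDerivAt_integral_of_dominated_loc_of_deriv_le (s := univ) Filter.univ_mem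
    (F := fun R z => w (y + R • z) * quadraticWeight z)
    (F' := fun R z => fderiv ℝ w (y + R • z) z * quadraticWeight z)
    (bound := fun z => C * ‖z‖ * quadraticWeight z)
    (Eventually.of_forall fun R => (integrable_mul_quadraticWeight
      (v := fun z => w (y + R • z)) (by fun_prop)).aestronglyMeasurable)
    (integrable_mul_quadraticWeight (v := fun z => w (y + R • z)) (by fun_prop))
    (integrable_mul_quadraticWeight
      (v := fun z => fderiv ℝ w (y + R • z) z) (by fun_prop)).aestronglyMeasurable
    (Eventually.of_forall fun z R _ => ?_)
    (integrable_mul_quadraticWeight (v := fun z => C * ‖z‖) (by fun_prop))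
    (Eventually.of_forall fun z R _ => HasDerivAt.mul_const ?_ _)).2
  · rw [norm_mul, Real.norm_of_nonneg (quadraticWeight_nonneg z)]
    exact mul_le_mul_of_nonneg_right (((fderiv ℝ w (y + R • z)).le_opNorm z).trans
      (mul_le_mul_of_nonneg_right (hC _) (norm_nonneg _))) (quadraticWeight_nonneg z)
  · have hline : HasDerivAt (fun R : ℝ => y + R • z) z R := by
      simpa using ((hasDerivAt_id R).smul_const z).const_add y
    exact (hw.differentiable two_ne_zero _).hasFDerivAt.comp_hasDerivAt R hline

theorem integral_fderiv_mul_quadraticWeight_nonpos (hw : ContDiff ℝ 2 w) (hR : 0 < R)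
    (hΔ : ∀ x ∈ Metric.closedBall y R, Δ w x ≤ 0) :
    ∫ z, fderiv ℝ w (y + R • z) z * quadraticWeight z ≤ 0 := by
  have hG : ContDiff ℝ 2 (fun z => w (y + R • z)) :=
    hw.comp (contDiff_const.add (contDiff_id.const_smul R))
  have hfderiv : ∀ z, fderiv ℝ (fun z => w (y + R • z)) z z =
      R * fderiv ℝ w (y + R • z) z := fun z => by
    have hcomp : HasFDerivAt (fun z => w (y + R • z)) _ z :=
      (hw.differentiable two_ne_zero (y + R • z)).hasFDerivAt.comp z
        (((hasFDerivAt_id z).const_smul R).const_add y)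
    simp [hcomp.fderiv]
  have hint := integral_fderiv_self_mul_quadraticWeight hG
  simp only [hfderiv, laplacian_comp_add_smul hw, mul_assoc] at hint
  rw [integral_const_mul] at hint
  have hnonneg : 0 ≤ ∫ z, R ^ 2 * (Δ w (y + R • z) * min (‖z‖ ^ 2 - 1) 0 ^ 3) := by
    refine integral_nonneg fun z => mul_nonneg (sq_nonneg R) ?_
    rcases le_or_gt ‖z‖ 1 with hz | hz
    · refine mul_nonneg_of_nonpos_of_nonpos (hΔ _ ?_)
        (Odd.pow_nonpos (by decide) (min_le_right _ _))
      rw [mem_closedBall_iff_norm, add_sub_cancel_left, norm_smul, Real.norm_of_nonneg hR.le]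
      exact mul_le_of_le_one_right hR.le hz
    · simp [min_eq_right (by nlinarith : (0 : ℝ) ≤ ‖z‖ ^ 2 - 1)]
  exact nonpos_of_mul_nonpos_right (by linarith) hR

theorem integral_comp_mul_quadraticWeight_le (hw : ContDiff ℝ 2 w) (hwc : HasCompactSupport w)
    (hR : 0 ≤ R) (hΔ : ∀ x ∈ Metric.closedBall y R, Δ w x ≤ 0) :
    ∫ z, w (y + R • z) * quadraticWeight z ≤ w y * ∫ z : Eucl n, quadraticWeight z := by
  have hderiv := hasDerivAt_integral_mul_quadraticWeight hw hwc y
  have hanti : AntitoneOn (fun R : ℝ => ∫ z, w (y + R • z) * quadraticWeight z) (Icc 0 R) := by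
    refine antitoneOn_of_deriv_nonpos (convex_Icc _ _)
      (fun t _ => (hderiv t).continuousAt.continuousWithinAt)
      (fun t _ => (hderiv t).differentiableAt.differentiableWithinAt) fun t ht => ?_
    rw [interior_Icc] at ht
    rw [(hderiv t).deriv]
    exact integral_fderiv_mul_quadraticWeight_nonpos hw ht.1 fun x hx =>
      hΔ x (Metric.closedBall_subset_closedBall ht.2.le hx)
  simpa [integral_const_mul] using hanti ⟨le_rfl, hR⟩ ⟨hR, le_rfl⟩ hR

theorem integral_comp_add_smul_mul_quadraticWeight (w : Eucl n → ℝ) (y : Eucl n) (hR : 0 < R) :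
    ∫ z, w (y + R • z) * quadraticWeight z =
      (R ^ n)⁻¹ * ∫ x, w x * quadraticWeight (R⁻¹ • (x - y)) := by
  have hscale := Measure.integral_comp_smul (volume : Measure (Eucl n))
    (fun z => w (y + z) * quadraticWeight (R⁻¹ • z)) R
  simp only [smul_smul, inv_mul_cancel₀ hR.ne', one_smul] at hscale
  rw [hscale, finrank_euclideanSpace_fin, abs_of_pos (by positivity), smul_eq_mul,
    ← integral_add_left_eq_self (fun x => w x * quadraticWeight (R⁻¹ • (x - y))) y]
  simp only [add_sub_cancel_left]

theorem setIntegral_le_integral_mul_quadraticWeight (hw : Continuous w) (hwc : HasCompactSupport w)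
    (hw₀ : ∀ x, 0 ≤ w x) (hd : 0 < d) {p : Eucl n} (hy : y ∈ Metric.closedBall p d) :
    1 / 4 * ∫ x in Metric.closedBall p d, w x ≤
      ∫ x, w x * quadraticWeight ((3 * d)⁻¹ • (x - y)) := by
  have hq := continuous_quadraticWeight (n := n)
  have hint : Integrable (fun x => w x * quadraticWeight ((3 * d)⁻¹ • (x - y))) :=
    Continuous.integrable_of_hasCompactSupport (by fun_prop) hwc.mul_right
  rw [← integral_const_mul]
  refine (setIntegral_mono_on ((hw.integrable_of_hasCompactSupport hwc).const_mul _).integrableOn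
    hint.integrableOn Metric.isClosed_closedBall.measurableSet fun x hx => ?_).trans
    (setIntegral_le_integral hint (Eventually.of_forall fun x =>
      mul_nonneg (hw₀ x) (quadraticWeight_nonneg _)))
  rw [mul_comm]
  refine mul_le_mul_of_nonneg_left (one_fourth_le_quadraticWeight ?_) (hw₀ x)
  have hdist : ‖x - y‖ ≤ 2 * d := by
    rw [← dist_eq_norm]
    rw [Metric.mem_closedBall] at hx hy
    linarith [dist_triangle_right x y p]
  rw [norm_smul, Real.norm_of_nonneg (by positivity), inv_mul_le_iff₀ (by positivity)]
  linarith

theorem exists_mul_setIntegral_le (hd : 0 < d) :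
    ∃ c > 0, ∀ (p : Eucl n) (w : Eucl n → ℝ), ContDiff ℝ 2 w → HasCompactSupport w →
      (∀ x, 0 ≤ w x) → (∀ x ∈ Metric.closedBall p (4 * d), Δ w x ≤ 0) →
      ∀ y ∈ Metric.closedBall p d, c * ∫ x in Metric.closedBall p d, w x ≤ w y := by
  have hI : 0 < ∫ z : Eucl n, quadraticWeight z := integral_quadraticWeight_pos
  have hR : 0 < 3 * d := by positivity
  refine ⟨((3 * d) ^ n)⁻¹ * (1 / 4) / ∫ z : Eucl n, quadraticWeight z, by positivity,
    fun p w hw hwc hw₀ hΔ y hy => ?_⟩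
  rw [div_mul_eq_mul_div, div_le_iff₀ hI, mul_assoc]
  calc ((3 * d) ^ n)⁻¹ * (1 / 4 * ∫ x in Metric.closedBall p d, w x)
      ≤ ((3 * d) ^ n)⁻¹ * ∫ x, w x * quadraticWeight ((3 * d)⁻¹ • (x - y)) :=
        mul_le_mul_of_nonneg_left
          (setIntegral_le_integral_mul_quadraticWeight hw.continuous hwc hw₀ hd hy) (by positivity)
    _ = ∫ z, w (y + (3 * d) • z) * quadraticWeight z :=
        (integral_comp_add_smul_mul_quadraticWeight w y hR).symm
    _ ≤ w y * ∫ z : Eucl n, quadraticWeight z :=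
        integral_comp_mul_quadraticWeight_le hw hwc hR.le fun x hx => hΔ x <|
          Metric.closedBall_subset_closedBall' (by linarith [Metric.mem_closedBall.1 hy]) hx

end MeanValue

section LocalPositivity

variable {n : ℕ} {N Ω K : Set (Eucl n)} {h w u : Eucl n → ℝ} {f : ℝ → Eucl n → ℝ} {p x : Eucl n}
  {d : ℝ}

theorem DistribLeNegLaplacian.laplacian_mollify_nonpos (H : DistribLeNegLaplacian N h w)
    (hh : ∀ᵐ x, 0 ≤ h x) (hw : LocallyIntegrable w) (b : ContDiffBump (0 : Eucl n))
    (hx : Metric.closedBall x b.rOut ⊆ N) : Δ (mollify b w) x ≤ 0 := by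
  have hnonneg : 0 ≤ mollify b h x := by
    rw [mollify_apply]
    exact integral_nonneg_of_ae (hh.mono fun t ht => mul_nonneg (b.nonneg_normed _) ht)
  linarith [H.mollify_le hw b hx]

theorem integral_min_one_pos {X : Type*} [MeasurableSpace X] {μ : Measure X} [IsFiniteMeasure μ]
    [NeZero μ] {v : X → ℝ} (hv : AEStronglyMeasurable v μ) (hpos : ∀ᵐ x ∂μ, 0 < v x) :
    0 < ∫ x, min (v x) 1 ∂μ := by
  have hmin : ∀ᵐ x ∂μ, 0 < min (v x) 1 := hpos.mono fun x hx => lt_min hx one_pos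
  have hint : Integrable (fun x => min (v x) 1) μ :=
    Integrable.of_bound (hv.inf aestronglyMeasurable_const) 1 <| hmin.mono fun x hx => by
      rw [Real.norm_of_nonneg hx.le]
      exact min_le_right _ _
  refine (integral_nonneg_of_ae (hmin.mono fun x hx => hx.le)).lt_of_ne fun hzero => ?_
  have hae := (integral_eq_zero_iff_of_nonneg_ae (hmin.mono fun x hx => hx.le) hint).1 hzero.symm
  obtain ⟨x, hx, hx₀⟩ := (hmin.and hae).exists
  exact hx.ne' hx₀

-- Mollifications are superharmonic, so the mean value inequality bounds them below by a multiple of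
-- the integral of their truncations at height one, which converges to a positive limit.
theorem DistribLeNegLaplacian.exists_pos_le_closedBall (hd : 0 < d)
    (H : DistribLeNegLaplacian (Metric.closedBall p (5 * d)) h w) (hh : ∀ᵐ x, 0 ≤ h x)
    (hw : LocallyIntegrable w) (hwc : HasCompactSupport w) (hw₀ : ∀ᵐ x, 0 ≤ w x)
    (hwpos : ∀ᵐ x, x ∈ Metric.closedBall p d → 0 < w x) :
    ∃ c > 0, ∀ᵐ x, x ∈ Metric.closedBall p d → c ≤ w x := by
  obtain ⟨b, hb, hlim⟩ := exists_seq_tendsto_mollify (n := n) hd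
  obtain ⟨c, hc, hmean⟩ := exists_mul_setIntegral_le (n := n) hd
  set μ : Measure (Eucl n) := volume.restrict (Metric.closedBall p d)
  have hball : MeasurableSet (Metric.closedBall p d) := Metric.isClosed_closedBall.measurableSet
  have : IsFiniteMeasure μ := isFiniteMeasure_restrict.2 measure_closedBall_lt_top.ne
  have : NeZero μ :=
    ⟨Measure.restrict_eq_zero.not.2 (Metric.measure_closedBall_pos volume p hd).ne'⟩
  have hwk : ∀ k, ContDiff ℝ 2 (mollify (b k) w) := fun k => contDiff_mollify (b k) hw 2
  have hwk_cont : ∀ k, Continuous (mollify (b k) w) := fun k => (hwk k).continuous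
  have hwk₀ : ∀ k x, 0 ≤ mollify (b k) w x := fun k => le_mollify (b k) hw hw₀
  have hwk_pos : ∀ k x, 0 ≤ min (mollify (b k) w x) 1 := fun k x => le_min (hwk₀ k x) zero_le_one
  have hle : ∀ k, ∀ y ∈ Metric.closedBall p d,
      c * ∫ x, min (mollify (b k) w x) 1 ∂μ ≤ mollify (b k) w y := by
    intro k y hy
    refine (mul_le_mul_of_nonneg_left ?_ hc.le).trans
      (hmean p _ (hwk k) (HasCompactSupport.convolution _ (b k).hasCompactSupport_normed hwc)
        (hwk₀ k) (fun x hx => H.laplacian_mollify_nonpos hh hw (b k) ?_) y hy)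
    · exact integral_mono_of_nonneg (Eventually.of_forall (hwk_pos k))
        ((hwk_cont k).continuousOn.integrableOn_compact (isCompact_closedBall _ _))
        (Eventually.of_forall fun x => min_le_left _ _)
    · exact Metric.closedBall_subset_closedBall'
        (by linarith [hb k, Metric.mem_closedBall.1 hx])
  have htendsto : Tendsto (fun k => ∫ x, min (mollify (b k) w x) 1 ∂μ) atTop
      (𝓝 (∫ x, min (w x) 1 ∂μ)) := by
    simpa using tendsto_integral_mul_of_abs_le (C := 1) (ζ := fun _ => 1)
      (F := fun k x => min (mollify (b k) w x) 1)
      (fun k => ((hwk_cont k).min continuous_const).aestronglyMeasurable)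
      (fun k x => (abs_of_nonneg (hwk_pos k x)).trans_le (min_le_right _ _))
      ((ae_restrict_of_ae (hlim w hw)).mono fun x hx => hx.min tendsto_const_nhds)
      (integrable_const (μ := μ) (1 : ℝ))
  refine ⟨c * ∫ x, min (w x) 1 ∂μ, mul_pos hc (integral_min_one_pos
    hw.aestronglyMeasurable.restrict ((ae_restrict_iff' hball).2 hwpos)), ?_⟩
  filter_upwards [hlim w hw] with y hy hyd
  exact le_of_tendsto_of_tendsto' (htendsto.const_mul c) hy fun k => hle k y hyd

theorem IsWeakSupersolution.exists_pos_le_closedBall (hΩ : IsOpen Ω)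
    (hu : IsWeakSupersolution Ω f u) (hpos : ∀ᵐ x ∂(volume.restrict Ω), 0 < u x)
    (hf : ∀ s, 0 < s → ∀ x ∈ Ω, 0 < f s x) (hd : 0 < d) (hp : Metric.closedBall p (5 * d) ⊆ Ω) :
    ∃ c > 0, ∀ᵐ x, x ∈ Metric.closedBall p d → c ≤ u x := by
  set K := Metric.closedBall p (5 * d)
  have hK : IsCompact K := isCompact_closedBall _ _
  have hsub : Metric.closedBall p d ⊆ K := Metric.closedBall_subset_closedBall (by linarith)
  rw [ae_restrict_iff' hΩ.measurableSet] at hpos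
  have hfpos : ∀ᵐ x, x ∈ K → 0 < f (u x) x :=
    hpos.mono fun x hx hxK => hf _ (hx (hp hxK)) x (hp hxK)
  have hsuper := hu.distribLeNegLaplacian hΩ ((ae_restrict_iff' hK.measurableSet).2 hfpos) hK hp
    (contDiff_const (c := (0 : ℝ))) le_rfl
  simp only [sub_zero] at hsuper
  have hrhs : ∀ᵐ x, 0 ≤ K.indicator (fun x => min (f (u x) x) 0) x +
      Δ (fun _ : Eucl n => (0 : ℝ)) x := by
    filter_upwards [hfpos] with x hx
    rw [laplacian_eq_zero_of_notMem_tsupport (by simp [tsupport]), add_zero]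
    exact indicator_apply_nonneg fun hxK => le_min (hx hxK).le le_rfl
  have hu₀ : ∀ᵐ x, 0 ≤ K.indicator u x :=
    hpos.mono fun x hx => indicator_apply_nonneg fun hxK => (hx (hp hxK)).le
  have hu_pos : ∀ᵐ x, x ∈ Metric.closedBall p d → 0 < K.indicator u x :=
    hpos.mono fun x hx hxd => (hx (hp (hsub hxd))).trans_eq (indicator_of_mem (hsub hxd) u).symm
  obtain ⟨c, hc, hle⟩ := hsuper.exists_pos_le_closedBall hd hrhs
    ((hu.integrableOn hK hp).integrable_indicator hK.measurableSet).locallyIntegrable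
    (HasCompactSupport.intro hK fun x hx => indicator_of_notMem hx u) hu₀ hu_pos
  exact ⟨c, hc, hle.mono fun x hx hxd => (hx hxd).trans_eq (indicator_of_mem (hsub hxd) u)⟩

theorem IsWeakSupersolution.exists_pos_le (hΩ : IsOpen Ω) (hu : IsWeakSupersolution Ω f u)
    (hpos : ∀ᵐ x ∂(volume.restrict Ω), 0 < u x) (hf : ∀ s, 0 < s → ∀ x ∈ Ω, 0 < f s x)
    (hK : IsCompact K) (hKΩ : K ⊆ Ω) : ∃ c > 0, ∀ᵐ x, x ∈ K → c ≤ u x := by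
  refine hK.induction_on (p := fun S => ∃ c > 0, ∀ᵐ x, x ∈ S → c ≤ u x) ⟨1, one_pos, by simp⟩
    ?_ ?_ ?_
  · rintro S T hST ⟨c, hc, hT⟩
    exact ⟨c, hc, hT.mono fun x hx hxS => hx (hST hxS)⟩
  · rintro S T ⟨c, hc, hS⟩ ⟨c', hc', hT⟩
    refine ⟨min c c', lt_min hc hc', ?_⟩
    filter_upwards [hS, hT] with x hxS hxT hx
    exact hx.elim (fun hx => (min_le_left _ _).trans (hxS hx))
      fun hx => (min_le_right _ _).trans (hxT hx)
  · intro p hp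
    obtain ⟨ε, hε, hball⟩ := Metric.nhds_basis_closedBall.mem_iff.1 (hΩ.mem_nhds (hKΩ hp))
    have hd : 0 < ε / 5 := by positivity
    exact ⟨Metric.closedBall p (ε / 5),
      mem_nhdsWithin_of_mem_nhds (Metric.closedBall_mem_nhds p hd),
      hu.exists_pos_le_closedBall hΩ hpos hf hd (by rwa [mul_div_cancel₀ ε (by norm_num)])⟩

end LocalPositivity

section Nonexistence

variable {n : ℕ} {l : Fin n} {γ r₀ c : ℝ} {g : ℝ → ℝ} {u : Eucl n → ℝ}

theorem IsViscositySupersolution.false_of_pos (hn : 2 ≤ n) (hγ : γ < 2) (hr₀ : 0 ≤ r₀) (hc : 0 < c)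
    (hg_zero : ∀ s, 0 < s → s ≤ 1 → c * s ^ criticalExponent n γ ≤ g s)
    (hg_top : ∀ s, 1 ≤ s → c * s ^ (γ - 1) ≤ g s)
    (hpos : ∀ x ∈ {x : Eucl n | 0 < x l} \ Metric.closedBall 0 r₀, 0 < u x)
    (hu : IsViscositySupersolution ({x : Eucl n | 0 < x l} \ Metric.closedBall 0 r₀)
      (fun s x => ‖x‖ ^ (-γ) * g s) u) : False := by
  have : CountableInterFilter (⊤ : Filter (Eucl n)) := by
    rw [← principal_univ]
    infer_instance
  refine false_of_comparisonOn hn hγ hr₀ hc hg_zero hg_top (ℱ := ⊤) (Eventually.of_forall hpos)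
    (fun K hK hKΩ => ?_) (fun D hD hDΩ => hu.comparisonOn hD hDΩ)
    fun U _ hne => frequently_top.2 hne
  obtain ⟨c', hc', hle⟩ := exists_pos_le_of_lowerSemicontinuousOn
    (hu.lowerSemicontinuousOn.mono hKΩ) hK fun x hx => hpos x (hKΩ hx)
  exact ⟨c', hc', Eventually.of_forall hle⟩

theorem IsWeakSupersolution.false_of_ae_pos (hn : 2 ≤ n) (hγ : γ < 2) (hr₀ : 0 ≤ r₀) (hc : 0 < c)
    (hg_pos : ∀ s, 0 < s → 0 < g s)
    (hg_zero : ∀ s, 0 < s → s ≤ 1 → c * s ^ criticalExponent n γ ≤ g s)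
    (hg_top : ∀ s, 1 ≤ s → c * s ^ (γ - 1) ≤ g s)
    (hpos : ∀ᵐ x ∂(volume.restrict ({x : Eucl n | 0 < x l} \ Metric.closedBall 0 r₀)), 0 < u x)
    (hu : IsWeakSupersolution ({x : Eucl n | 0 < x l} \ Metric.closedBall 0 r₀)
      (fun s x => ‖x‖ ^ (-γ) * g s) u) : False := by
  have : NeZero n := ⟨by lia⟩
  have hΩ := isOpen_halfSpace_diff_closedBall l r₀
  have hf : ∀ s, 0 < s → ∀ x ∈ {x : Eucl n | 0 < x l} \ Metric.closedBall 0 r₀,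
      0 < ‖x‖ ^ (-γ) * g s := fun s hs x hx =>
    have hx₀ : r₀ < ‖x‖ := not_le.1 fun h => hx.2 (mem_closedBall_zero_iff.2 h)
    mul_pos (Real.rpow_pos_of_pos (hr₀.trans_lt hx₀) _) (hg_pos s hs)
  exact false_of_comparisonOn hn hγ hr₀ hc hg_zero hg_top
    ((ae_restrict_iff' hΩ.measurableSet).1 hpos)
    (fun K hK hKΩ => hu.exists_pos_le hΩ hpos hf hK hKΩ)
    (fun D hD hDΩ => hu.comparisonOn hΩ hpos hf hD hDΩ)
    fun U hU hne => frequently_ae_mem_iff.2 (hU.measure_pos volume hne).ne'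

end Nonexistence

theorem corollary5p4 (n : ℕ) (hn : 2 ≤ n) (γ : ℝ) (hγ : γ < 2) (r₀ : ℝ) (hr₀ : 0 < r₀)
    (g : ℝ → ℝ) (hg_cont : ContinuousOn g (Ioi 0)) (hg_pos : ∀ s, 0 < s → 0 < g s)
    (hg_zero : (0 : EReal) <
      liminf (fun s : ℝ => ((s ^ (-(((n : ℝ) + 1 - γ) / ((n : ℝ) - 1))) * g s : ℝ) : EReal))
        (𝓝[>] 0))
    (hg_top : (0 : EReal) <
      liminf (fun s : ℝ => ((s ^ (1 - γ) * g s : ℝ) : EReal)) atTop)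
    (Ω : Set (EuclideanSpace ℝ (Fin n)))
    (hΩ : Ω = upperHalfSpace n \ Metric.closedBall 0 r₀)
    (f : ℝ → EuclideanSpace ℝ (Fin n) → ℝ)
    (hf : f = fun s x => ‖x‖ ^ (-γ) * g s) :
    (¬ ∃ u : EuclideanSpace ℝ (Fin n) → ℝ,
      (∀ x ∈ Ω, 0 < u x) ∧ IsClassicalSupersolution Ω f u) ∧
    (¬ ∃ u : EuclideanSpace ℝ (Fin n) → ℝ,
      (∀ᵐ x ∂(volume.restrict Ω), 0 < u x) ∧ IsWeakSupersolution Ω f u) ∧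
    (¬ ∃ u : EuclideanSpace ℝ (Fin n) → ℝ,
      (∀ x ∈ Ω, 0 < u x) ∧ IsViscositySupersolution Ω f u) := by
  obtain ⟨c, hc, hzero, htop⟩ := exists_critical_lower_bound hg_cont hg_pos hg_zero hg_top
  have hl : ((⟨n - 1, by lia⟩ : Fin n) : ℕ) + 1 = n := Nat.sub_add_cancel (by lia)
  rw [upperHalfSpace_eq hl] at hΩ
  subst hΩ hf
  refine ⟨?_, ?_, ?_⟩
  · rintro ⟨u, hpos, hu⟩
    exact (hu.isViscositySupersolution (isOpen_halfSpace_diff_closedBall _ r₀)).false_of_pos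
      hn hγ hr₀.le hc hzero htop hpos
  · rintro ⟨u, hpos, hu⟩
    exact hu.false_of_ae_pos hn hγ hr₀.le hc hg_pos hzero htop hpos
  · rintro ⟨u, hpos, hu⟩
    exact hu.false_of_pos hn hγ hr₀.le hc hzero htop hpos
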